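/- Let $d\ge 1$ and consider on $\mathbb T^d=(\mathbb R/2\pi\mathbb Z)^d$ the quasi-linear Schrödinger equation $$ i u_t-\Delta u+\rho u+\Delta\Big(\frac{\partial H}{\partial \bar u}(u,\bar u)\Big)=0,\qquad H(u,\bar u)=|u|^4+\sum_{p\ge 3}\alpha_p|u|^{2p},\tag{1}$$ where $\alpha_p\in\mathbb R$ and the series for $H$ has a positive radius of convergence. **Notation.** For $b\ge 1$, $n_1,\dots,n_b\in\mathbb Z^d$ and $k\in\mathbb Z^b$ put $n_k=\sum_j k_jn_j$; $e_1,\dots,e_b$ is the standard basis of $\mathbb Z^b$; $|\cdot|$ is the Euclidean norm, $a=(a_1,\dots,a_b)\in\mathbb R^b$, and $\omega_0=(|n_1|^2+\rho,\dots,|n_b|^2+\rho)$. Fix $\kappa,\sigma>0$ and $s>b/2$. The solution $u_0=\sum_j a_je^{i n_j\cdot x+i(|n_j|^2+\rho)t}$ of the linear equation $iu_t-\Delta u+\rho u=0$ is said to *persist with frequency* $\omega\in\mathbb R^b$ if (1) has a classical solution $u(x,t)=\sum_{(n,k)\in\mathbb Z^d\times\mathbb Z^b}\hat u(n,k)e^{in\cdot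 x+i(k\cdot\omega)t}$, with values in the disc of convergence of $H$, such that $\hat u(n_j,e_j)=a_j$ for all $j$, $$\Big(\sum_{(n,k)\notin\{(n_j,e_j)\}}|\hat u(n,k)|^2\max(1,|(n,k)|)^{2s}e^{2\sigma|(n,k)|}\Big)^{1/2}<|a|^{1+\kappa},\qquad |\omega-\omega_0|<C|a|^2 ,$$ where $C$ does not depend on $a$. Write (F) for the frequency expansion $$\omega_j=|n_j|^2+\rho-|n_j|^2\Big(4\sum_{l=1}^b a_l^2-2a_j^2\Big)+O(|a|^3),\qquad j=1,\dots,b.\tag{F}$$ Let $\mathcal K=\{k\in\mathbb Z^b:\sum_jk_j=1,\ \sum_jk_j|n_j|^2=|n_k|^2\}$ and $\mathcal K_2=\mathcal K\setminus\{e_1,\dots,e_b\}$; this is a finite set if the $n_j$ are linearly independent. In that case let $A=(A_{kk'})_{k,k'\in\mathcal K_2}$ be the matrix with entries in $\mathbb Z[a_1,\dots,a_b]$ given by $A_{kk}=\sum_jk_j|n_j|^2a_j^2$ and, for $k\neq k'$, $$A_{kk'}=|n_k|^2\Big(2\sum_{(i,j):\,k+e_i-e_j=k'}a_ia_j+\sum_{(i,j):\,e_i+e_j-k=k'}a_ia_j\Big)$$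 (sums over ordered pairs). **Theorem.** There is $\kappa>0$ such that the following hold for **every** $\rho\in\mathbb R$ (no Diophantine condition), every $H$ as above, every $\sigma>0$ and every $s>b/2$. The constants $C$, the implied constants in the $O(|a|^3)$ and the smallness thresholds may depend on $n_1,\dots,n_b,\rho,H,\sigma,s$, but not on $\varepsilon$ or $a$. 1. Let $n_1,\dots,n_b\in\mathbb Z^d$ be linearly independent with $\mathcal K_2=\emptyset$. If $\varepsilon>0$ is sufficiently small, then for all $a\in[\varepsilon,2\varepsilon]^b$ the solution $u_0$ persists with a frequency satisfying (F). 2. (i) For every $n\in\mathbb Z^d$ and every real $a\ne0$ with $|a|$ small enough, the periodic solution $ae^{in\cdot x+i(|n|^2+\rho)t}$ persists with a frequency $\omega=|n|^2+\rho-2a^2|n|^2+O(|a|^3)$. (ii) If $d\ge2$ and $n_1,n_2\in\mathbb Z^d$ are not parallel, then for all sufficiently small $\varepsilon>0$ and all $a\in[\varepsilon,2\varepsilon]^2$, $u_0$ persists with a frequency satisfying (F). (iii) If $d\ge3$, $n_1,n_2,n_3\in\mathbb Z^d$ are linearly independent and for every permutation $(i,j,l)$ of $(1,2,3)$ the angle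 between $n_i-n_j$ and $n_i-n_l$ is less than $\pi/2$, then for all sufficiently small $\varepsilon>0$ and all $a\in[\varepsilon,2\varepsilon]^3$, $u_0$ persists with a frequency satisfying (F). (iv) If $|n_j|^2=M$ for all $j$, with a constant $M>0$, and $n_j\perp n_l$ for all $j\neq l$, then for all sufficiently small $\varepsilon>0$ and all $a\in[\varepsilon,2\varepsilon]^b$, $u_0$ persists with a frequency satisfying (F). 3. Let $n_1,\dots,n_b\in\mathbb Z^d$ be linearly independent such that $(n_i-n_j)\not\perp(n_i-n_l)$ for all distinct $i,j,l$, and $\det A\not\equiv0$ as a polynomial in $a_1,\dots,a_b$. Then there is $c>0$, depending only on $n_1,\dots,n_b$, such that for all sufficiently small $\varepsilon>0$ there is a measurable set $I_\varepsilon\subset[\varepsilon,2\varepsilon]^b$ with $\operatorname{mes}I_\varepsilon<\varepsilon^{b+c}$ such that for all $a\in[\varepsilon,2\varepsilon]^b\setminus I_\varepsilon$ the solution $u_0$ persists with a frequency satisfying (F). -/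

import Mathlib

namespace QuasiNLS

noncomputable section

/-! ### The gauge invariant nonlinearity -/

/-- The coefficients `α_p`, `p ≥ 3`, define a function `∑_{p ≥ 3} α_p |z|^{2p}` which is analytic
near `0`: the power series has a positive radius of convergence. -/
def AnalyticNearZero (α : ℕ → ℝ) : Prop :=
  ∃ r : ℝ, 0 < r ∧ Summable fun p : ℕ => |α (p + 3)| * r ^ (2 * (p + 3))

/-- `H(z, z̄) = |z|⁴ + ∑_{p ≥ 3} α_p |z|^{2p}`; only the values `α p` with `p ≥ 3` matter. -/
def hamiltonian (α : ℕ → ℝ) (z : ℂ) : ℂ :=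
  ((‖z‖ ^ 4 + ∑' p : ℕ, α (p + 3) * ‖z‖ ^ (2 * (p + 3)) : ℝ) : ℂ)

/-- The Wirtinger derivative `∂f/∂z̄ = (1/2) (∂f/∂x + i ∂f/∂y)` of `f : ℂ → ℂ`. -/
def dbar (f : ℂ → ℂ) (z : ℂ) : ℂ :=
  (1 / 2) * (fderiv ℝ f z 1 + Complex.I * fderiv ℝ f z Complex.I)

/-- `u : ℝ^d × ℝ → ℂ` is a classical solution of
`i u_t - Δ u + ρ u + Δ (∂H/∂ū (u, ū)) = 0` on `ℝ^d × ℝ`, with values in an open disc inside the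
disc of convergence of the series which defines `H`. -/
def IsSolution {d : ℕ} (ρ : ℝ) (α : ℕ → ℝ) (u : EuclideanSpace ℝ (Fin d) → ℝ → ℂ) : Prop :=
  ContDiff ℝ 2 (fun q : EuclideanSpace ℝ (Fin d) × ℝ => u q.1 q.2) ∧
  (∃ r : ℝ, (Summable fun p : ℕ => |α (p + 3)| * r ^ (2 * (p + 3))) ∧ ∀ x t, ‖u x t‖ < r) ∧
  ∀ x t,
    Complex.I * deriv (fun τ => u x τ) t - Laplacian.laplacian (fun y => u y t) x + ρ * u x t
      + Laplacian.laplacian (fun y => dbar (hamiltonian α) (u y t)) x = 0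

/-! ### Fourier modes and amplitudes -/

/-- `|m|²` for an integer vector. -/
def sqNorm {ι : Type*} [Fintype ι] (m : ι → ℤ) : ℤ := ∑ i, m i ^ 2

/-- An integer vector as a point of Euclidean space. -/
def toEuclid {d : ℕ} (m : Fin d → ℤ) : EuclideanSpace ℝ (Fin d) :=
  WithLp.toLp 2 fun i => (m i : ℝ)

/-- The Euclidean length `|(a_1, …, a_b)|`. -/
def vecNorm {b : ℕ} (a : Fin b → ℝ) : ℝ := √(∑ j, a j ^ 2)

/-- The standard basis vector `e_j` of `ℤ^b`. -/
def stdVec {b : ℕ} (j : Fin b) : Fin b → ℤ := Pi.single j 1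

/-- `n_k = ∑ k_j n_j`. -/
def mode {b d : ℕ} (n : Fin b → Fin d → ℤ) (k : Fin b → ℤ) : Fin d → ℤ := ∑ j, k j • n j

/-- The Euclidean length of `(m, k) ∈ ℤ^d × ℤ^b`. -/
def pairNorm {b d : ℕ} (p : (Fin d → ℤ) × (Fin b → ℤ)) : ℝ :=
  √((sqNorm p.1 + sqNorm p.2 : ℤ) : ℝ)

/-- The Fourier mode `e^{i m·x + i (k·ω) t}`, `p = (m, k)`. -/
def fourierMode {b d : ℕ} (ω : Fin b → ℝ) (p : (Fin d → ℤ) × (Fin b → ℤ))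
    (x : EuclideanSpace ℝ (Fin d)) (t : ℝ) : ℂ :=
  Complex.exp (Complex.I *
    (((∑ i, (p.1 i : ℝ) * x i) + (∑ j, (p.2 j : ℝ) * ω j) * t : ℝ) : ℂ))

/-- The square of the weighted modulus of the coefficient at `p = (m, k)`. The weight
`|p|^{2s} e^{2σ|p|}` is used with `max 1 |p|` in place of `|p|`, which only differs at `p = 0`,
where it keeps the coefficient under control. -/
def weightedSq {b d : ℕ} (σ s : ℝ) (c : (Fin d → ℤ) × (Fin b → ℤ) → ℂ)
    (p : (Fin d → ℤ) × (Fin b → ℤ)) : ℝ :=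
  ‖c p‖ ^ 2 * max 1 (pairNorm p) ^ (2 * s) * Real.exp (2 * σ * pairNorm p)

/-- The modes `(n_j, e_j)` of the unperturbed solution. -/
def tangentialModes {b d : ℕ} (n : Fin b → Fin d → ℤ) : Set ((Fin d → ℤ) × (Fin b → ℤ)) :=
  Set.range fun j => (n j, stdVec j)

/-- The unperturbed frequencies `|n_j|² + ρ`. -/
def linearFreq {b d : ℕ} (ρ : ℝ) (n : Fin b → Fin d → ℤ) (j : Fin b) : ℝ :=
  (sqNorm (n j) : ℝ) + ρ

/-- The quasi-periodic solution `∑ a_j e^{i n_j·x + i (|n_j|² + ρ) t}` of the linear equation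
persists with frequency `ω`: the nonlinear equation has a solution
`u(x,t) = ∑ c(m,k) e^{i m·x + i (k·ω) t}` with `c(n_j, e_j) = a_j`, with
`(∑_{(m,k) ≠ (n_j,e_j)} |c(m,k)|² |(m,k)|^{2s} e^{2σ|(m,k)|})^{1/2} < |a|^{1+κ}`,
and with `|ω - ω₀| < C |a|²`. -/
def Persists {b d : ℕ} (ρ : ℝ) (α : ℕ → ℝ) (n : Fin b → Fin d → ℤ) (κ σ s C : ℝ)
    (a ω : Fin b → ℝ) : Prop :=
  ∃ (u : EuclideanSpace ℝ (Fin d) → ℝ → ℂ) (c : (Fin d → ℤ) × (Fin b → ℤ) → ℂ),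
    IsSolution ρ α u ∧
    (∀ x t, HasSum (fun p => c p * fourierMode ω p x t) (u x t)) ∧
    (∀ j, c (n j, stdVec j) = (a j : ℂ)) ∧
    Summable (fun p : ↥(tangentialModes n)ᶜ => weightedSq σ s c p) ∧
    √(∑' p : ↥(tangentialModes n)ᶜ, weightedSq σ s c p) < vecNorm a ^ (1 + κ) ∧
    vecNorm (fun j => ω j - linearFreq ρ n j) < C * vecNorm a ^ 2

/-- The solution persists with a frequency that satisfies
`|ω_j - (|n_j|² + ρ - |n_j|² (4 ∑_l a_l² - 2 a_j²))| ≤ C |a|³` for all `j`. -/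
def PersistsWithShift {b d : ℕ} (ρ : ℝ) (α : ℕ → ℝ) (n : Fin b → Fin d → ℤ) (κ σ s C : ℝ)
    (a : Fin b → ℝ) : Prop :=
  ∃ ω : Fin b → ℝ, Persists ρ α n κ σ s C a ω ∧
    ∀ j, |ω j - ((sqNorm (n j) : ℝ) + ρ
      - (sqNorm (n j) : ℝ) * (4 * ∑ l, a l ^ 2 - 2 * a j ^ 2))| ≤ C * vecNorm a ^ 3

/-- For every gauge invariant nonlinearity analytic near `0`, all `σ > 0` and `s > b/2`, and all
sufficiently small `ε`: the solution persists with the frequency expansion above for all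
`(a_1, …, a_b) ∈ [ε, 2ε]^b`, the implied constants being independent of `ε` and `a`. -/
def PersistsOnBoxes {b d : ℕ} (ρ : ℝ) (n : Fin b → Fin d → ℤ) (κ : ℝ) : Prop :=
  ∀ α : ℕ → ℝ, AnalyticNearZero α → ∀ σ s : ℝ, 0 < σ → (b : ℝ) / 2 < s →
    ∃ C ε₀ : ℝ, 0 < C ∧ 0 < ε₀ ∧ ∀ ε : ℝ, 0 < ε → ε < ε₀ →
      ∀ a ∈ Set.Icc (fun _ : Fin b => ε) (fun _ => 2 * ε), PersistsWithShift ρ α n κ σ s C a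

/-! ### Resonant modes and the matrix of the resonant interactions -/

/-- The vectors `n_1, …, n_b` are linearly independent. -/
def Indep {b d : ℕ} (n : Fin b → Fin d → ℤ) : Prop :=
  LinearIndependent ℝ fun j => toEuclid (n j)

/-- The resonant modes: `∑ k_j = 1` and `∑ k_j |n_j|² = |∑ k_j n_j|²`. -/
def resonantModes {b d : ℕ} (n : Fin b → Fin d → ℤ) : Set (Fin b → ℤ) :=
  {k | ∑ j, k j = 1 ∧ ∑ j, k j * sqNorm (n j) = sqNorm (mode n k)}

/-- The nontrivial resonant modes: all those different from `e_1, …, e_b`. -/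
def resonantModes₂ {b d : ℕ} (n : Fin b → Fin d → ℤ) : Set (Fin b → ℤ) :=
  resonantModes n \ Set.range stdVec

open MvPolynomial in
/-- The matrix `A`, with entries in `ℤ[a_1, …, a_b]`: for `k ≠ k'`,
`A_{kk'} = |n_k|² (2 ∑_{k + e_i - e_j = k'} a_i a_j + ∑_{e_i + e_j - k = k'} a_i a_j)`,
with sums over ordered pairs `(i, j)`, and `A_{kk} = ∑ k_j |n_j|² a_j²`. -/
def resonanceMatrix {b d : ℕ} (n : Fin b → Fin d → ℤ) :
    Matrix (resonantModes₂ n) (resonantModes₂ n) (MvPolynomial (Fin b) ℤ) :=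
  open Classical in
  fun k k' =>
    if k = k' then ∑ j, C (k.1 j * sqNorm (n j)) * X j ^ 2
    else C (sqNorm (mode n k.1)) *
      (2 * (∑ i, ∑ j, if k.1 + stdVec i - stdVec j = k'.1 then X i * X j else 0)
        + ∑ i, ∑ j, if stdVec i + stdVec j - k.1 = k'.1 then X i * X j else 0)

theorem resonantModes₂_finite {b d : ℕ} {n : Fin b → Fin d → ℤ} (hn : Indep n) :
    (resonantModes₂ n).Finite := by
  refine Set.Finite.subset ?_ (Set.sdiff_subset (s := resonantModes n))
  let f : (Fin b → ℝ) →ₗ[ℝ] EuclideanSpace ℝ (Fin d) :=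
    Fintype.linearCombination ℝ fun j => toEuclid (n j)
  have hf : LinearMap.ker f = ⊥ := LinearMap.ker_eq_bot.2 hn.fintypeLinearCombination_injective
  obtain ⟨K, hK, hlip⟩ := f.exists_antilipschitzWith hf
  have hsq : ∀ k : Fin b → ℤ, ((sqNorm (mode n k) : ℤ) : ℝ) = ‖f fun j => (k j : ℝ)‖ ^ 2 := by
    intro k
    rw [EuclideanSpace.norm_sq_eq]
    simp [f, Fintype.linearCombination_apply, toEuclid, sqNorm, mode, Finset.sum_apply]
  set L : ℝ := ∑ j, |((sqNorm (n j) : ℤ) : ℝ)| with hL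
  have key : ∀ k ∈ resonantModes n, ‖(fun j => (k j : ℝ))‖ ≤ (K : ℝ) ^ 2 * L := by
    intro k hk
    set x : Fin b → ℝ := fun j => (k j : ℝ) with hx
    have h1 : ‖x‖ ≤ K * ‖f x‖ := by
      have := hlip.le_mul_dist x 0
      simpa using this
    have h2 : ‖f x‖ ^ 2 ≤ ‖x‖ * L := by
      rw [← hsq k, ← hk.2]
      push_cast
      rw [hL, Finset.mul_sum]
      refine Finset.sum_le_sum fun j _ => ?_
      calc (k j : ℝ) * (sqNorm (n j) : ℝ) ≤ |(k j : ℝ) * (sqNorm (n j) : ℝ)| := le_abs_self _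
        _ = |x j| * |(sqNorm (n j) : ℝ)| := abs_mul _ _
        _ ≤ ‖x‖ * |(sqNorm (n j) : ℝ)| := by
          gcongr
          exact norm_le_pi_norm x j
    have hL0 : 0 ≤ L := Finset.sum_nonneg fun _ _ => abs_nonneg _
    rcases (norm_nonneg x).eq_or_lt with h0 | h0
    · rw [← h0]; positivity
    · have h3 : ‖x‖ * ‖x‖ ≤ ‖x‖ * ((K : ℝ) ^ 2 * L) := by
        calc ‖x‖ * ‖x‖ ≤ (K * ‖f x‖) * (K * ‖f x‖) := by gcongr
          _ = (K : ℝ) ^ 2 * ‖f x‖ ^ 2 := by ring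
          _ ≤ (K : ℝ) ^ 2 * (‖x‖ * L) := by gcongr
          _ = ‖x‖ * ((K : ℝ) ^ 2 * L) := by ring
      exact le_of_mul_le_mul_left h3 h0
  refine Set.Finite.subset
    (Set.finite_Icc (fun _ : Fin b => -⌈(K : ℝ) ^ 2 * L⌉) (fun _ => ⌈(K : ℝ) ^ 2 * L⌉)) ?_
  intro k hk
  have hb : ∀ j, |(k j : ℝ)| ≤ (⌈(K : ℝ) ^ 2 * L⌉ : ℤ) := fun j =>
    ((norm_le_pi_norm (fun j => (k j : ℝ)) j).trans (key k hk)).trans (Int.le_ceil _)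
  constructor
  · intro j
    have := (abs_le.1 (hb j)).1
    exact_mod_cast this
  · intro j
    have := (abs_le.1 (hb j)).2
    exact_mod_cast this

/-- `det A`, a polynomial in `a_1, …, a_b`. -/
def resonanceDet {b d : ℕ} (n : Fin b → Fin d → ℤ) (hn : Indep n) : MvPolynomial (Fin b) ℤ :=
  open Classical in
  letI : Fintype (resonantModes₂ n) := (resonantModes₂_finite hn).fintype
  (resonanceMatrix n).det

end

end QuasiNLS

namespace QuasiNLS

noncomputable section

open scoped NNReal

/-! ### The weighted Wiener algebra on `ℤ^b` -/

/-! The solution is sought in the form u = ∑_k û(k) e^{i n_k·x + i(k·ω)t}, with real coefficients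
indexed by k ∈ ℤ^b alone and lying in a weighted ℓ¹ convolution algebra. Gauge invariance preserves
the condition ∑ k_j = 1. On this hyperplane ρ cancels, and at ω = ω₀ the linear symbol is the
integer D(k) = |n_k|² - ∑ k_j|n_j|² (`divisor`). A nonzero integer has modulus at least 1, so there
are no small divisors and no Diophantine condition is needed. If the n_j are independent, |n_k|²
grows quadratically in k, so |n_k|² and all |k_j| are O(|D(k)|) wherever D(k) ≠ 0
(`exists_divisor_bound`). Division by D thus recovers the two derivatives lost in Δ(∂H/∂ū) and also
controls the term k·(ω - ω₀). A plain contraction solves the equations at these modes.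

The modes with D(k) = 0 form the finite set 𝒦. The equation at e_j serves as the definition of ω_j,
and its leading part gives (F). On 𝒦₂ the linearised cubic term minus the leading frequency shift is
exactly 2A (`coef_cubicLin_resProj`). The cubic source term is absent there, because e_i + e_j - e_l
is nontrivially resonant only if n_l - n_i ⊥ n_l - n_j (`divisor_stdVec_add_sub`). Whenever A has an
inverse with entries at most δ/ε³, a fixed point argument yields a correction of size ε²
(`exists_solution`), and ε² < |a|^{3/2} gives κ = 1/2.

If 𝒦₂ = ∅, nothing has to be inverted. In (ii)–(iv) this emptiness follows by writing D(k) as a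
combination of the nonnegative integers z² - z with positive coefficients. In (i) the plane wave is
itself an exact solution. For the last assertion, A is homogeneous of degree two in a, so it
suffices to bound the set of y ∈ [1,2]^b with |det A(y)| ≤ μ. A nonzero polynomial has sublevel sets
of measure O(μ^γ) (`exists_volume_sublevel_le`), and μ proportional to ε is exactly what the bound
δ/ε³ requires. -/

/-- The submultiplicative weight `e^{τ |k|₁}` on `ℤ^b`. -/
def expWeight {b : ℕ} (τ : ℝ≥0) (k : Fin b → ℤ) : ℝ := Real.exp (τ * ∑ j, |(k j : ℝ)|)

section Weight

variable {b : ℕ} (τ : ℝ≥0)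

theorem expWeight_pos (k : Fin b → ℤ) : 0 < expWeight τ k := Real.exp_pos _

theorem one_le_expWeight (k : Fin b → ℤ) : 1 ≤ expWeight τ k :=
  Real.one_le_exp (mul_nonneg τ.2 (Finset.sum_nonneg fun _ _ => abs_nonneg _))

theorem expWeight_add_le (k l : Fin b → ℤ) :
    expWeight τ (k + l) ≤ expWeight τ k * expWeight τ l := by
  rw [expWeight, expWeight, expWeight, ← Real.exp_add, ← mul_add, ← Finset.sum_add_distrib]
  refine Real.exp_le_exp.2 (mul_le_mul_of_nonneg_left (Finset.sum_le_sum fun j _ => ?_) τ.2)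
  simpa using abs_add_le (k j : ℝ) (l j)

@[simp] theorem expWeight_neg (k : Fin b → ℤ) : expWeight τ (-k) = expWeight τ k := by
  simp [expWeight]

@[simp] theorem expWeight_zero : expWeight τ (0 : Fin b → ℤ) = 1 := by
  simp [expWeight]

end Weight

/-- Real sequences `f` on `ℤ^b` with `∑ |f(k)| e^{τ |k|₁} < ∞`, realised as the sequences
`k ↦ f(k) e^{τ |k|₁}` in `ℓ¹`. -/
def Wiener (b : ℕ) (τ : ℝ≥0) : Type := lp (fun _ : Fin b → ℤ => ℝ) 1

namespace Wiener

variable {b : ℕ} {τ : ℝ≥0}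

instance : NormedAddCommGroup (Wiener b τ) :=
  inferInstanceAs (NormedAddCommGroup (lp (fun _ : Fin b → ℤ => ℝ) 1))

instance : NormedSpace ℝ (Wiener b τ) :=
  inferInstanceAs (NormedSpace ℝ (lp (fun _ : Fin b → ℤ => ℝ) 1))

instance : CompleteSpace (Wiener b τ) :=
  inferInstanceAs (CompleteSpace (lp (fun _ : Fin b → ℤ => ℝ) 1))

/-- The sequence supported at `k` with value `1`. -/
def delta (k : Fin b → ℤ) : Wiener b τ :=
  (lp.single 1 k (expWeight τ k) : lp (fun _ : Fin b → ℤ => ℝ) 1)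

/-- The underlying element of `ℓ¹`. -/
def toL1 (f : Wiener b τ) : lp (fun _ : Fin b → ℤ => ℝ) 1 := f

/-- The value of the sequence `f` at `k`. -/
def coef (k : Fin b → ℤ) (f : Wiener b τ) : ℝ := toL1 f k / expWeight τ k

theorem norm_delta (k : Fin b → ℤ) : ‖(delta k : Wiener b τ)‖ = expWeight τ k := by
  have := lp.norm_single (E := fun _ : Fin b → ℤ => ℝ) (p := 1) (by simp) k (expWeight τ k)
  rw [Real.norm_of_nonneg (expWeight_pos τ k).le] at this
  exact this

theorem hasSum_norm (f : Wiener b τ) : HasSum (fun k => |coef k f| * expWeight τ k) ‖f‖ := by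
  have h := lp.hasSum_norm (p := 1) (by simp) (toL1 f)
  simp only [ENNReal.toReal_one, Real.rpow_one] at h
  refine h.congr_fun fun k => ?_
  rw [coef, abs_div, abs_of_pos (expWeight_pos τ k), div_mul_cancel₀ _ (expWeight_pos τ k).ne',
    Real.norm_eq_abs]

theorem hasSum_coef_smul_delta (f : Wiener b τ) : HasSum (fun k => coef k f • delta k) f := by
  have h := lp.hasSum_single (p := 1) (by simp) (toL1 f)
  refine HasSum.congr_fun (f := fun k => (lp.single 1 k
    (toL1 f k) : lp (fun _ : Fin b → ℤ => ℝ) 1)) h fun k => ?_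
  have h2 : (coef k f • (delta k : Wiener b τ)) = (lp.single 1 k (coef k f • expWeight τ k) :
      lp (fun _ : Fin b → ℤ => ℝ) 1) := (lp.single_smul 1 k _ _).symm
  rw [h2, coef, smul_eq_mul, div_mul_cancel₀ _ (expWeight_pos τ k).ne']

theorem abs_coef_mul_le (k : Fin b → ℤ) (f : Wiener b τ) : |coef k f| * expWeight τ k ≤ ‖f‖ :=
  le_hasSum (hasSum_norm f) k fun l _ => mul_nonneg (abs_nonneg _) (expWeight_pos τ l).le

theorem abs_coef_le (k : Fin b → ℤ) (f : Wiener b τ) : |coef k f| ≤ ‖f‖ :=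
  (le_mul_of_one_le_right (abs_nonneg _) (one_le_expWeight τ k)).trans (abs_coef_mul_le k f)

theorem coef_add (k : Fin b → ℤ) (f g : Wiener b τ) : coef k (f + g) = coef k f + coef k g :=
  add_div _ _ _

theorem coef_smul (k : Fin b → ℤ) (c : ℝ) (f : Wiener b τ) : coef k (c • f) = c * coef k f :=
  mul_div_assoc _ _ _

/-- The coefficient at `k` as a continuous linear functional. -/
def coefL (k : Fin b → ℤ) : Wiener b τ →L[ℝ] ℝ :=
  LinearMap.mkContinuous
    { toFun := coef k
      map_add' := coef_add k
      map_smul' := coef_smul k } 1 fun f => by simpa using abs_coef_le k f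

@[simp] theorem coefL_apply (k : Fin b → ℤ) (f : Wiener b τ) : coefL k f = coef k f := rfl

theorem coef_sub (k : Fin b → ℤ) (f g : Wiener b τ) : coef k (f - g) = coef k f - coef k g :=
  map_sub (coefL k) f g

theorem coef_sum {ι : Type*} (k : Fin b → ℤ) (s : Finset ι) (f : ι → Wiener b τ) :
    coef k (∑ i ∈ s, f i) = ∑ i ∈ s, coef k (f i) :=
  map_sum (coefL k) f s

@[simp] theorem coef_zero (k : Fin b → ℤ) : coef k (0 : Wiener b τ) = 0 := map_zero (coefL k)

theorem coef_delta (k l : Fin b → ℤ) :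
    coef k (delta l : Wiener b τ) = if k = l then 1 else 0 := by
  rw [coef]
  split_ifs with h
  · subst h
    rw [div_eq_one_iff_eq (expWeight_pos τ k).ne']
    exact lp.single_apply_self (E := fun _ : Fin b → ℤ => ℝ) 1 k _
  · rw [div_eq_zero_iff]
    exact Or.inl (lp.single_apply_ne (E := fun _ : Fin b → ℤ => ℝ) 1 l _ h)

@[ext] theorem ext {f g : Wiener b τ} (h : ∀ k, coef k f = coef k g) : f = g := by
  refine (hasSum_coef_smul_delta f).unique ?_
  simpa only [h] using hasSum_coef_smul_delta g

/-! ### Linear maps determined by their values on `delta k`. -/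

section Lift

variable {X : Type*} [NormedAddCommGroup X] [NormedSpace ℝ X]

/-- The `delta k` span a dense subspace. All algebraic identities of the convolution algebra are
reduced by this lemma to identities between indices in ℤ^b. -/
theorem continuousLinearMap_ext {φ ψ : Wiener b τ →L[ℝ] X} (h : ∀ k, φ (delta k) = ψ (delta k)) :
    φ = ψ := by
  ext f
  refine ((hasSum_coef_smul_delta f).mapL φ).unique ?_
  refine ((hasSum_coef_smul_delta f).mapL ψ).congr_fun fun k => ?_
  rw [map_smul, map_smul, h]

variable [CompleteSpace X]

theorem summable_lift {x : (Fin b → ℤ) → X} {M : ℝ} (hx : ∀ k, ‖x k‖ ≤ M * expWeight τ k)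
    (f : Wiener b τ) : Summable fun k => coef k f • x k := by
  refine Summable.of_norm_bounded ((hasSum_norm f).summable.mul_left M) fun k => ?_
  rw [norm_smul, Real.norm_eq_abs]
  calc |coef k f| * ‖x k‖ ≤ |coef k f| * (M * expWeight τ k) := by gcongr; exact hx k
    _ = _ := by ring

/-- The universal property of `ℓ¹`: a family `x k` with `‖x k‖ ≤ M e^{τ |k|₁}` defines a continuous
linear map that sends `delta k` to `x k`. -/
def lift (x : (Fin b → ℤ) → X) (M : ℝ) (hx : ∀ k, ‖x k‖ ≤ M * expWeight τ k) :
    Wiener b τ →L[ℝ] X :=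
  LinearMap.mkContinuous
    { toFun := fun f => ∑' k, coef k f • x k
      map_add' := fun f g => by
        rw [← (summable_lift hx f).tsum_add (summable_lift hx g)]
        simp only [coef_add, add_smul]
      map_smul' := fun c f => by
        rw [RingHom.id_apply, ← tsum_const_smul'']
        simp only [coef_smul, mul_smul] } M fun f => by
    refine tsum_of_norm_bounded ((hasSum_norm f).mul_left M) fun k => ?_
    rw [norm_smul, Real.norm_eq_abs]
    calc |coef k f| * ‖x k‖ ≤ |coef k f| * (M * expWeight τ k) := by gcongr; exact hx k
      _ = _ := by ring

variable {x : (Fin b → ℤ) → X} {M : ℝ} (hx : ∀ k, ‖x k‖ ≤ M * expWeight τ k)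

theorem hasSum_lift (f : Wiener b τ) : HasSum (fun k => coef k f • x k) (lift x M hx f) :=
  (summable_lift hx f).hasSum

@[simp] theorem lift_delta (k : Fin b → ℤ) : lift x M hx (delta k) = x k := by
  refine (hasSum_lift hx (delta k)).unique ?_
  convert hasSum_ite_eq k (x k) using 2 with l
  rw [coef_delta]
  split_ifs with h
  · rw [h, one_smul]
  · rw [zero_smul]

theorem norm_lift_le : ‖lift x M hx‖ ≤ M :=
  LinearMap.mkContinuous_norm_le _ (by simpa using (norm_nonneg _).trans (hx 0)) _

theorem norm_lift_apply_le (f : Wiener b τ) : ‖lift x M hx f‖ ≤ M * ‖f‖ :=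
  (lift x M hx).le_of_opNorm_le (norm_lift_le hx) f

end Lift

/-! ### Convolution -/

/-- Convolution, as a continuous bilinear map. -/
def convolution : Wiener b τ →L[ℝ] Wiener b τ →L[ℝ] Wiener b τ :=
  lift (fun k => lift (fun l => delta (k + l)) (expWeight τ k)
      fun l => by rw [norm_delta]; exact expWeight_add_le τ k l) 1
    fun k => by rw [one_mul]; exact norm_lift_le _

@[simp] theorem convolution_delta (k l : Fin b → ℤ) :
    convolution (delta k) (delta l) = (delta (k + l) : Wiener b τ) := by
  simp [convolution]

instance : Mul (Wiener b τ) := ⟨fun f g => convolution f g⟩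

instance : One (Wiener b τ) := ⟨delta 0⟩

theorem one_def : (1 : Wiener b τ) = delta 0 := rfl

@[simp] theorem delta_mul_delta (k l : Fin b → ℤ) :
    (delta k : Wiener b τ) * delta l = delta (k + l) := convolution_delta k l

theorem wiener_mul_comm (f g : Wiener b τ) : f * g = g * f := by
  have h : convolution = (convolution : Wiener b τ →L[ℝ] Wiener b τ →L[ℝ] Wiener b τ).flip :=
    continuousLinearMap_ext fun k => continuousLinearMap_ext fun l => by
      rw [ContinuousLinearMap.flip_apply, convolution_delta, convolution_delta, add_comm]
  exact DFunLike.congr_fun (DFunLike.congr_fun h f) g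

theorem wiener_one_mul (f : Wiener b τ) : 1 * f = f := by
  have h : convolution (delta 0 : Wiener b τ) = ContinuousLinearMap.id ℝ _ :=
    continuousLinearMap_ext fun k => by simp
  exact DFunLike.congr_fun h f

theorem wiener_mul_assoc (f g h : Wiener b τ) : f * g * h = f * (g * h) := by
  -- Both bracketings as continuous trilinear maps, so that they can be compared on triples of
  -- deltas.
  let Φ : Wiener b τ →L[ℝ] Wiener b τ →L[ℝ] Wiener b τ →L[ℝ] Wiener b τ :=
    (ContinuousLinearMap.compL ℝ _ _ _ convolution).comp convolution
  let Ψ : Wiener b τ →L[ℝ] Wiener b τ →L[ℝ] Wiener b τ →L[ℝ] Wiener b τ :=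
    ((ContinuousLinearMap.compL ℝ (Wiener b τ) (Wiener b τ) (Wiener b τ)).flip.comp
      convolution).flip.comp convolution
  have hΦ : ∀ f g h, Φ f g h = f * g * h := fun _ _ _ => rfl
  have hΨ : ∀ f g h, Ψ f g h = f * (g * h) := fun _ _ _ => rfl
  have e : Φ = Ψ := continuousLinearMap_ext fun k => continuousLinearMap_ext fun l =>
    continuousLinearMap_ext fun m => by
      rw [hΦ, hΨ]
      simp [add_assoc]
  rw [← hΦ, e, hΨ]

theorem norm_convolution_le (f g : Wiener b τ) : ‖f * g‖ ≤ ‖f‖ * ‖g‖ := by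
  have h : ‖(convolution : Wiener b τ →L[ℝ] Wiener b τ →L[ℝ] Wiener b τ)‖ ≤ 1 := norm_lift_le _
  calc ‖convolution f g‖ ≤ ‖convolution f‖ * ‖g‖ := (convolution f).le_opNorm g
    _ ≤ 1 * ‖f‖ * ‖g‖ := by gcongr; exact convolution.le_of_opNorm_le h f
    _ = _ := by rw [one_mul]

instance : CommRing (Wiener b τ) where
  left_distrib f g h := map_add (convolution f) g h
  right_distrib f g h := by
    change convolution (f + g) h = convolution f h + convolution g h
    rw [map_add, add_apply]
  zero_mul f := by
    change convolution 0 f = 0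
    rw [map_zero, zero_apply]
  mul_zero f := map_zero (convolution f)
  mul_assoc := wiener_mul_assoc
  one_mul := wiener_one_mul
  mul_one f := by rw [wiener_mul_comm, wiener_one_mul]
  mul_comm := wiener_mul_comm
  zsmul := (inferInstance : NormedAddCommGroup (Wiener b τ)).zsmul
  zsmul_zero' := (inferInstance : NormedAddCommGroup (Wiener b τ)).zsmul_zero'
  zsmul_succ' := (inferInstance : NormedAddCommGroup (Wiener b τ)).zsmul_succ'
  zsmul_neg' := (inferInstance : NormedAddCommGroup (Wiener b τ)).zsmul_neg'
  neg_add_cancel := neg_add_cancel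

instance : NormedCommRing (Wiener b τ) where
  dist_eq := (inferInstance : NormedAddCommGroup (Wiener b τ)).dist_eq
  norm_mul_le := norm_convolution_le
  mul_comm := mul_comm

instance : NormedAlgebra ℝ (Wiener b τ) where
  toAlgebra := Algebra.ofModule
    (fun r f g => by
      change convolution (r • f) g = r • convolution f g
      rw [map_smul, smul_apply])
    (fun r f g => map_smul (convolution f) r g)
  norm_smul_le := norm_smul_le

theorem coef_delta_mul (k l : Fin b → ℤ) (f : Wiener b τ) :
    coef l (delta k * f) = coef (l - k) f := by
  have h : (coefL l).comp (convolution (delta k : Wiener b τ)) = coefL (l - k) :=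
    continuousLinearMap_ext fun m => by
      simp [coef_delta, sub_eq_iff_eq_add, add_comm]
  exact DFunLike.congr_fun h f

theorem hasSum_coef_mul (l : Fin b → ℤ) (f g : Wiener b τ) :
    HasSum (fun k => coef k f * coef (l - k) g) (coef l (f * g)) := by
  have h := (hasSum_coef_smul_delta f).mapL ((coefL l).comp (convolution.flip g))
  refine h.congr_fun fun k => ?_
  rw [map_smul, ← coef_delta_mul]
  rfl

/-! ### Conjugation, multipliers, evaluation and the grading -/

/-- The sequence `k ↦ f(-k)`: the Fourier coefficients of the complex conjugate. -/
def reflect : Wiener b τ →L[ℝ] Wiener b τ :=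
  lift (fun k => delta (-k)) 1 fun k => by rw [norm_delta, expWeight_neg, one_mul]

@[simp] theorem reflect_delta (k : Fin b → ℤ) : reflect (delta k : Wiener b τ) = delta (-k) := by
  simp [reflect]

theorem norm_reflect_le (f : Wiener b τ) : ‖reflect f‖ ≤ ‖f‖ :=
  (norm_lift_apply_le _ f).trans_eq (one_mul _)

theorem coef_reflect (k : Fin b → ℤ) (f : Wiener b τ) : coef k (reflect f) = coef (-k) f := by
  have h : (coefL k).comp (reflect : Wiener b τ →L[ℝ] Wiener b τ) = coefL (-k) :=
    continuousLinearMap_ext fun m => by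
      simp [coef_delta, neg_eq_iff_eq_neg]
  exact DFunLike.congr_fun h f

/-- The multiplier `f(k) ↦ m(k) f(k)` with a bounded symbol. -/
def multiplier (m : (Fin b → ℤ) → ℝ) (M : ℝ) (hm : ∀ k, |m k| ≤ M) : Wiener b τ →L[ℝ] Wiener b τ :=
  lift (fun k => m k • delta k) M fun k => by
    rw [norm_smul, norm_delta, Real.norm_eq_abs]
    exact mul_le_mul_of_nonneg_right (hm k) (expWeight_pos τ k).le

theorem coef_multiplier {m : (Fin b → ℤ) → ℝ} {M : ℝ} (hm : ∀ k, |m k| ≤ M) (k : Fin b → ℤ)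
    (f : Wiener b τ) : coef k (multiplier m M hm f) = m k * coef k f := by
  have h : (coefL k).comp (multiplier m M hm : Wiener b τ →L[ℝ] Wiener b τ) = m k • coefL k :=
    continuousLinearMap_ext fun l => by
      simp only [ContinuousLinearMap.comp_apply, multiplier, lift_delta, coefL_apply, coef_smul,
        coef_delta, smul_apply, smul_eq_mul]
      split_ifs with h
      · rw [h]
      · simp
  exact DFunLike.congr_fun h f

theorem norm_multiplier_apply_le {m : (Fin b → ℤ) → ℝ} {M : ℝ} (hm : ∀ k, |m k| ≤ M)
    (f : Wiener b τ) : ‖multiplier m M hm f‖ ≤ M * ‖f‖ :=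
  norm_lift_apply_le _ f

/-- The character `e^{i k·θ}`. -/
def character (θ : Fin b → ℝ) (k : Fin b → ℤ) : ℂ :=
  Complex.exp (Complex.I * ((∑ j, (k j : ℝ) * θ j : ℝ) : ℂ))

theorem norm_character (θ : Fin b → ℝ) (k : Fin b → ℤ) : ‖character θ k‖ = 1 := by
  rw [character, mul_comm]
  exact Complex.norm_exp_ofReal_mul_I _

theorem character_add (θ : Fin b → ℝ) (k l : Fin b → ℤ) :
    character θ (k + l) = character θ k * character θ l := by
  rw [character, character, character, ← Complex.exp_add, ← mul_add, ← Complex.ofReal_add,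
    ← Finset.sum_add_distrib]
  simp [add_mul]

theorem character_neg (θ : Fin b → ℝ) (k : Fin b → ℤ) :
    character θ (-k) = (starRingEnd ℂ) (character θ k) := by
  rw [character, character, ← Complex.exp_conj, map_mul, Complex.conj_I, Complex.conj_ofReal]
  simp

theorem norm_character_le (θ : Fin b → ℝ) (k : Fin b → ℤ) :
    ‖character θ k‖ ≤ 1 * expWeight τ k := by
  rw [norm_character, one_mul]
  exact one_le_expWeight τ k

/-- The value at `θ` of the Fourier series with coefficients `f`. -/
def eval (θ : Fin b → ℝ) : Wiener b τ →L[ℝ] ℂ :=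
  lift (character θ) 1 (norm_character_le θ)

theorem eval_delta (θ : Fin b → ℝ) (k : Fin b → ℤ) :
    eval θ (delta k : Wiener b τ) = character θ k := lift_delta _ k

theorem hasSum_eval (θ : Fin b → ℝ) (f : Wiener b τ) :
    HasSum (fun k => (coef k f : ℂ) * character θ k) (eval θ f) :=
  hasSum_lift (norm_character_le θ) f

theorem norm_eval_le (θ : Fin b → ℝ) (f : Wiener b τ) : ‖eval θ f‖ ≤ ‖f‖ :=
  (norm_lift_apply_le _ f).trans_eq (one_mul _)

theorem eval_mul (θ : Fin b → ℝ) (f g : Wiener b τ) : eval θ (f * g) = eval θ f * eval θ g := by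
  have h : (ContinuousLinearMap.compL ℝ (Wiener b τ) (Wiener b τ) ℂ (eval θ)).comp convolution =
      ((ContinuousLinearMap.mul ℝ ℂ).flip.comp (eval θ)).flip.comp (eval θ) :=
    continuousLinearMap_ext fun k => continuousLinearMap_ext fun l => by
      simp [eval_delta, character_add, mul_comm]
  exact DFunLike.congr_fun (DFunLike.congr_fun h f) g

theorem eval_one (θ : Fin b → ℝ) : eval θ (1 : Wiener b τ) = 1 := by
  rw [one_def, eval_delta]
  simp [character]

theorem eval_pow (θ : Fin b → ℝ) (f : Wiener b τ) (m : ℕ) : eval θ (f ^ m) = eval θ f ^ m := by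
  induction m with
  | zero => simp [eval_one]
  | succ m ih => rw [pow_succ, pow_succ, eval_mul, ih]

theorem eval_reflect (θ : Fin b → ℝ) (f : Wiener b τ) :
    eval θ (reflect f) = (starRingEnd ℂ) (eval θ f) := by
  have h : (eval θ).comp (reflect : Wiener b τ →L[ℝ] Wiener b τ) =
      Complex.conjCLE.toContinuousLinearMap.comp (eval θ) :=
    continuousLinearMap_ext fun k => by
      simp [eval_delta, character_neg]
  exact DFunLike.congr_fun h f

/-- The sequences supported on `∑ k_j = m`. -/
def graded (m : ℤ) : Submodule ℝ (Wiener b τ) where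
  carrier := {f | ∀ k : Fin b → ℤ, ∑ j, k j ≠ m → coef k f = 0}
  zero_mem' := fun k _ => coef_zero k
  add_mem' := fun {f g} hf hg k hk => by rw [coef_add, hf k hk, hg k hk, add_zero]
  smul_mem' := fun c f hf k hk => by rw [coef_smul, hf k hk, mul_zero]

theorem delta_mem_graded {m : ℤ} {k : Fin b → ℤ} (hk : ∑ j, k j = m) :
    (delta k : Wiener b τ) ∈ graded m := fun l hl => by
  rw [coef_delta, if_neg]
  rintro rfl
  exact hl hk

/-- In a nonzero term of the convolution k has degree m and l - k has degree m', so l has degree m +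
m'. Since `reflect` reverses the degree, |u|^{2m}u stays in degree 1; this is gauge invariance. -/
theorem mul_mem_graded {m m' : ℤ} {f g : Wiener b τ} (hf : f ∈ graded m) (hg : g ∈ graded m') :
    f * g ∈ graded (m + m') := fun l hl => by
  refine (hasSum_coef_mul l f g).unique (hasSum_zero.congr_fun fun k => ?_)
  by_cases hk : ∑ j, k j = m
  · rw [hg (l - k), mul_zero]
    simp only [Pi.sub_apply, Finset.sum_sub_distrib]
    lia
  · rw [hf k hk, zero_mul]

theorem reflect_mem_graded {m : ℤ} {f : Wiener b τ} (hf : f ∈ graded m) :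
    reflect f ∈ graded (-m) := fun k hk => by
  rw [coef_reflect]
  refine hf _ ?_
  simp only [Pi.neg_apply, Finset.sum_neg_distrib]
  lia

theorem tsum_mem_graded {ι : Type*} {m : ℤ} {f : ι → Wiener b τ} (hs : Summable f)
    (hf : ∀ i, f i ∈ graded m) : ∑' i, f i ∈ graded m := fun k hk => by
  have := hs.hasSum.mapL (coefL k)
  exact this.unique (hasSum_zero.congr_fun fun i => hf i k hk)

end Wiener

end

end QuasiNLS

namespace QuasiNLS

noncomputable section

open scoped NNReal

/-! ### The nonlinearity on the Wiener algebra -/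

/-- A radius `r₁` in the interior of the disc of convergence, with a bound for the derivatives. -/
theorem AnalyticNearZero.exists_radius {α : ℕ → ℝ} (hα : AnalyticNearZero α) :
    ∃ r r₁ : ℝ, 0 < r₁ ∧ r₁ < r ∧ (Summable fun p : ℕ => |α (p + 3)| * r ^ (2 * (p + 3))) ∧
      Summable fun p : ℕ => |(p + 3) * α (p + 3)| * (2 * p + 5) * r₁ ^ (2 * p) := by
  obtain ⟨r, hr, hs⟩ := hα
  refine ⟨r, r / 2, half_pos hr, half_lt_self hr, hs, ?_⟩
  -- Halving the radius gains 4^p, which absorbs the polynomial factor from differentiation; 15 is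
  -- the value at p = 0.
  have hpow : ∀ p : ℕ, ((p : ℝ) + 3) * (2 * p + 5) ≤ 15 * 4 ^ p := by
    intro p
    induction p with
    | zero => norm_num
    | succ p ih =>
      push_cast
      have : (0 : ℝ) ≤ p := p.cast_nonneg
      rw [pow_succ]
      nlinarith
  refine Summable.of_nonneg_of_le (fun p => by positivity) (fun p => ?_) (hs.mul_left (15 / r ^ 6))
  rw [abs_mul, abs_of_nonneg (by positivity : (0 : ℝ) ≤ p + 3), div_pow, pow_mul 2,
    show (2 : ℝ) ^ 2 = 4 by norm_num]
  calc ((p : ℝ) + 3) * |α (p + 3)| * (2 * p + 5) * (r ^ (2 * p) / 4 ^ p)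
      = (((p : ℝ) + 3) * (2 * p + 5) / 4 ^ p) * (|α (p + 3)| * r ^ (2 * p)) := by ring
    _ ≤ 15 * (|α (p + 3)| * r ^ (2 * p)) := by
      gcongr
      exact (div_le_iff₀ (by positivity)).2 (hpow p)
    _ = 15 / r ^ 6 * (|α (p + 3)| * r ^ (2 * (p + 3))) := by
      rw [mul_add, pow_add]
      field_simp

namespace Wiener

variable {b : ℕ} {τ : ℝ≥0}

/-! ### Monomials and their Lipschitz estimates. -/

/-- The monomial `|u|^{2m} u`. -/
def monomial (m : ℕ) (u : Wiener b τ) : Wiener b τ := (u * reflect u) ^ m * u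

theorem monomial_succ (m : ℕ) (u : Wiener b τ) :
    monomial (m + 1) u = u * reflect u * monomial m u := by
  rw [monomial, monomial, pow_succ]
  ring

theorem norm_mul_reflect_le {R : ℝ} {u : Wiener b τ} (hu : ‖u‖ ≤ R) : ‖u * reflect u‖ ≤ R ^ 2 := by
  have h0 := norm_nonneg u
  calc ‖u * reflect u‖ ≤ ‖u‖ * ‖reflect u‖ := norm_mul_le _ _
    _ ≤ R * R := mul_le_mul hu ((norm_reflect_le u).trans hu) (norm_nonneg _) (h0.trans hu)
    _ = R ^ 2 := by ring

theorem norm_monomial_le {R : ℝ} {u : Wiener b τ} (hu : ‖u‖ ≤ R) (m : ℕ) :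
    ‖monomial m u‖ ≤ R ^ (2 * m + 1) := by
  induction m with
  | zero => simpa [monomial] using hu
  | succ m ih =>
    rw [monomial_succ]
    calc _ ≤ ‖u * reflect u‖ * ‖monomial m u‖ := norm_mul_le _ _
      _ ≤ R ^ 2 * R ^ (2 * m + 1) := by
        gcongr
        exact norm_mul_reflect_le hu
      _ = _ := by ring

theorem norm_mul_reflect_sub_le {R : ℝ} {u v : Wiener b τ} (hu : ‖u‖ ≤ R) (hv : ‖v‖ ≤ R) :
    ‖u * reflect u - v * reflect v‖ ≤ 2 * R * ‖u - v‖ := by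
  have hR : 0 ≤ R := (norm_nonneg _).trans hu
  have e : u * reflect u - v * reflect v = u * reflect (u - v) + (u - v) * reflect v := by
    rw [map_sub]; ring
  rw [e]
  calc _ ≤ ‖u * reflect (u - v)‖ + ‖(u - v) * reflect v‖ := norm_add_le _ _
    _ ≤ ‖u‖ * ‖reflect (u - v)‖ + ‖u - v‖ * ‖reflect v‖ :=
      add_le_add (norm_mul_le _ _) (norm_mul_le _ _)
    _ ≤ R * ‖u - v‖ + ‖u - v‖ * R := by
      gcongr
      · exact norm_reflect_le _
      · exact (norm_reflect_le _).trans hv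
    _ = _ := by ring

/-- Telescoping one factor u · `reflect u` at a time. The constant is the derivative of x^{2m+1} at
R. -/
theorem norm_monomial_sub_le {R : ℝ} {u v : Wiener b τ} (hu : ‖u‖ ≤ R) (hv : ‖v‖ ≤ R) (m : ℕ) :
    ‖monomial m u - monomial m v‖ ≤ (2 * m + 1) * R ^ (2 * m) * ‖u - v‖ := by
  have hR : 0 ≤ R := (norm_nonneg _).trans hu
  induction m with
  | zero => simp [monomial]
  | succ m ih =>
    have h1 := norm_mul_reflect_sub_le hu hv
    have e : monomial (m + 1) u - monomial (m + 1) v =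
        u * reflect u * (monomial m u - monomial m v) +
          (u * reflect u - v * reflect v) * monomial m v := by
      rw [monomial_succ, monomial_succ]; ring
    rw [e]
    calc _ ≤ ‖u * reflect u * (monomial m u - monomial m v)‖ +
          ‖(u * reflect u - v * reflect v) * monomial m v‖ := norm_add_le _ _
      _ ≤ ‖u * reflect u‖ * ‖monomial m u - monomial m v‖ +
          ‖u * reflect u - v * reflect v‖ * ‖monomial m v‖ :=
        add_le_add (norm_mul_le _ _) (norm_mul_le _ _)
      _ ≤ R ^ 2 * ((2 * m + 1) * R ^ (2 * m) * ‖u - v‖) + 2 * R * ‖u - v‖ * R ^ (2 * m + 1) := by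
        gcongr
        · exact norm_mul_reflect_le hu
        · exact norm_monomial_le hv m
      _ = _ := by push_cast; ring

theorem monomial_mem_graded {u : Wiener b τ} (hu : u ∈ graded 1) (m : ℕ) :
    monomial m u ∈ graded 1 := by
  induction m with
  | zero => simpa [monomial] using hu
  | succ m ih =>
    rw [monomial_succ]
    have := mul_mem_graded (mul_mem_graded hu (reflect_mem_graded hu)) ih
    simpa using this

theorem eval_monomial (θ : Fin b → ℝ) (m : ℕ) (u : Wiener b τ) :
    eval θ (monomial m u) = ((‖eval θ u‖ ^ (2 * m) : ℝ) : ℂ) * eval θ u := by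
  rw [monomial, eval_mul, eval_pow, eval_mul, eval_reflect, Complex.mul_conj,
    Complex.normSq_eq_norm_sq, pow_mul, ← Complex.ofReal_pow]

/-- The part of order at least five of the nonlinearity. -/
def quintic (α : ℕ → ℝ) (u : Wiener b τ) : Wiener b τ :=
  ∑' p : ℕ, ((p + 3) * α (p + 3)) • monomial (p + 2) u

/-- The nonlinearity `∂H/∂ū`. -/
def nonlinearity (α : ℕ → ℝ) (u : Wiener b τ) : Wiener b τ :=
  (2 : ℝ) • monomial 1 u + quintic α u

section Estimates

variable {α : ℕ → ℝ} {r₁ R : ℝ} {u v : Wiener b τ}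

theorem summable_quintic (hr : 0 < r₁)
    (hs : Summable fun p : ℕ => |(p + 3) * α (p + 3)| * (2 * p + 5) * r₁ ^ (2 * p))
    (hu : ‖u‖ ≤ r₁) : Summable fun p : ℕ => ((p + 3) * α (p + 3)) • monomial (p + 2) u := by
  refine Summable.of_norm_bounded (hs.mul_left (r₁ ^ 5)) fun p => ?_
  rw [norm_smul, Real.norm_eq_abs]
  calc |(p + 3) * α (p + 3)| * ‖monomial (p + 2) u‖
      ≤ |(p + 3) * α (p + 3)| * r₁ ^ (2 * (p + 2) + 1) := by
        gcongr
        exact norm_monomial_le hu _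
    _ = |(p + 3) * α (p + 3)| * 1 * r₁ ^ (2 * p) * r₁ ^ 5 := by ring
    _ ≤ |(p + 3) * α (p + 3)| * (2 * p + 5) * r₁ ^ (2 * p) * r₁ ^ 5 := by
        gcongr
        have : (0 : ℝ) ≤ p := p.cast_nonneg
        linarith
    _ = _ := by ring

/-- The monomial of degree 2p+5 has Lipschitz constant (2p+5)R^{2p+4}. Splitting off R⁴ and
enlarging R to r₁ in the rest leaves a convergent series independent of R. -/
theorem norm_quintic_sub_le (hr : 0 < r₁)
    (hs : Summable fun p : ℕ => |(p + 3) * α (p + 3)| * (2 * p + 5) * r₁ ^ (2 * p))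
    (hR : R ≤ r₁) (hu : ‖u‖ ≤ R) (hv : ‖v‖ ≤ R) :
    ‖quintic α u - quintic α v‖ ≤
      (∑' p : ℕ, |(p + 3) * α (p + 3)| * (2 * p + 5) * r₁ ^ (2 * p)) * R ^ 4 * ‖u - v‖ := by
  have hR0 : 0 ≤ R := (norm_nonneg _).trans hu
  rw [quintic, quintic, ← (summable_quintic hr hs (hu.trans hR)).tsum_sub
    (summable_quintic hr hs (hv.trans hR)), mul_assoc]
  refine tsum_of_norm_bounded (hs.hasSum.mul_right (R ^ 4 * ‖u - v‖)) fun p => ?_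
  rw [← smul_sub, norm_smul, Real.norm_eq_abs]
  calc |(p + 3) * α (p + 3)| * ‖monomial (p + 2) u - monomial (p + 2) v‖
      ≤ |(p + 3) * α (p + 3)| * ((2 * (p + 2 : ℕ) + 1) * R ^ (2 * (p + 2)) * ‖u - v‖) := by
        gcongr
        exact norm_monomial_sub_le hu hv _
    _ = |(p + 3) * α (p + 3)| * (2 * p + 5) * R ^ (2 * p) * (R ^ 4 * ‖u - v‖) := by
        push_cast; ring
    _ ≤ _ := by gcongr

theorem quintic_zero : quintic α (0 : Wiener b τ) = 0 := by
  simp [quintic, monomial]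

theorem norm_quintic_le (hr : 0 < r₁)
    (hs : Summable fun p : ℕ => |(p + 3) * α (p + 3)| * (2 * p + 5) * r₁ ^ (2 * p))
    (hR : R ≤ r₁) (hu : ‖u‖ ≤ R) :
    ‖quintic α u‖ ≤
      (∑' p : ℕ, |(p + 3) * α (p + 3)| * (2 * p + 5) * r₁ ^ (2 * p)) * R ^ 5 := by
  have hR0 : 0 ≤ R := (norm_nonneg _).trans hu
  have h := norm_quintic_sub_le hr hs hR hu (v := 0) (by simpa using hR0)
  rw [quintic_zero, sub_zero, sub_zero] at h
  refine h.trans ?_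
  have : 0 ≤ (∑' p : ℕ, |(p + 3) * α (p + 3)| * (2 * p + 5) * r₁ ^ (2 * p)) :=
    tsum_nonneg fun p => by positivity
  calc _ ≤ (∑' p : ℕ, |(p + 3) * α (p + 3)| * (2 * p + 5) * r₁ ^ (2 * p)) * R ^ 4 * R := by gcongr
    _ = _ := by ring

theorem nonlinearity_mem_graded (hr : 0 < r₁)
    (hs : Summable fun p : ℕ => |(p + 3) * α (p + 3)| * (2 * p + 5) * r₁ ^ (2 * p))
    (hu : ‖u‖ ≤ r₁) (hg : u ∈ graded 1) : nonlinearity α u ∈ graded 1 :=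
  Submodule.add_mem _ (Submodule.smul_mem _ _ (monomial_mem_graded hg 1))
    (tsum_mem_graded (summable_quintic hr hs hu) fun _ =>
      Submodule.smul_mem _ _ (monomial_mem_graded hg _))

end Estimates

end Wiener

/-- H is a function h of y = |z|², and ∂(|z|²)/∂z̄ = z, so the derivative is h'(|z|²)z. The series
for h is differentiated term by term in y on the ball of radius r₁². -/
theorem dbar_hamiltonian {α : ℕ → ℝ} {r₁ : ℝ} (hr : 0 < r₁)
    (hs : Summable fun p : ℕ => |(p + 3) * α (p + 3)| * (2 * p + 5) * r₁ ^ (2 * p))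
    {z : ℂ} (hz : ‖z‖ < r₁) :
    dbar (hamiltonian α) z =
      ((2 * ‖z‖ ^ 2 + ∑' p : ℕ, (p + 3) * α (p + 3) * ‖z‖ ^ (2 * (p + 2)) : ℝ) : ℂ) * z := by
  set h' : ℝ := 2 * ‖z‖ ^ 2 + ∑' p : ℕ, (p + 3) * α (p + 3) * ‖z‖ ^ (2 * (p + 2)) with hh'
  have hz2 : ‖z‖ ^ 2 ∈ Metric.ball (0 : ℝ) (r₁ ^ 2) := by
    rw [mem_ball_zero_iff, Real.norm_of_nonneg (by positivity)]
    gcongr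
  have hder : HasDerivAt (fun y : ℝ => ∑' p : ℕ, α (p + 3) * y ^ (p + 3))
      (∑' p : ℕ, α (p + 3) * (((p + 3 : ℕ) : ℝ) * (‖z‖ ^ 2) ^ (p + 3 - 1))) (‖z‖ ^ 2) := by
    refine hasDerivAt_tsum_of_isPreconnected (hs.mul_left (r₁ ^ 4)) Metric.isOpen_ball
      (convex_ball (0 : ℝ) (r₁ ^ 2)).isPreconnected
      (fun p y _ => (hasDerivAt_pow (p + 3) y).const_mul (α (p + 3))) (fun p y hy => ?_)
      (Metric.mem_ball_self (by positivity)) (by simp) hz2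
    rw [mem_ball_zero_iff] at hy
    have e : α (p + 3) * (((p + 3 : ℕ) : ℝ) * y ^ (p + 3 - 1)) =
        (p + 3) * α (p + 3) * y ^ (p + 2) := by
      rw [show p + 3 - 1 = p + 2 by lia]
      push_cast
      ring
    rw [e, norm_mul, norm_pow, Real.norm_eq_abs]
    calc |(p + 3) * α (p + 3)| * ‖y‖ ^ (p + 2)
        ≤ |(p + 3) * α (p + 3)| * (r₁ ^ 2) ^ (p + 2) := by gcongr
      _ = |(p + 3) * α (p + 3)| * 1 * r₁ ^ (2 * p) * r₁ ^ 4 := by ring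
      _ ≤ |(p + 3) * α (p + 3)| * (2 * p + 5) * r₁ ^ (2 * p) * r₁ ^ 4 := by
          gcongr
          have : (0 : ℝ) ≤ p := p.cast_nonneg
          linarith
      _ = _ := by ring
  have hsum : ∑' p : ℕ, α (p + 3) * (((p + 3 : ℕ) : ℝ) * (‖z‖ ^ 2) ^ (p + 3 - 1)) =
      ∑' p : ℕ, (p + 3) * α (p + 3) * ‖z‖ ^ (2 * (p + 2)) := by
    refine tsum_congr fun p => ?_
    rw [show p + 3 - 1 = p + 2 by lia, pow_mul]
    push_cast
    ring
  have hfull : HasDerivAt (fun y : ℝ => y ^ 2 + ∑' p : ℕ, α (p + 3) * y ^ (p + 3)) h'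
      (‖z‖ ^ 2) := by
    refine ((hasDerivAt_pow 2 (‖z‖ ^ 2)).fun_add hder).congr_deriv ?_
    rw [hsum, hh']
    norm_num
  have hF : HasFDerivAt (hamiltonian α)
      (Complex.ofRealCLM.comp (h' • ((2 : ℕ) • innerSL ℝ z))) z := by
    have h1 := hfull.comp_hasFDerivAt z (hasStrictFDerivAt_norm_sq z).hasFDerivAt
    refine (Complex.ofRealCLM.hasFDerivAt.comp z h1).congr_of_eventuallyEq
      (Filter.Eventually.of_forall fun w => ?_)
    simp only [hamiltonian, Function.comp_apply, Complex.ofRealCLM_apply]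
    congr 2
    · ring
    · exact tsum_congr fun p => by rw [pow_mul]
  rw [dbar, hF.fderiv]
  apply Complex.ext <;> simp [Complex.inner] <;> ring

namespace Wiener

variable {b : ℕ} {τ : ℝ≥0} {α : ℕ → ℝ} {r₁ : ℝ} {u : Wiener b τ}

/-- Evaluation at θ is multiplicative and turns `reflect` into complex conjugation, so the
nonlinearity of the algebra becomes the pointwise one. -/
theorem eval_nonlinearity (hr : 0 < r₁)
    (hs : Summable fun p : ℕ => |(p + 3) * α (p + 3)| * (2 * p + 5) * r₁ ^ (2 * p))
    (hu : ‖u‖ < r₁) (θ : Fin b → ℝ) :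
    eval θ (nonlinearity α u) = dbar (hamiltonian α) (eval θ u) := by
  rw [dbar_hamiltonian hr hs ((norm_eval_le θ u).trans_lt hu), nonlinearity, quintic, map_add,
    map_smul, ContinuousLinearMap.map_tsum _ (summable_quintic hr hs hu.le)]
  simp only [map_smul, eval_monomial, Complex.real_smul]
  push_cast
  rw [add_mul, ← tsum_mul_right]
  congr 1
  · ring
  · exact tsum_congr fun p => by ring

end Wiener

end

end QuasiNLS

namespace QuasiNLS

noncomputable section

open scoped NNReal

/-! ### Quasi-periodic functions -/

section Oscillation

variable {E : Type*} [NormedAddCommGroup E] [NormedSpace ℝ E]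

theorem iteratedDeriv_exp_I (m : ℕ) (c : ℂ) (s : ℝ) :
    iteratedDeriv m (fun s : ℝ => c * Complex.exp (Complex.I * s)) s =
      Complex.I ^ m * (c * Complex.exp (Complex.I * s)) := by
  induction m generalizing s with
  | zero => simp
  | succ m ih =>
    rw [iteratedDeriv_succ, funext ih]
    have h1 : HasDerivAt (fun s : ℝ => Complex.I * (s : ℂ)) Complex.I s := by
      simpa using (Complex.ofRealCLM.hasDerivAt (x := s)).const_mul Complex.I
    rw [((h1.cexp.const_mul c).const_mul (Complex.I ^ m)).deriv]
    ring

theorem contDiff_exp_I (m : ℕ∞) (c : ℂ) :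
    ContDiff ℝ m fun s : ℝ => c * Complex.exp (Complex.I * s) :=
  contDiff_const.mul (contDiff_const.mul Complex.ofRealCLM.contDiff).cexp

/-- A function of ℓ(x) alone: the chain rule for the linear map ℓ reduces the claim to one real
variable. -/
theorem iteratedFDeriv_exp_I (m : ℕ) (c : ℂ) (ℓ : E →L[ℝ] ℝ) (x : E) (v : Fin m → E) :
    iteratedFDeriv ℝ m (fun x => c * Complex.exp (Complex.I * (ℓ x : ℝ))) x v =
      (∏ i, (ℓ (v i) : ℂ)) * (Complex.I ^ m * (c * Complex.exp (Complex.I * (ℓ x : ℝ)))) := by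
  have h := ℓ.iteratedFDeriv_comp_right (contDiff_exp_I m c) x (i := m) le_rfl
  have h' := congrArg (fun T => T v) h
  simp only [ContinuousMultilinearMap.compContinuousLinearMap_apply] at h'
  rw [iteratedFDeriv_apply_eq_iteratedDeriv_mul_prod, iteratedDeriv_exp_I,
    Complex.real_smul] at h'
  push_cast at h'
  exact h'

theorem norm_iteratedFDeriv_exp_I_le (m : ℕ) (c : ℂ) (ℓ : E →L[ℝ] ℝ) (x : E) :
    ‖iteratedFDeriv ℝ m (fun x => c * Complex.exp (Complex.I * (ℓ x : ℝ))) x‖ ≤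
      ‖c‖ * ‖ℓ‖ ^ m := by
  refine ContinuousMultilinearMap.opNorm_le_bound (by positivity) fun v => ?_
  rw [iteratedFDeriv_exp_I, norm_mul, norm_mul, norm_mul, norm_pow, Complex.norm_I, one_pow,
    mul_comm Complex.I, Complex.norm_exp_ofReal_mul_I, norm_prod, one_mul, mul_one, mul_comm,
    mul_assoc]
  gcongr
  calc ∏ i, ‖(ℓ (v i) : ℂ)‖ ≤ ∏ i : Fin m, ‖ℓ‖ * ‖v i‖ := by
        gcongr with i
        rw [Complex.norm_real]
        exact ℓ.le_opNorm _
    _ = _ := by simp [Finset.prod_mul_distrib]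

end Oscillation

namespace Wiener

variable {b : ℕ} {τ : ℝ≥0} {E : Type*} [NormedAddCommGroup E] [NormedSpace ℝ E]

/-- Affine phases L_j x + φ_j on a general space E allow one argument for derivatives in space, in
time and in space-time. -/
theorem eval_eq_tsum (L : Fin b → E →L[ℝ] ℝ) (φ : Fin b → ℝ) (f : Wiener b τ) (x : E) :
    eval (fun j => L j x + φ j) f =
      ∑' k, (coef k f * character φ k) *
        Complex.exp (Complex.I * ((∑ j, (k j : ℝ) • L j) x : ℝ)) := by
  rw [← (hasSum_eval _ f).tsum_eq]
  refine tsum_congr fun k => ?_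
  rw [mul_assoc, character, character, ← Complex.exp_add, ← mul_add, ← Complex.ofReal_add]
  congr 5
  simp [mul_add, Finset.sum_add_distrib, add_comm]

/-- Up to two derivatives cost at most (1 + CS)² ≤ 2 + 2C²S², with S = |k|₁. The weight pays for
this through e^{τS} ≥ (τS)²/2, hence the constant 2 + 4C²/τ². -/
theorem summable_moment (hτ : 0 < τ) (L : Fin b → E →L[ℝ] ℝ) (φ : Fin b → ℝ) (f : Wiener b τ)
    {m : ℕ} (hm : m ≤ 2) :
    Summable fun k => ‖(coef k f * character φ k : ℂ)‖ * ‖∑ j, (k j : ℝ) • L j‖ ^ m := by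
  set C : ℝ := ∑ j, ‖L j‖ with hC
  have hτ' : (0 : ℝ) < τ := hτ
  refine Summable.of_nonneg_of_le (fun k => by positivity) (fun k => ?_)
    ((hasSum_norm f).summable.mul_right (2 + 4 * C ^ 2 / τ ^ 2))
  rw [norm_mul, norm_character, mul_one, Complex.norm_real, Real.norm_eq_abs, mul_assoc]
  gcongr
  set S : ℝ := ∑ j, |(k j : ℝ)| with hS
  have hS0 : 0 ≤ S := Finset.sum_nonneg fun _ _ => abs_nonneg _
  have hC0 : 0 ≤ C := Finset.sum_nonneg fun _ _ => norm_nonneg _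
  have h1 : ‖∑ j, (k j : ℝ) • L j‖ ≤ C * S := by
    refine (norm_sum_le _ _).trans ?_
    rw [hC, Finset.sum_mul]
    refine Finset.sum_le_sum fun j _ => ?_
    rw [norm_smul, Real.norm_eq_abs, mul_comm]
    gcongr
    exact Finset.single_le_sum (f := fun j => |(k j : ℝ)|) (fun _ _ => abs_nonneg _)
      (Finset.mem_univ j)
  have h2 : ‖∑ j, (k j : ℝ) • L j‖ ^ m ≤ (1 + C * S) ^ 2 :=
    calc _ ≤ (1 + C * S) ^ m := by gcongr; linarith
      _ ≤ (1 + C * S) ^ 2 := pow_le_pow_right₀ (by nlinarith [mul_nonneg hC0 hS0]) hm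
  have h3 := Real.quadratic_le_exp_of_nonneg (mul_nonneg hτ'.le hS0)
  have h4 : 0 < expWeight τ k := expWeight_pos τ k
  change _ ≤ Real.exp (τ * S) at h3
  change _ ≤ Real.exp (τ * S) * _
  have h5 : C ^ 2 / τ ^ 2 * (τ * S) ^ 2 = (C * S) ^ 2 := by field_simp
  have h6 : C ^ 2 / τ ^ 2 * (1 + τ * S + (τ * S) ^ 2 / 2) ≤ C ^ 2 / τ ^ 2 * Real.exp (τ * S) := by
    gcongr
  have h7 : 0 ≤ C ^ 2 / τ ^ 2 * (1 + τ * S) := by positivity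
  have h8 : 0 ≤ τ * S := by positivity
  rw [mul_add, mul_add] at h6
  rw [mul_add] at h7
  have h9 : Real.exp (τ * S) * (4 * C ^ 2 / τ ^ 2) = 4 * (C ^ 2 / τ ^ 2 * Real.exp (τ * S)) := by
    ring
  rw [mul_add, h9]
  nlinarith [sq_nonneg (1 - C * S)]

theorem contDiff_eval (hτ : 0 < τ) (L : Fin b → E →L[ℝ] ℝ) (φ : Fin b → ℝ) (f : Wiener b τ) :
    ContDiff ℝ 2 fun x => eval (fun j => L j x + φ j) f := by
  simp only [eval_eq_tsum]
  refine contDiff_tsum (N := 2)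
    (v := fun m k => ‖(coef k f * character φ k : ℂ)‖ * ‖∑ j, (k j : ℝ) • L j‖ ^ m)
    (fun k => ?_) (fun m hm => summable_moment hτ L φ f (by exact_mod_cast hm))
    fun m k x _ => norm_iteratedFDeriv_exp_I_le m _ _ x
  exact (contDiff_exp_I 2 _).comp (ContinuousLinearMap.contDiff _)

theorem hasSum_iteratedFDeriv_eval (hτ : 0 < τ) (L : Fin b → E →L[ℝ] ℝ) (φ : Fin b → ℝ)
    (f : Wiener b τ) {m : ℕ} (hm : m ≤ 2) (x : E) (v : Fin m → E) :
    HasSum (fun k => (coef k f : ℂ) * (Complex.I ^ m * ∏ i, ((∑ j, (k j : ℝ) * L j (v i) : ℝ) : ℂ)) *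
        character (fun j => L j x + φ j) k)
      (iteratedFDeriv ℝ m (fun x => eval (fun j => L j x + φ j) f) x v) := by
  have hb := summable_moment hτ L φ f hm
  have hc : ∀ k, ContDiff ℝ (2 : ℕ∞) fun x => (coef k f * character φ k) *
      Complex.exp (Complex.I * ((∑ j, (k j : ℝ) • L j) x : ℝ)) := fun k =>
    (contDiff_exp_I 2 _).comp (ContinuousLinearMap.contDiff _)
  simp only [eval_eq_tsum]
  rw [iteratedFDeriv_tsum_apply (N := 2)
    (v := fun m k => ‖(coef k f * character φ k : ℂ)‖ * ‖∑ j, (k j : ℝ) • L j‖ ^ m)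
    hc
    (fun m hm => summable_moment hτ L φ f (by exact_mod_cast hm))
    (fun m k x _ => norm_iteratedFDeriv_exp_I_le m _ _ x) (by exact_mod_cast hm)]
  have hs : Summable fun k => iteratedFDeriv ℝ m (fun x => (coef k f * character φ k) *
      Complex.exp (Complex.I * ((∑ j, (k j : ℝ) • L j) x : ℝ))) x :=
    Summable.of_norm_bounded hb fun k => norm_iteratedFDeriv_exp_I_le m _ _ x
  have h := hs.hasSum.mapL (ContinuousMultilinearMap.apply ℝ (fun _ : Fin m => E) ℂ v)
  refine h.congr_fun fun k => ?_
  rw [ContinuousMultilinearMap.apply_apply, iteratedFDeriv_exp_I]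
  have e : character (fun j => L j x + φ j) k =
      character φ k * Complex.exp (Complex.I * ((∑ j, (k j : ℝ) • L j) x : ℝ)) := by
    rw [character, character, ← Complex.exp_add, ← mul_add, ← Complex.ofReal_add]
    congr 3
    simp [mul_add, Finset.sum_add_distrib, add_comm]
  rw [e]
  simp only [sum_apply, smul_apply, smul_eq_mul]
  ring

end Wiener

/-! ### From the equations for the coefficients to solutions -/

section Solution

variable {b d : ℕ} {τ : ℝ≥0} (n : Fin b → Fin d → ℤ) (ω : Fin b → ℝ)

/-- The linear functional `x ↦ m·x`. -/
def phaseSpace (m : Fin d → ℤ) : EuclideanSpace ℝ (Fin d) →L[ℝ] ℝ :=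
  ∑ i, (m i : ℝ) • EuclideanSpace.proj i

theorem phaseSpace_apply (m : Fin d → ℤ) (x : EuclideanSpace ℝ (Fin d)) :
    phaseSpace m x = ∑ i, (m i : ℝ) * x i := by
  simp [phaseSpace]

/-- The angles `n_j·x + ω_j t`. -/
def phase (x : EuclideanSpace ℝ (Fin d)) (t : ℝ) (j : Fin b) : ℝ := phaseSpace (n j) x + ω j * t

theorem sum_mul_phaseSpace (k : Fin b → ℤ) (x : EuclideanSpace ℝ (Fin d)) :
    ∑ j, (k j : ℝ) * phaseSpace (n j) x = phaseSpace (mode n k) x := by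
  simp only [phaseSpace_apply, mode, Finset.sum_apply, Pi.smul_apply, smul_eq_mul, Int.cast_sum,
    Int.cast_mul, Finset.mul_sum, Finset.sum_mul]
  rw [Finset.sum_comm]
  simp only [mul_assoc]

theorem fourierMode_eq_character (k : Fin b → ℤ) (x : EuclideanSpace ℝ (Fin d)) (t : ℝ) :
    fourierMode ω (mode n k, k) x t = Wiener.character (phase n ω x t) k := by
  rw [fourierMode, Wiener.character]
  congr 3
  simp only [phase, mul_add, Finset.sum_add_distrib, sum_mul_phaseSpace]
  simp only [phaseSpace_apply, Finset.sum_mul, mul_assoc]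

theorem hasSum_laplacian_eval (hτ : 0 < τ) (f : Wiener b τ) (x : EuclideanSpace ℝ (Fin d)) (t : ℝ) :
    HasSum (fun k => (Wiener.coef k f : ℂ) * (-(sqNorm (mode n k) : ℂ)) *
        Wiener.character (phase n ω x t) k)
      (Laplacian.laplacian (fun y => Wiener.eval (phase n ω y t) f) x) := by
  rw [InnerProductSpace.laplacian_eq_iteratedFDeriv_orthonormalBasis _
    (EuclideanSpace.basisFun (Fin d) ℝ)]
  have h := hasSum_sum (s := Finset.univ) fun i _ =>
    Wiener.hasSum_iteratedFDeriv_eval hτ (fun j => phaseSpace (n j)) (fun j => ω j * t) f le_rfl x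
    ![EuclideanSpace.basisFun (Fin d) ℝ i, EuclideanSpace.basisFun (Fin d) ℝ i]
  refine h.congr_fun fun k => ?_
  rw [← Finset.sum_mul, ← Finset.mul_sum, ← Finset.mul_sum]
  have hI : Complex.I ^ 2 = -1 := Complex.I_sq
  rw [hI]
  simp only [Fin.prod_univ_two, Matrix.cons_val_zero, Matrix.cons_val_one, sum_mul_phaseSpace]
  congr 2
  simp [phaseSpace_apply, sqNorm, sq]

theorem hasSum_deriv_eval (hτ : 0 < τ) (f : Wiener b τ) (x : EuclideanSpace ℝ (Fin d)) (t : ℝ) :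
    HasSum (fun k => (Wiener.coef k f : ℂ) * (Complex.I * ((∑ j, (k j : ℝ) * ω j : ℝ) : ℂ)) *
        Wiener.character (phase n ω x t) k)
      (deriv (fun s => Wiener.eval (phase n ω x s) f) t) := by
  have h := Wiener.hasSum_iteratedFDeriv_eval hτ
    (fun j => ω j • ContinuousLinearMap.id ℝ ℝ) (fun j => phaseSpace (n j) x) f
    one_le_two t (fun _ : Fin 1 => (1 : ℝ))
  rw [← iteratedDeriv_eq_iteratedFDeriv, iteratedDeriv_one] at h
  have e : ∀ s, (fun j => (ω j • ContinuousLinearMap.id ℝ ℝ) s + phaseSpace (n j) x) =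
      phase n ω x s := fun s => by
    ext j
    simp [phase, add_comm]
  simp only [e] at h
  simpa using h

/-- All Fourier series involved may be differentiated term by term, so the left-hand side of the
equation is a series whose coefficients are those in `heq`. -/
theorem isSolution_of_coef {ρ : ℝ} {α : ℕ → ℝ} {r r₁ : ℝ} (hr : 0 < r₁) (hrr : r₁ < r)
    (hsr : Summable fun p : ℕ => |α (p + 3)| * r ^ (2 * (p + 3)))
    (hs : Summable fun p : ℕ => |(p + 3) * α (p + 3)| * (2 * p + 5) * r₁ ^ (2 * p))
    (hτ : 0 < τ) {u : Wiener b τ} (hu : ‖u‖ < r₁)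
    (heq : ∀ k, (-(∑ j, (k j : ℝ) * ω j) + (sqNorm (mode n k) : ℝ) + ρ) * Wiener.coef k u -
      (sqNorm (mode n k) : ℝ) * Wiener.coef k (Wiener.nonlinearity α u) = 0) :
    IsSolution ρ α fun x t => Wiener.eval (phase n ω x t) u := by
  refine ⟨?_, ⟨r, hsr, fun x t => (Wiener.norm_eval_le _ u).trans_lt (hu.trans hrr)⟩,
    fun x t => ?_⟩
  · have h := Wiener.contDiff_eval hτ (E := EuclideanSpace ℝ (Fin d) × ℝ)
      (fun j => (phaseSpace (n j)).comp (ContinuousLinearMap.fst ℝ _ _) +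
        ω j • ContinuousLinearMap.snd ℝ _ _) 0 u
    convert h using 4 with q
    ext j
    simp [phase]
  · simp only [← Wiener.eval_nonlinearity hr hs hu]
    have h := ((((hasSum_deriv_eval n ω hτ u x t).mul_left Complex.I).sub
      (hasSum_laplacian_eval n ω hτ u x t)).add
      ((Wiener.hasSum_eval (phase n ω x t) u).mul_left (ρ : ℂ))).add
      (hasSum_laplacian_eval n ω hτ (Wiener.nonlinearity α u) x t)
    refine h.unique (hasSum_zero.congr_fun fun k => ?_)
    have hk := congrArg (fun y : ℝ => (y : ℂ)) (heq k)
    push_cast at hk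
    have hI : Complex.I * Complex.I = -1 := Complex.I_mul_I
    push_cast
    linear_combination (Wiener.character (phase n ω x t) k) * hk +
      (Wiener.coef k u : ℂ) * (∑ j, (k j : ℂ) * (ω j : ℂ)) *
        Wiener.character (phase n ω x t) k * hI

end Solution

end

end QuasiNLS

namespace QuasiNLS

noncomputable section

open scoped NNReal

/-! ### Persistence from a solution in the Wiener algebra -/

section Persistence

variable {b d : ℕ} {τ : ℝ≥0}

/-- The sequence `∑ a_j δ_{e_j}` of the unperturbed solution. -/
def tangent (a : Fin b → ℝ) : Wiener b τ := ∑ j, a j • Wiener.delta (stdVec j)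

theorem stdVec_injective : Function.Injective (stdVec : Fin b → Fin b → ℤ) := fun i j h => by
  by_contra hij
  have := congrFun h i
  simp [stdVec, hij] at this

theorem sum_stdVec (j : Fin b) : ∑ i, stdVec j i = 1 := by
  simp [stdVec]

theorem mode_stdVec (n : Fin b → Fin d → ℤ) (j : Fin b) : mode n (stdVec j) = n j := by
  rw [mode, Finset.sum_eq_single j] <;> simp +contextual [stdVec]

theorem coef_tangent (a : Fin b → ℝ) (k : Fin b → ℤ) :
    Wiener.coef k (tangent a : Wiener b τ) = ∑ j, if k = stdVec j then a j else 0 := by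
  simp [tangent, Wiener.coef_sum, Wiener.coef_smul, Wiener.coef_delta]

theorem coef_tangent_stdVec (a : Fin b → ℝ) (j : Fin b) :
    Wiener.coef (stdVec j) (tangent a : Wiener b τ) = a j := by
  simp [coef_tangent, stdVec_injective.eq_iff]

theorem coef_tangent_of_notMem (a : Fin b → ℝ) {k : Fin b → ℤ} (hk : k ∉ Set.range stdVec) :
    Wiener.coef k (tangent a : Wiener b τ) = 0 := by
  rw [coef_tangent]
  exact Finset.sum_eq_zero fun j _ => if_neg fun h => hk ⟨j, h.symm⟩

theorem tangent_mem_graded (a : Fin b → ℝ) : (tangent a : Wiener b τ) ∈ Wiener.graded 1 :=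
  Submodule.sum_mem _ fun j _ =>
    Submodule.smul_mem _ _ (Wiener.delta_mem_graded (sum_stdVec j))

theorem expWeight_stdVec (j : Fin b) : expWeight τ (stdVec j) = Real.exp τ := by
  rw [expWeight, Finset.sum_eq_single j]
  · simp [stdVec]
  · intro i _ hi
    simp [stdVec, hi]
  · simp

theorem norm_tangent_le {a : Fin b → ℝ} {R : ℝ} (ha : ∀ j, |a j| ≤ R) :
    ‖(tangent a : Wiener b τ)‖ ≤ b * Real.exp τ * R := by
  refine (norm_sum_le _ _).trans ((Finset.sum_le_card_nsmul _ _ (R * Real.exp τ)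
    fun j _ => ?_).trans_eq ?_)
  · rw [norm_smul, Wiener.norm_delta, expWeight_stdVec, Real.norm_eq_abs]
    gcongr
    exact ha j
  · simp
    ring

/-- For a suitable exponent, the weight of the Wiener algebra dominates the Sobolev-Gevrey weight
on the pairs `(n_k, k)`. -/
theorem exists_expWeight (n : Fin b → Fin d → ℤ) {σ s : ℝ} (hσ : 0 < σ) (hs : 0 ≤ s) :
    ∃ τ : ℝ≥0, 0 < τ ∧ ∀ k : Fin b → ℤ,
      max 1 (pairNorm (mode n k, k)) ^ s * Real.exp (σ * pairNorm (mode n k, k)) ≤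
        expWeight τ k := by
  set N : ℝ := ∑ j, ∑ i, |(n j i : ℝ)| with hN
  have hN0 : 0 ≤ N := Finset.sum_nonneg fun _ _ => Finset.sum_nonneg fun _ _ => abs_nonneg _
  -- With P = |(n_k, k)| one has P ≤ (N + 1)|k|₁ and max(1, P) ≤ e^P, so the whole weight is at most
  -- e^{(s+σ)P}.
  have hτ : 0 < (s + σ) * (N + 1) := by positivity
  refine ⟨⟨(s + σ) * (N + 1), hτ.le⟩, hτ, fun k => ?_⟩
  set S : ℝ := ∑ j, |(k j : ℝ)| with hS
  have hS0 : 0 ≤ S := Finset.sum_nonneg fun _ _ => abs_nonneg _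
  have hsq : ∀ {m : ℕ} (y : Fin m → ℤ), ((sqNorm y : ℤ) : ℝ) ≤ (∑ i, |(y i : ℝ)|) ^ 2 := by
    intro m y
    rw [sqNorm]
    push_cast
    calc ∑ i, (y i : ℝ) ^ 2 = ∑ i, |(y i : ℝ)| ^ 2 := by simp
      _ ≤ _ := Finset.sum_sq_le_sq_sum_of_nonneg fun _ _ => abs_nonneg _
  have hmode : ∑ i, |(mode n k i : ℝ)| ≤ N * S := by
    calc ∑ i, |(mode n k i : ℝ)| ≤ ∑ i, ∑ j, |(k j : ℝ)| * |(n j i : ℝ)| := by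
          refine Finset.sum_le_sum fun i _ => ?_
          simp only [mode, Finset.sum_apply, Pi.smul_apply, smul_eq_mul, Int.cast_sum,
            Int.cast_mul]
          refine (Finset.abs_sum_le_sum_abs _ _).trans_eq ?_
          simp only [abs_mul]
      _ = ∑ j, |(k j : ℝ)| * ∑ i, |(n j i : ℝ)| := by
          rw [Finset.sum_comm]
          simp only [Finset.mul_sum]
      _ ≤ ∑ j, |(k j : ℝ)| * N := by
          gcongr with j
          exact Finset.single_le_sum (f := fun j => ∑ i, |(n j i : ℝ)|)
            (fun _ _ => Finset.sum_nonneg fun _ _ => abs_nonneg _) (Finset.mem_univ j)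
      _ = N * S := by rw [← Finset.sum_mul, mul_comm]
  have hp : pairNorm (mode n k, k) ≤ (N + 1) * S := by
    rw [pairNorm]
    refine Real.sqrt_le_iff.2 ⟨by positivity, ?_⟩
    push_cast
    have h1 := hsq (mode n k)
    have h2 := hsq k
    have h3 : (∑ i, |(mode n k i : ℝ)|) ^ 2 ≤ (N * S) ^ 2 := by gcongr
    nlinarith [mul_nonneg hN0 (sq_nonneg S)]
  have hp0 : 0 ≤ pairNorm (mode n k, k) := Real.sqrt_nonneg _
  calc max 1 (pairNorm (mode n k, k)) ^ s * Real.exp (σ * pairNorm (mode n k, k))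
      ≤ Real.exp (pairNorm (mode n k, k)) ^ s * Real.exp (σ * pairNorm (mode n k, k)) := by
        gcongr
        refine max_le (Real.one_le_exp hp0) ?_
        linarith [Real.add_one_le_exp (pairNorm (mode n k, k))]
    _ = Real.exp ((s + σ) * pairNorm (mode n k, k)) := by
        rw [← Real.exp_mul, ← Real.exp_add]
        ring_nf
    _ ≤ Real.exp ((s + σ) * ((N + 1) * S)) := by gcongr
    _ = _ := congrArg Real.exp (mul_assoc _ _ _).symm

/-- The Fourier coefficients live on the graph k ↦ (n_k, k), and the weighted ℓ² norm off the
tangential modes is dominated by the weighted ℓ¹ norm of v. -/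
theorem persists_of_isSolution {n : Fin b → Fin d → ℤ} {ρ κ σ s C : ℝ} {α : ℕ → ℝ}
    {a ω : Fin b → ℝ}
    (hw : ∀ k : Fin b → ℤ, max 1 (pairNorm (mode n k, k)) ^ s *
      Real.exp (σ * pairNorm (mode n k, k)) ≤ expWeight τ k)
    {v : Wiener b τ} (hv : ∀ j, Wiener.coef (stdVec j) v = 0)
    (hsol : IsSolution ρ α fun x t => Wiener.eval (phase n ω x t) (tangent a + v))
    (hva : ‖v‖ < vecNorm a ^ (1 + κ))
    (hω : vecNorm (fun j => ω j - linearFreq ρ n j) < C * vecNorm a ^ 2) :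
    Persists ρ α n κ σ s C a ω := by
  classical
  let g : (Fin b → ℤ) → (Fin d → ℤ) × (Fin b → ℤ) := fun k => (mode n k, k)
  have hg : Function.Injective g := fun k l h => congrArg Prod.snd h
  have hrange : ∀ p : (Fin d → ℤ) × (Fin b → ℤ), p ∉ Set.range g → p.1 ≠ mode n p.2 :=
    fun p hp h => hp ⟨p.2, Prod.ext h.symm rfl⟩
  refine ⟨_, fun p => if p.1 = mode n p.2 then (Wiener.coef p.2 (tangent a + v) : ℂ) else 0, hsol,
    fun x t => ?_, fun j => ?_, ?_⟩
  · refine (hg.hasSum_iff fun p hp => ?_).1 ?_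
    · simp only [if_neg (hrange p hp), zero_mul]
    · refine (Wiener.hasSum_eval (phase n ω x t) (tangent a + v)).congr_fun fun k => ?_
      simp only [Function.comp_apply, g, if_true, fourierMode_eq_character]
  · simp [mode_stdVec, Wiener.coef_add, hv, coef_tangent_stdVec]
  · set y : (Fin d → ℤ) × (Fin b → ℤ) → ℝ := fun p =>
      if p.1 = mode n p.2 then |Wiener.coef p.2 v| * expWeight τ p.2 else 0 with hy
    have hysum : HasSum y ‖v‖ := by
      refine (hg.hasSum_iff fun p hp => ?_).1 ?_
      · simp only [hy, if_neg (hrange p hp)]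
      · refine (Wiener.hasSum_norm v).congr_fun fun k => ?_
        simp [hy, g]
    have hy0 : ∀ p, 0 ≤ y p := fun p => by
      simp only [hy]
      split_ifs
      · exact mul_nonneg (abs_nonneg _) (expWeight_pos τ _).le
      · exact le_rfl
    -- Each y p is at most ∑ y = ‖v‖, hence (y p)² ≤ ‖v‖ · y p; summing gives the passage from ℓ¹ to
    -- ℓ².
    have hle : ∀ p : ↥(tangentialModes n)ᶜ, weightedSq σ s (fun p =>
        if p.1 = mode n p.2 then (Wiener.coef p.2 (tangent a + v) : ℂ) else 0) p ≤
        ‖v‖ * y p := by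
      rintro ⟨⟨m, k⟩, hp⟩
      have hyv : y (m, k) ≤ ‖v‖ := le_hasSum hysum _ fun p _ => hy0 p
      refine le_trans ?_ (mul_le_mul_of_nonneg_right hyv (hy0 _))
      simp only [hy, weightedSq]
      split_ifs with h
      · have hk : k ∉ Set.range stdVec := by
          rintro ⟨j, rfl⟩
          exact hp ⟨j, Prod.ext (by rw [h, mode_stdVec]) rfl⟩
        rw [Wiener.coef_add, coef_tangent_of_notMem a hk, zero_add, Complex.norm_real,
          Real.norm_eq_abs, h]
        set P := pairNorm (mode n k, k)
        have hM : (0 : ℝ) ≤ max 1 P := zero_le_one.trans (le_max_left _ _)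
        have e : max 1 P ^ (2 * s) * Real.exp (2 * σ * P) = (max 1 P ^ s * Real.exp (σ * P)) ^ 2 := by
          rw [mul_pow, mul_comm 2 s, Real.rpow_mul hM, ← Real.exp_nat_mul]
          norm_num [mul_assoc]
        rw [mul_assoc, e]
        have h0 : 0 ≤ max 1 P ^ s * Real.exp (σ * P) := by positivity
        calc _ ≤ |Wiener.coef k v| ^ 2 * expWeight τ k ^ 2 := by
              gcongr
              exact hw k
          _ = _ := by ring
      · simp
    have h0 : ∀ p : ↥(tangentialModes n)ᶜ, 0 ≤ weightedSq σ s (fun p =>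
        if p.1 = mode n p.2 then (Wiener.coef p.2 (tangent a + v) : ℂ) else 0) p := fun p => by
      have : (0 : ℝ) ≤ max 1 (pairNorm p.1) := zero_le_one.trans (le_max_left _ _)
      rw [weightedSq]
      positivity
    have hS : Summable fun p : ↥(tangentialModes n)ᶜ => ‖v‖ * y p :=
      (hysum.summable.subtype _).mul_left _
    have hS' := Summable.of_nonneg_of_le h0 hle hS
    refine ⟨hS', lt_of_le_of_lt ?_ hva, hω⟩
    refine Real.sqrt_le_iff.2 ⟨norm_nonneg _, (hS'.tsum_le_tsum hle hS).trans ?_⟩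
    rw [tsum_mul_left, sq]
    gcongr
    refine (hysum.summable.tsum_subtype_le y _ hy0).trans_eq hysum.tsum_eq

end Persistence

/-! ### Periodic solutions -/

/-- For b = 1 the condition ∑ k_j = 1 leaves the single mode k = 1. The plane wave is therefore an
exact solution once ω is read off from its one equation, and the correction v is zero. No
independence is needed, so m = 0 is included. -/
theorem persists_periodic {d : ℕ} (m : Fin d → ℤ) (κ ρ : ℝ) {α : ℕ → ℝ} (hα : AnalyticNearZero α)
    {σ s : ℝ} (hσ : 0 < σ) (hs : 0 ≤ s) :
    ∃ C δ : ℝ, 0 < C ∧ 0 < δ ∧ ∀ a : ℝ, a ≠ 0 → |a| < δ →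
      ∃ ω : ℝ, Persists ρ α (fun _ : Fin 1 => m) κ σ s C (fun _ => a) (fun _ => ω) ∧
        |ω - ((sqNorm m : ℝ) + ρ - 2 * a ^ 2 * (sqNorm m : ℝ))| ≤ C * |a| ^ 3 := by
  obtain ⟨τ, hτ, hw⟩ := exists_expWeight (fun _ : Fin 1 => m) hσ hs
  obtain ⟨r, r₁, hr, hrr, hsr, hsr₁⟩ := hα.exists_radius
  set K := ∑' p : ℕ, |(p + 3) * α (p + 3)| * (2 * p + 5) * r₁ ^ (2 * p) with hK
  have hK0 : 0 ≤ K := tsum_nonneg fun p => by positivity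
  set E := Real.exp τ with hE
  have hE0 : 0 < E := Real.exp_pos _
  have hm0 : (0 : ℝ) ≤ sqNorm m := by
    exact_mod_cast Finset.sum_nonneg fun i _ => sq_nonneg (m i)
  set M : ℝ := (sqNorm m : ℝ) with hM
  -- The first summand bounds |ω - ω₀|/|a|² and also the error in the expansion divided by |a|³; the
  -- added 1 makes the inequality for |ω - ω₀| strict even if M = 0.
  refine ⟨M * (2 + K * E ^ 5) + 1, min 1 (r₁ / E), by positivity, by positivity,
    fun a ha0 ha => ?_⟩
  have ha1 : |a| < 1 := ha.trans_le (min_le_left _ _)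
  have hapos : 0 < |a| := abs_pos.2 ha0
  have hvn : vecNorm (fun _ : Fin 1 => a) = |a| := by simp [vecNorm, Real.sqrt_sq_eq_abs]
  set e : Fin 1 → ℤ := stdVec 0 with he
  set u : Wiener 1 τ := tangent fun _ => a with hu
  have hue : u = a • Wiener.delta e := by simp [hu, tangent, he]
  have hun : ‖u‖ ≤ E * |a| := by
    simpa using norm_tangent_le (τ := τ) (a := fun _ : Fin 1 => a) (R := |a|) fun _ => le_rfl
  have hur : ‖u‖ < r₁ := hun.trans_lt (by
    have := ha.trans_le (min_le_right _ _)
    rwa [lt_div_iff₀ hE0, mul_comm] at this)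
  set q := Wiener.coef e (Wiener.quintic α u) with hq
  have hqle : |q| ≤ K * (E ^ 5 * |a| ^ 5) :=
    calc |q| ≤ ‖Wiener.quintic α u‖ := Wiener.abs_coef_le _ _
      _ ≤ K * ‖u‖ ^ 5 := Wiener.norm_quintic_le hr hsr₁ hur.le le_rfl
      _ ≤ K * (E * |a|) ^ 5 := by gcongr
      _ = _ := by ring
  have hqa : |q / a| ≤ K * E ^ 5 * |a| ^ 4 := by
    rw [abs_div, div_le_iff₀ hapos]
    exact hqle.trans_eq (by ring)
  have hqa3 : |q / a| ≤ K * E ^ 5 * |a| ^ 3 := hqa.trans (by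
    gcongr ?_ * ?_
    exact pow_le_pow_of_le_one hapos.le ha1.le (by norm_num))
  have hqa2 : |q / a| ≤ K * E ^ 5 * |a| ^ 2 := hqa.trans (by
    gcongr ?_ * ?_
    exact pow_le_pow_of_le_one hapos.le ha1.le (by norm_num))
  have hmono : Wiener.coef e (Wiener.monomial 1 u) = a ^ 3 := by
    rw [hue, Wiener.monomial]
    simp only [map_smul, Wiener.reflect_delta, pow_one, smul_mul_smul_comm,
      Wiener.delta_mul_delta, Wiener.coef_smul]
    rw [Wiener.coef_delta, if_pos (by simp)]
    ring
  have hcoefu : Wiener.coef e u = a := coef_tangent_stdVec _ 0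
  refine ⟨M + ρ - M * (2 * a ^ 2 + q / a), ?_, ?_⟩
  · refine persists_of_isSolution hw (v := 0) (fun j => Wiener.coef_zero _) ?_ ?_ ?_
    · rw [add_zero]
      refine isSolution_of_coef _ _ hr hrr hsr hsr₁ hτ hur fun k => ?_
      -- Off degree 1 both u and the nonlinearity have coefficient zero.
      by_cases hk : ∑ j, k j = 1
      · have hke : k = e := by
          ext j
          fin_cases j
          simpa [he, stdVec] using hk
        rw [hke, ← hu, Wiener.nonlinearity, Wiener.coef_add, Wiener.coef_smul, hmono, ← hq, hcoefu,
          he, mode_stdVec, ← hM]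
        simp [stdVec]
        field_simp
        ring
      · rw [← hu, (tangent_mem_graded (fun _ : Fin 1 => a) : u ∈ _) k hk,
          Wiener.nonlinearity_mem_graded hr hsr₁ hur.le (tangent_mem_graded _) k hk]
        ring
    · rw [norm_zero, hvn]
      positivity
    · rw [hvn]
      have : vecNorm (fun _ : Fin 1 => M + ρ - M * (2 * a ^ 2 + q / a) -
          linearFreq ρ (fun _ : Fin 1 => m) 0) = M * |2 * a ^ 2 + q / a| := by
        simp only [vecNorm, Finset.univ_unique, Finset.sum_const, Finset.card_singleton, one_smul,
          Real.sqrt_sq_eq_abs, linearFreq, ← hM]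
        rw [show M + ρ - M * (2 * a ^ 2 + q / a) - (M + ρ) = -(M * (2 * a ^ 2 + q / a)) by ring,
          abs_neg, abs_mul, abs_of_nonneg hm0]
      refine lt_of_eq_of_lt this ?_
      have h2 : |2 * a ^ 2 + q / a| ≤ (2 + K * E ^ 5) * |a| ^ 2 := by
        refine (abs_add_le _ _).trans ?_
        rw [abs_mul, abs_pow, abs_two]
        linarith
      have h3 : 0 < |a| ^ 2 := by positivity
      nlinarith [mul_le_mul_of_nonneg_left h2 hm0]
  · rw [show M + ρ - M * (2 * a ^ 2 + q / a) - (M + ρ - 2 * a ^ 2 * M) = -(M * (q / a)) by ring,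
      abs_neg, abs_mul, abs_of_nonneg hm0]
    have h3 : 0 < |a| ^ 3 := by positivity
    nlinarith [mul_le_mul_of_nonneg_left hqa3 hm0]

end

end QuasiNLS

namespace QuasiNLS

noncomputable section

open scoped NNReal

/-! ### Expansion of the nonlinearity at the unperturbed solution -/

section Expansion

variable {b d : ℕ} {τ : ℝ≥0}

open Wiener

/-- The derivative of the cubic part `2 |u|² u` at the unperturbed solution. -/
def cubicLin (a : Fin b → ℝ) (v : Wiener b τ) : Wiener b τ :=
  (4 : ℝ) • (tangent a * reflect (tangent a) * v) + (2 : ℝ) • (tangent a * tangent a * reflect v)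

theorem cubicLin_sub (a : Fin b → ℝ) (v w : Wiener b τ) :
    cubicLin a (v - w) = cubicLin a v - cubicLin a w := by
  simp only [cubicLin, mul_sub, map_sub, smul_sub]
  abel

theorem cubicLin_zero (a : Fin b → ℝ) : cubicLin a (0 : Wiener b τ) = 0 := by
  simp [cubicLin]

/-- The part of the nonlinearity that is of higher order at the unperturbed solution. -/
def remainder (α : ℕ → ℝ) (a : Fin b → ℝ) (v : Wiener b τ) : Wiener b τ :=
  nonlinearity α (tangent a + v) - (2 : ℝ) • monomial 1 (tangent a) - cubicLin a v

theorem nonlinearity_tangent_add (α : ℕ → ℝ) (a : Fin b → ℝ) (v : Wiener b τ) :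
    nonlinearity α (tangent a + v) =
      (2 : ℝ) • monomial 1 (tangent a) + cubicLin a v + remainder α a v := by
  rw [remainder]; abel

/-- What is left of the cubic part is at least quadratic in v. At v = 0 only the quintic part
survives, whence the bound ε⁵ for `rem_zero`. -/
theorem remainder_eq (α : ℕ → ℝ) (a : Fin b → ℝ) (v : Wiener b τ) :
    remainder α a v = (4 : ℝ) • (tangent a * (v * reflect v)) +
      (2 : ℝ) • (reflect (tangent a) * (v * v)) + (2 : ℝ) • monomial 1 v +
        quintic α (tangent a + v) := by
  have h4 : ∀ x : Wiener b τ, (4 : ℝ) • x = 4 * x := fun x => by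
    rw [Algebra.smul_def, map_ofNat]
  have h2 : ∀ x : Wiener b τ, (2 : ℝ) • x = 2 * x := fun x => by
    rw [Algebra.smul_def, map_ofNat]
  simp only [remainder, nonlinearity, cubicLin, monomial, map_add, pow_one, h4, h2]
  ring

/-- Bounds for the expansion of the nonlinearity at an unperturbed solution of size `ε`. -/
structure ExpansionBounds (τ : ℝ≥0) (α : ℕ → ℝ) (a : Fin b → ℝ) (ε C : ℝ) : Prop where
  main : ‖(2 : ℝ) • monomial 1 (tangent a : Wiener b τ)‖ ≤ C * ε ^ 3
  lin : ∀ v : Wiener b τ, ‖cubicLin a v‖ ≤ C * ε ^ 2 * ‖v‖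
  rem : ∀ v w : Wiener b τ, ‖v‖ ≤ 2 * ε ^ 2 → ‖w‖ ≤ 2 * ε ^ 2 →
    ‖remainder α a v - remainder α a w‖ ≤ C * ε ^ 3 * ‖v - w‖
  rem_zero : ‖remainder α a (0 : Wiener b τ)‖ ≤ C * ε ^ 5

theorem exists_expansionBounds (b : ℕ) (τ : ℝ≥0) {α : ℕ → ℝ} {r₁ : ℝ} (hr : 0 < r₁)
    (hs : Summable fun p : ℕ => |(p + 3) * α (p + 3)| * (2 * p + 5) * r₁ ^ (2 * p)) :
    ∃ C ε₀ : ℝ, 0 < C ∧ 0 < ε₀ ∧ ε₀ ≤ 1 ∧ ∀ ε, 0 < ε → ε < ε₀ → ∀ a : Fin b → ℝ,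
      (∀ j, |a j| ≤ 2 * ε) → ExpansionBounds τ α a ε C ∧
        ∀ v : Wiener b τ, ‖v‖ ≤ 2 * ε ^ 2 → ‖tangent a + v‖ < r₁ := by
  set K := ∑' p : ℕ, |(p + 3) * α (p + 3)| * (2 * p + 5) * r₁ ^ (2 * p) with hK
  have hK0 : 0 ≤ K := tsum_nonneg fun p => by positivity
  -- ‖tangent a‖ ≤ cε for |a_j| ≤ 2ε, and then ‖tangent a + v‖ ≤ cε + 2ε² ≤ (c + 2)ε, which explains
  -- the threshold r₁/(c + 2). The constant below is large enough for all four bounds at once.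
  set c : ℝ := b * Real.exp τ * 2 with hc
  have hc0 : 0 ≤ c := by positivity
  refine ⟨2 * c ^ 3 + 6 * c ^ 2 + 24 * c + 24 + K * (c + 2) ^ 4 + K * (c + 2) ^ 5,
    min 1 (r₁ / (c + 2)), by positivity, by positivity, min_le_left _ _, fun ε hε hε' a ha => ?_⟩
  have hε1 : ε < 1 := hε'.trans_le (min_le_left _ _)
  have hεr : ε * (c + 2) < r₁ := by
    have := hε'.trans_le (min_le_right _ _)
    rwa [lt_div_iff₀ (by positivity)] at this
  set t : Wiener b τ := tangent a with ht
  have htn : ‖t‖ ≤ c * ε := (norm_tangent_le ha).trans_eq (by ring)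
  have hrt : ‖reflect t‖ ≤ c * ε := (norm_reflect_le t).trans htn
  have hε2 : ε ^ 2 ≤ ε := by nlinarith
  have htv : ∀ v : Wiener b τ, ‖v‖ ≤ 2 * ε ^ 2 → ‖t + v‖ ≤ ε * (c + 2) := fun v hv => by
    refine (norm_add_le _ _).trans ?_
    nlinarith
  have h4 : ‖(4 : ℝ)‖ = 4 := by norm_num
  have h2 : ‖(2 : ℝ)‖ = 2 := by norm_num
  set D : ℝ := K * (c + 2) ^ 4
  set D' : ℝ := K * (c + 2) ^ 5
  have hD : 0 ≤ D := by positivity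
  have hD' : 0 ≤ D' := by positivity
  refine ⟨⟨?_, fun v => ?_, fun v w hv hw => ?_, ?_⟩, fun v hv => (htv v hv).trans_lt hεr⟩
  · rw [norm_smul, h2]
    calc 2 * ‖monomial 1 t‖ ≤ 2 * (c * ε) ^ (2 * 1 + 1) := by
          gcongr
          exact norm_monomial_le htn 1
      _ = 2 * c ^ 3 * ε ^ 3 := by ring
      _ ≤ _ := by
          gcongr
          nlinarith [pow_nonneg hc0 2]
  · rw [cubicLin]
    refine (norm_add_le _ _).trans ?_
    rw [norm_smul, norm_smul, h4, h2]
    have e1 : ‖t * reflect t * v‖ ≤ (c * ε) ^ 2 * ‖v‖ :=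
      (norm_mul_le _ _).trans (by gcongr; exact norm_mul_reflect_le htn)
    have e2 : ‖t * t * reflect v‖ ≤ (c * ε) * (c * ε) * ‖v‖ := by
      refine (norm_mul_le _ _).trans ?_
      gcongr
      · exact (norm_mul_le _ _).trans (by gcongr)
      · exact norm_reflect_le v
    calc _ ≤ 4 * ((c * ε) ^ 2 * ‖v‖) + 2 * ((c * ε) * (c * ε) * ‖v‖) := by gcongr
      _ = 6 * c ^ 2 * ε ^ 2 * ‖v‖ := by ring
      _ ≤ _ := by
          gcongr
          nlinarith [pow_nonneg hc0 3]
  · set X := ‖v - w‖ with hX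
    have hX0 : 0 ≤ X := norm_nonneg _
    have e : remainder α a v - remainder α a w =
        (4 : ℝ) • (t * (v * reflect v - w * reflect w)) +
        (2 : ℝ) • (reflect t * ((v + w) * (v - w))) + (2 : ℝ) • (monomial 1 v - monomial 1 w) +
        (quintic α (t + v) - quintic α (t + w)) := by
      rw [remainder_eq, remainder_eq, show (v + w) * (v - w) = v * v - w * w by ring]
      simp only [mul_sub, smul_sub]
      abel
    have e1 : ‖t * (v * reflect v - w * reflect w)‖ ≤ c * ε * (2 * (2 * ε ^ 2) * X) :=
      (norm_mul_le _ _).trans (by gcongr; exact norm_mul_reflect_sub_le hv hw)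
    have e2 : ‖reflect t * ((v + w) * (v - w))‖ ≤ c * ε * ((2 * ε ^ 2 + 2 * ε ^ 2) * X) := by
      refine (norm_mul_le _ _).trans ?_
      gcongr
      refine (norm_mul_le _ _).trans ?_
      gcongr
      exact (norm_add_le _ _).trans (add_le_add hv hw)
    have e3 : ‖monomial 1 v - monomial 1 w‖ ≤ 3 * (2 * ε ^ 2) ^ 2 * X :=
      (norm_monomial_sub_le hv hw 1).trans_eq (by rw [hX]; norm_num)
    have e4 : ‖quintic α (t + v) - quintic α (t + w)‖ ≤ K * (ε * (c + 2)) ^ 4 * X := by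
      have := norm_quintic_sub_le hr hs hεr.le (htv v hv) (htv w hw)
      rwa [show t + v - (t + w) = v - w by abel] at this
    rw [e]
    refine (norm_add_le _ _).trans ((add_le_add (norm_add₃_le) le_rfl).trans ?_)
    rw [norm_smul, norm_smul, norm_smul, h4, h2]
    have hε43 : ε ^ 4 ≤ ε ^ 3 := pow_le_pow_of_le_one hε.le hε1.le (by norm_num)
    calc _ ≤ 4 * (c * ε * (2 * (2 * ε ^ 2) * X)) + 2 * (c * ε * ((2 * ε ^ 2 + 2 * ε ^ 2) * X)) +
          2 * (3 * (2 * ε ^ 2) ^ 2 * X) + K * (ε * (c + 2)) ^ 4 * X := by gcongr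
      _ = (24 * c * ε ^ 3 + (24 + D) * ε ^ 4) * X := by simp only [D]; ring
      _ ≤ (24 * c * ε ^ 3 + (24 + D) * ε ^ 3) * X := by gcongr
      _ = (24 * c + (24 + D)) * ε ^ 3 * X := by ring
      _ ≤ _ := by
          refine mul_le_mul_of_nonneg_right (mul_le_mul_of_nonneg_right ?_ (by positivity)) hX0
          nlinarith [pow_nonneg hc0 3, pow_nonneg hc0 2]
  · have e : remainder α a (0 : Wiener b τ) = quintic α t := by
      rw [remainder_eq]
      simp [monomial, ht]
    rw [e]
    have htr : ‖t‖ ≤ ε * (c + 2) := by nlinarith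
    calc _ ≤ K * (ε * (c + 2)) ^ 5 := norm_quintic_le hr hs hεr.le htr
      _ = D' * ε ^ 5 := by simp only [D']; ring
      _ ≤ _ := by
          gcongr
          nlinarith [pow_nonneg hc0 3, pow_nonneg hc0 2]

/-! ### The frequency shift and its expansion. -/

/-- The frequency shift is `-|n_j|²` times this quantity. -/
def freqShift (α : ℕ → ℝ) (a : Fin b → ℝ) (v : Wiener b τ) (j : Fin b) : ℝ :=
  coef (stdVec j) (nonlinearity α (tangent a + v)) / a j

/-- The part of higher order of the frequency shift. -/
def freqRem (α : ℕ → ℝ) (a : Fin b → ℝ) (v : Wiener b τ) (j : Fin b) : ℝ :=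
  coef (stdVec j) (cubicLin a v + remainder α a v) / a j

theorem coef_tangent_mul (a : Fin b → ℝ) (k : Fin b → ℤ) (f : Wiener b τ) :
    coef k (tangent a * f) = ∑ j, a j * coef (k - stdVec j) f := by
  rw [tangent, Finset.sum_mul, coef_sum]
  simp [coef_smul, coef_delta_mul]

theorem coef_reflect_tangent_mul (a : Fin b → ℝ) (k : Fin b → ℤ) (f : Wiener b τ) :
    coef k (reflect (tangent a) * f) = ∑ j, a j * coef (k + stdVec j) f := by
  rw [tangent, map_sum, Finset.sum_mul, coef_sum]
  simp [coef_smul, coef_delta_mul]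

theorem coef_monomial_tangent (a : Fin b → ℝ) (k : Fin b → ℤ) :
    coef k (monomial 1 (tangent a : Wiener b τ)) =
      ∑ i, ∑ l, a i * a l * coef (stdVec i + stdVec l - k) (tangent a : Wiener b τ) := by
  rw [monomial, pow_one, show (tangent a : Wiener b τ) * reflect (tangent a) * tangent a =
    tangent a * (tangent a * reflect (tangent a)) by ring, coef_tangent_mul]
  refine Finset.sum_congr rfl fun i _ => ?_
  rw [coef_tangent_mul, Finset.mul_sum]
  refine Finset.sum_congr rfl fun l _ => ?_
  rw [coef_reflect, mul_assoc]
  congr 3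
  abel

/-- e_i + e_l - e_j is a basis vector exactly when i = j or l = j. Inclusion–exclusion over these
two cases gives the factor 2 and the correction -a_j², the source of 4∑a_l² - 2a_j² in (F). -/
theorem coef_stdVec_monomial_tangent (a : Fin b → ℝ) (j : Fin b) :
    coef (stdVec j) (monomial 1 (tangent a : Wiener b τ)) =
      a j * (2 * ∑ l, a l ^ 2 - a j ^ 2) := by
  have key : ∀ i l, a i * a l * coef (stdVec i + stdVec l - stdVec j) (tangent a : Wiener b τ) =
      (if i = j then a j * a l ^ 2 else 0) + (if l = j then a j * a i ^ 2 else 0) -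
        (if i = j then if l = j then a j ^ 3 else 0 else 0) := by
    intro i l
    by_cases hi : i = j
    · subst hi
      rw [add_sub_cancel_left, coef_tangent_stdVec]
      by_cases hl : l = i
      · subst hl
        simp
        ring
      · simp [hl]
        ring
    · by_cases hl : l = j
      · subst hl
        rw [add_sub_cancel_right, coef_tangent_stdVec]
        simp [hi]
        ring
      · rw [coef_tangent_of_notMem]
        · simp [hi, hl]
        · rintro ⟨m, hm⟩
          have := congrFun hm j
          simp only [stdVec, Pi.sub_apply, Pi.add_apply, Pi.single_apply] at this
          simp only [Ne.symm hi, Ne.symm hl, if_false, if_true] at this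
          split_ifs at this <;> lia
  rw [coef_monomial_tangent]
  simp only [key, Finset.sum_sub_distrib, Finset.sum_add_distrib, Finset.sum_ite_eq',
    Finset.mem_univ, if_true]
  simp only [Finset.sum_ite_irrel, Finset.sum_const_zero, Finset.sum_ite_eq', Finset.mem_univ,
    if_true, ← Finset.mul_sum]
  ring

theorem freqShift_eq (α : ℕ → ℝ) (a : Fin b → ℝ) (v : Wiener b τ) {j : Fin b} (hj : a j ≠ 0) :
    freqShift α a v j = 4 * ∑ l, a l ^ 2 - 2 * a j ^ 2 + freqRem α a v j := by
  rw [freqShift, freqRem, nonlinearity_tangent_add, add_assoc, coef_add, coef_smul,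
    coef_stdVec_monomial_tangent]
  field_simp
  ring

section Bounds

variable {α : ℕ → ℝ} {a : Fin b → ℝ} {ε C : ℝ} (hB : ExpansionBounds τ α a ε C)
  (hC : 0 ≤ C) (hε : 0 < ε) (hε1 : ε ≤ 1) {v w : Wiener b τ} (hv : ‖v‖ ≤ 2 * ε ^ 2)
  (hw : ‖w‖ ≤ 2 * ε ^ 2)
include hB hC hε hε1 hv

/-- For ‖v‖ = O(ε²) the linear term is O(ε⁴) and the remainder O(ε⁵). Division by a_j ≥ ε then makes
`freqRem` of order ε³, the error term in (F). -/
theorem ExpansionBounds.norm_lin_add_rem_le :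
    ‖cubicLin a v + remainder α a v‖ ≤ 5 * C * ε ^ 4 := by
  have h0 : ‖(0 : Wiener b τ)‖ ≤ 2 * ε ^ 2 := by rw [norm_zero]; positivity
  have h1 := hB.lin v
  have h2 := hB.rem v 0 hv h0
  have h3 := hB.rem_zero
  rw [sub_zero] at h2
  have h4 : ‖remainder α a v‖ ≤ C * ε ^ 3 * ‖v‖ + C * ε ^ 5 := by
    have := norm_add_le (remainder α a v - remainder α a 0) (remainder α a 0)
    rw [sub_add_cancel] at this
    linarith
  have h5 : ε ^ 5 ≤ ε ^ 4 := pow_le_pow_of_le_one hε.le hε1 (by norm_num)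
  calc _ ≤ C * ε ^ 2 * ‖v‖ + (C * ε ^ 3 * ‖v‖ + C * ε ^ 5) :=
        (norm_add_le _ _).trans (add_le_add h1 h4)
    _ ≤ C * ε ^ 2 * (2 * ε ^ 2) + (C * ε ^ 3 * (2 * ε ^ 2) + C * ε ^ 5) := by gcongr
    _ = 2 * C * ε ^ 4 + 3 * C * ε ^ 5 := by ring
    _ ≤ 2 * C * ε ^ 4 + 3 * C * ε ^ 4 := by gcongr
    _ = _ := by ring

theorem ExpansionBounds.norm_nonlinearity_le :
    ‖nonlinearity α (tangent a + v)‖ ≤ 6 * C * ε ^ 3 := by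
  rw [nonlinearity_tangent_add, add_assoc]
  have h1 := hB.norm_lin_add_rem_le hC hε hε1 hv
  have h5 : ε ^ 4 ≤ ε ^ 3 := pow_le_pow_of_le_one hε.le hε1 (by norm_num)
  calc _ ≤ C * ε ^ 3 + 5 * C * ε ^ 4 := (norm_add_le _ _).trans (add_le_add hB.main h1)
    _ ≤ C * ε ^ 3 + 5 * C * ε ^ 3 := by gcongr
    _ = _ := by ring

theorem ExpansionBounds.abs_freqRem_le {j : Fin b} (hj : ε ≤ a j) :
    |freqRem α a v j| ≤ 5 * C * ε ^ 3 := by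
  have hj0 : 0 < a j := hε.trans_le hj
  rw [freqRem, abs_div, abs_of_pos hj0, div_le_iff₀ hj0]
  calc _ ≤ 5 * C * ε ^ 4 := (abs_coef_le _ _).trans (hB.norm_lin_add_rem_le hC hε hε1 hv)
    _ = 5 * C * ε ^ 3 * ε := by ring
    _ ≤ _ := by gcongr

theorem ExpansionBounds.abs_freqShift_le {j : Fin b} (hj : ε ≤ a j) :
    |freqShift α a v j| ≤ 6 * C * ε ^ 2 := by
  have hj0 : 0 < a j := hε.trans_le hj
  rw [freqShift, abs_div, abs_of_pos hj0, div_le_iff₀ hj0]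
  calc _ ≤ 6 * C * ε ^ 3 := (abs_coef_le _ _).trans (hB.norm_nonlinearity_le hC hε hε1 hv)
    _ = 6 * C * ε ^ 2 * ε := by ring
    _ ≤ _ := by gcongr

include hw

theorem ExpansionBounds.norm_lin_add_rem_sub_le :
    ‖cubicLin a v + remainder α a v - (cubicLin a w + remainder α a w)‖ ≤
      2 * C * ε ^ 2 * ‖v - w‖ := by
  have h1 := hB.lin (v - w)
  have h2 := hB.rem v w hv hw
  rw [cubicLin_sub] at h1
  have h5 : ε ^ 3 ≤ ε ^ 2 := pow_le_pow_of_le_one hε.le hε1 (by norm_num)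
  calc _ = ‖(cubicLin a v - cubicLin a w) + (remainder α a v - remainder α a w)‖ := by
        congr 1; abel
    _ ≤ C * ε ^ 2 * ‖v - w‖ + C * ε ^ 3 * ‖v - w‖ := (norm_add_le _ _).trans (add_le_add h1 h2)
    _ ≤ C * ε ^ 2 * ‖v - w‖ + C * ε ^ 2 * ‖v - w‖ := by gcongr
    _ = _ := by ring

theorem ExpansionBounds.norm_nonlinearity_sub_le :
    ‖nonlinearity α (tangent a + v) - nonlinearity α (tangent a + w)‖ ≤
      2 * C * ε ^ 2 * ‖v - w‖ := by
  rw [nonlinearity_tangent_add, nonlinearity_tangent_add, add_assoc, add_assoc,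
    add_sub_add_left_eq_sub]
  exact hB.norm_lin_add_rem_sub_le hC hε hε1 hv hw

theorem ExpansionBounds.abs_freqRem_sub_le {j : Fin b} (hj : ε ≤ a j) :
    |freqRem α a v j - freqRem α a w j| ≤ 2 * C * ε * ‖v - w‖ := by
  have hj0 : 0 < a j := hε.trans_le hj
  rw [freqRem, freqRem, ← sub_div, ← coef_sub, abs_div, abs_of_pos hj0, div_le_iff₀ hj0]
  calc _ ≤ 2 * C * ε ^ 2 * ‖v - w‖ :=
        (abs_coef_le _ _).trans (hB.norm_lin_add_rem_sub_le hC hε hε1 hv hw)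
    _ = 2 * C * ε * ‖v - w‖ * ε := by ring
    _ ≤ _ := by gcongr

theorem ExpansionBounds.abs_freqShift_sub_le {j : Fin b} (hj : ε ≤ a j) :
    |freqShift α a v j - freqShift α a w j| ≤ 2 * C * ε * ‖v - w‖ := by
  have hj0 : a j ≠ 0 := (hε.trans_le hj).ne'
  rw [freqShift_eq _ _ _ hj0, freqShift_eq _ _ _ hj0, add_sub_add_left_eq_sub]
  exact hB.abs_freqRem_sub_le hC hε hε1 hv hw hj

end Bounds

end Expansion

/-! ### The nonresonant modes -/

section Nonresonant

variable {b d : ℕ} {τ : ℝ≥0}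

open Wiener

/-- The integers `|n_k|² - ∑ k_j |n_j|²`. -/
def divisor (n : Fin b → Fin d → ℤ) (k : Fin b → ℤ) : ℤ :=
  sqNorm (mode n k) - ∑ j, k j * sqNorm (n j)

/-- Independence gives |k|² ≲ |n_k|² ≤ |D| + L|k|, so a large k forces |D| to be at least of the
order of |k|; for bounded k it suffices that the integer D is nonzero. The bound for |n_k|² follows
by inserting this in the same inequality. -/
theorem exists_divisor_bound {n : Fin b → Fin d → ℤ} (hn : Indep n) :
    ∃ M : ℝ, 0 ≤ M ∧ ∀ k, divisor n k ≠ 0 →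
      |(sqNorm (mode n k) : ℝ)| ≤ M * |(divisor n k : ℝ)| ∧
        ∀ j, |(k j : ℝ)| ≤ M * |(divisor n k : ℝ)| := by
  let f : (Fin b → ℝ) →ₗ[ℝ] EuclideanSpace ℝ (Fin d) :=
    Fintype.linearCombination ℝ fun j => toEuclid (n j)
  have hf : LinearMap.ker f = ⊥ := LinearMap.ker_eq_bot.2 hn.fintypeLinearCombination_injective
  obtain ⟨K, hK, hlip⟩ := f.exists_antilipschitzWith hf
  have hsq : ∀ k : Fin b → ℤ, ((sqNorm (mode n k) : ℤ) : ℝ) = ‖f fun j => (k j : ℝ)‖ ^ 2 := by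
    intro k
    rw [EuclideanSpace.norm_sq_eq]
    simp [f, Fintype.linearCombination_apply, toEuclid, sqNorm, mode, Finset.sum_apply]
  set L : ℝ := ∑ j, |((sqNorm (n j) : ℤ) : ℝ)| with hL
  have hL0 : 0 ≤ L := Finset.sum_nonneg fun _ _ => abs_nonneg _
  set N : ℝ := (K : ℝ) ^ 2 * (L + 1) + 1 with hN
  have hN1 : 1 ≤ N := le_add_of_nonneg_left (by positivity)
  have hN0 : 0 ≤ N := zero_le_one.trans hN1
  refine ⟨1 + L * N + N, by positivity, fun k hk => ?_⟩
  set D : ℝ := |(divisor n k : ℝ)| with hD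
  have hD1 : 1 ≤ D := by
    rw [hD]
    exact_mod_cast Int.one_le_abs hk
  set X := ‖(fun j => (k j : ℝ))‖ with hX
  have hX0 : 0 ≤ X := norm_nonneg _
  set q : ℝ := (sqNorm (mode n k) : ℝ) with hq
  have hq0 : 0 ≤ q := by rw [hq, hsq]; positivity
  have hsum : |∑ j, (k j : ℝ) * (sqNorm (n j) : ℝ)| ≤ X * L := by
    rw [hL, Finset.mul_sum]
    refine (Finset.abs_sum_le_sum_abs _ _).trans (Finset.sum_le_sum fun j _ => ?_)
    rw [abs_mul]
    gcongr
    exact norm_le_pi_norm (fun j => (k j : ℝ)) j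
  have hqD : q ≤ D + X * L := by
    have : q = (divisor n k : ℝ) + ∑ j, (k j : ℝ) * (sqNorm (n j) : ℝ) := by
      simp [divisor, hq]
    linarith [le_abs_self (divisor n k : ℝ), le_abs_self (∑ j, (k j : ℝ) * (sqNorm (n j) : ℝ))]
  have hXq : X ^ 2 ≤ (K : ℝ) ^ 2 * q := by
    have h1 : X ≤ K * ‖f fun j => (k j : ℝ)‖ := by
      simpa using hlip.le_mul_dist (fun j => (k j : ℝ)) 0
    rw [hq, hsq]
    calc X ^ 2 ≤ (K * ‖f fun j => (k j : ℝ)‖) ^ 2 := by gcongr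
      _ = _ := by ring
  -- If X > ND then D ≤ X, the quadratic inequality becomes linear and yields X ≤ K²(L + 1) < N ≤
  -- ND.
  have hXN : X ≤ N * D := by
    by_contra! h
    have hDX : D ≤ X := by nlinarith
    have h1 : X * X ≤ (K : ℝ) ^ 2 * (L + 1) * X :=
      calc X * X = X ^ 2 := by ring
        _ ≤ (K : ℝ) ^ 2 * q := hXq
        _ ≤ (K : ℝ) ^ 2 * (X + X * L) := by gcongr; linarith
        _ = _ := by ring
    have h2 : X ≤ (K : ℝ) ^ 2 * (L + 1) := le_of_mul_le_mul_right h1 (by linarith)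
    nlinarith
  refine ⟨?_, fun j => ?_⟩
  · rw [abs_of_nonneg hq0]
    nlinarith [mul_le_mul_of_nonneg_right hXN hL0, mul_nonneg hN0 (zero_le_one.trans hD1)]
  · have h1 : |(k j : ℝ)| ≤ X := norm_le_pi_norm (fun j => (k j : ℝ)) j
    nlinarith [mul_nonneg (mul_nonneg hL0 hN0) (zero_le_one.trans hD1)]

/-- The quotients `p(k) / (|n_k|² - ∑ k_j |n_j|²)` at the nonresonant modes. -/
def nonresSymbol (n : Fin b → Fin d → ℤ) (p : (Fin b → ℤ) → ℤ) (k : Fin b → ℤ) : ℝ :=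
  if ∑ j, k j = 1 ∧ divisor n k ≠ 0 then (p k : ℝ) / divisor n k else 0

theorem abs_nonresSymbol_le {n : Fin b → Fin d → ℤ} {p : (Fin b → ℤ) → ℤ} {M : ℝ} (hM : 0 ≤ M)
    (hp : ∀ k, divisor n k ≠ 0 → |(p k : ℝ)| ≤ M * |(divisor n k : ℝ)|) (k : Fin b → ℤ) :
    |nonresSymbol n p k| ≤ M := by
  rw [nonresSymbol]
  split_ifs with h
  · rw [abs_div, div_le_iff₀ (abs_pos.2 (by exact_mod_cast h.2))]
    exact hp k h.2
  · simpa using hM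

end Nonresonant

end

end QuasiNLS

namespace QuasiNLS

noncomputable section

open scoped NNReal

/-! ### The resonant modes -/

section Resonant

variable {b d : ℕ} {τ : ℝ≥0}

open Wiener

theorem mem_resonantModes_iff {n : Fin b → Fin d → ℤ} {k : Fin b → ℤ} :
    k ∈ resonantModes n ↔ ∑ j, k j = 1 ∧ divisor n k = 0 := by
  rw [resonantModes, Set.mem_ofPred_eq, divisor, sub_eq_zero, eq_comm (a := sqNorm (mode n k))]

theorem stdVec_mem_resonantModes (n : Fin b → Fin d → ℤ) (j : Fin b) :
    stdVec j ∈ resonantModes n := by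
  refine ⟨sum_stdVec j, ?_⟩
  rw [mode_stdVec, Finset.sum_eq_single j] <;> simp +contextual [stdVec]

/-- The resonance matrix at a real point. -/
def realResonanceMatrix (n : Fin b → Fin d → ℤ) (a : Fin b → ℝ) :
    Matrix (resonantModes₂ n) (resonantModes₂ n) ℝ :=
  (resonanceMatrix n).map (MvPolynomial.aeval a)

theorem realResonanceMatrix_apply (n : Fin b → Fin d → ℤ) (a : Fin b → ℝ)
    (k k' : resonantModes₂ n) [Decidable (k = k')] :
    realResonanceMatrix n a k k' =
      if k = k' then ∑ j, ((k.1 j : ℝ) * (sqNorm (n j) : ℝ)) * a j ^ 2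
      else (sqNorm (mode n k.1) : ℝ) *
        (2 * (∑ i, ∑ j, if k.1 + stdVec i - stdVec j = k'.1 then a i * a j else 0)
          + ∑ i, ∑ j, if stdVec i + stdVec j - k.1 = k'.1 then a i * a j else 0) := by
  classical
  rw [realResonanceMatrix, Matrix.map_apply, resonanceMatrix]
  split_ifs with h
  · simp
  · simp [apply_ite (MvPolynomial.aeval a)]

/-- The projection to the nontrivial resonant modes. -/
def resProj (n : Fin b → Fin d → ℤ) : Wiener b τ →L[ℝ] Wiener b τ :=
  multiplier ((resonantModes₂ n).indicator 1) 1 fun k => by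
    by_cases h : k ∈ resonantModes₂ n <;> simp [h]

theorem coef_resProj_of_mem {n : Fin b → Fin d → ℤ} {k : Fin b → ℤ} (hk : k ∈ resonantModes₂ n)
    (v : Wiener b τ) : coef k (resProj n v) = coef k v := by
  simp [resProj, coef_multiplier, hk]

theorem coef_resProj_of_notMem {n : Fin b → Fin d → ℤ} {k : Fin b → ℤ}
    (hk : k ∉ resonantModes₂ n) (v : Wiener b τ) : coef k (resProj n v) = 0 := by
  simp [resProj, coef_multiplier, hk]

theorem norm_resProj_le (n : Fin b → Fin d → ℤ) (v : Wiener b τ) : ‖resProj n v‖ ≤ ‖v‖ :=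
  (norm_multiplier_apply_le _ v).trans_eq (one_mul _)

variable (n : Fin b → Fin d → ℤ) [Fintype (resonantModes₂ n)]

theorem coef_resProj_eq_sum [DecidableEq (Fin b → ℤ)] (k : Fin b → ℤ) (v : Wiener b τ) :
    coef k (resProj n v) = ∑ k' : resonantModes₂ n, if k = k'.1 then coef k'.1 v else 0 := by
  by_cases hk : k ∈ resonantModes₂ n
  · rw [coef_resProj_of_mem hk, Finset.sum_eq_single ⟨k, hk⟩]
    · simp
    · rintro ⟨l, hl⟩ _ hne
      exact if_neg fun h => hne (Subtype.ext h.symm)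
    · simp
  · rw [coef_resProj_of_notMem hk, Finset.sum_eq_zero]
    rintro ⟨l, hl⟩ _
    refine if_neg fun h => hk ?_
    rw [h]
    exact hl

/-- This is where A comes from. Off the diagonal the factors 4 and 2 of `cubicLin` give 2A directly.
On the diagonal 4|n_k|²∑a_l² cancels against the frequency shift, since ∑ k_j|n_j|² = |n_k|² on 𝒦,
and 2∑ k_j|n_j|²a_j² remains. -/
theorem coef_cubicLin_resProj (a : Fin b → ℝ) (k : resonantModes₂ n) (v : Wiener b τ) :
    (sqNorm (mode n k.1) : ℝ) * coef k.1 (cubicLin a (resProj n v)) -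
        (∑ j, ((k.1 j : ℝ) * (sqNorm (n j) : ℝ)) * (4 * ∑ l, a l ^ 2 - 2 * a j ^ 2)) * coef k.1 v =
      2 * ∑ k' : resonantModes₂ n, realResonanceMatrix n a k k' * coef k'.1 v := by
  classical
  have swap : ∀ l : Fin b → Fin b → Fin b → ℤ,
      ∑ i, ∑ j, a i * a j * coef (l i j) (resProj n v) = ∑ k' : resonantModes₂ n,
        (∑ i, ∑ j, if l i j = k'.1 then a i * a j else 0) * coef k'.1 v := fun l => by
    simp only [coef_resProj_eq_sum, Finset.sum_mul, Finset.mul_sum]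
    symm
    rw [Finset.sum_comm]
    refine Finset.sum_congr rfl fun i _ => ?_
    rw [Finset.sum_comm]
    refine Finset.sum_congr rfl fun j _ => Finset.sum_congr rfl fun k' _ => ?_
    split_ifs <;> simp
  have h1 : coef k.1 (tangent a * reflect (tangent a) * resProj n v) =
      ∑ k' : resonantModes₂ n,
        (∑ i, ∑ j, if k.1 + stdVec i - stdVec j = k'.1 then a i * a j else 0) * coef k'.1 v := by
    rw [mul_comm (tangent a) (reflect _), mul_assoc, coef_reflect_tangent_mul, ← swap]
    refine Finset.sum_congr rfl fun i _ => ?_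
    rw [coef_tangent_mul, Finset.mul_sum]
    simp only [mul_assoc]
  have h2 : coef k.1 (tangent a * tangent a * reflect (resProj n v)) =
      ∑ k' : resonantModes₂ n,
        (∑ i, ∑ j, if stdVec i + stdVec j - k.1 = k'.1 then a i * a j else 0) * coef k'.1 v := by
    rw [mul_assoc, coef_tangent_mul, ← swap]
    refine Finset.sum_congr rfl fun i _ => ?_
    rw [coef_tangent_mul, Finset.mul_sum]
    refine Finset.sum_congr rfl fun j _ => ?_
    rw [coef_reflect, mul_assoc]
    congr 3
    abel
  have h3 : ∑ i, ∑ j, (if k.1 + stdVec i - stdVec j = k.1 then a i * a j else 0) =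
      ∑ l, a l ^ 2 := by
    refine Finset.sum_congr rfl fun i _ => ?_
    rw [Finset.sum_eq_single i]
    · rw [if_pos (by abel)]
      ring
    · intro j _ hj
      refine if_neg fun h => hj (stdVec_injective ?_)
      rw [add_sub_assoc, add_eq_left, sub_eq_zero] at h
      exact h.symm
    · simp
  -- e_i + e_j = 2k forces i = j by parity and then k = e_i, which is not in 𝒦₂.
  have h4 : ∑ i, ∑ j, (if stdVec i + stdVec j - k.1 = k.1 then a i * a j else 0) = 0 := by
    refine Finset.sum_eq_zero fun i _ => Finset.sum_eq_zero fun j _ => if_neg fun h => ?_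
    have hij : i = j := by
      by_contra hij
      have := congrFun h i
      simp [stdVec, hij] at this
      lia
    subst hij
    refine k.2.2 ⟨i, ?_⟩
    ext l
    have := congrFun h l
    simp only [Pi.sub_apply, Pi.add_apply] at this
    lia
  have hk : ∑ j, ((k.1 j : ℝ) * (sqNorm (n j) : ℝ)) = (sqNorm (mode n k.1) : ℝ) := by
    exact_mod_cast k.2.1.2
  have h5 : (∑ j, ((k.1 j : ℝ) * (sqNorm (n j) : ℝ)) * (4 * ∑ l, a l ^ 2 - 2 * a j ^ 2)) =
      4 * (sqNorm (mode n k.1) : ℝ) * ∑ l, a l ^ 2 -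
        2 * ∑ j, ((k.1 j : ℝ) * (sqNorm (n j) : ℝ)) * a j ^ 2 := by
    generalize ∑ l, a l ^ 2 = S
    rw [← hk]
    simp only [Finset.mul_sum, Finset.sum_mul, ← Finset.sum_sub_distrib]
    exact Finset.sum_congr rfl fun j _ => by ring
  have h6 : (∑ j, ((k.1 j : ℝ) * (sqNorm (n j) : ℝ)) * (4 * ∑ l, a l ^ 2 - 2 * a j ^ 2)) *
      coef k.1 v = ∑ k' : resonantModes₂ n, if k = k' then (4 * (sqNorm (mode n k.1) : ℝ) *
        ∑ l, a l ^ 2 - 2 * ∑ j, ((k.1 j : ℝ) * (sqNorm (n j) : ℝ)) * a j ^ 2) * coef k'.1 v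
          else 0 := by
    rw [h5, Finset.sum_ite_eq, if_pos (Finset.mem_univ _)]
  rw [h6, cubicLin, coef_add, coef_smul, coef_smul, h1, h2]
  generalize ∑ l, a l ^ 2 = S at h3 ⊢
  simp only [realResonanceMatrix_apply]
  generalize ∑ j, ((k.1 j : ℝ) * (sqNorm (n j) : ℝ)) * a j ^ 2 = D
  rw [Finset.mul_sum, Finset.mul_sum, ← Finset.sum_add_distrib, Finset.mul_sum,
    ← Finset.sum_sub_distrib, Finset.mul_sum]
  refine Finset.sum_congr rfl fun k' _ => ?_
  by_cases hkk : k = k'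
  · subst hkk
    rw [if_pos rfl, if_pos rfl, h3, h4]
    ring
  · rw [if_neg hkk, if_neg hkk]
    ring

end Resonant

end

end QuasiNLS

namespace QuasiNLS

noncomputable section

open scoped NNReal

/-! ### The fixed point problem -/

section FixedPoint

variable {b d : ℕ} {τ : ℝ≥0}

open Wiener

/-- The quotients of `|n_k|²` and of the `k_j` by the divisors are bounded. -/
structure DivisorBound (n : Fin b → Fin d → ℤ) (M : ℝ) : Prop where
  nonneg : 0 ≤ M
  sqNorm_le : ∀ k, divisor n k ≠ 0 → |(sqNorm (mode n k) : ℝ)| ≤ M * |(divisor n k : ℝ)|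
  coord_le : ∀ j k, divisor n k ≠ 0 → |((k j : ℤ) : ℝ)| ≤ M * |(divisor n k : ℝ)|

variable {n : Fin b → Fin d → ℤ} {M : ℝ}

/-- The right-hand side of the equations at the nonresonant modes. -/
def nonresMap (hM : DivisorBound n M) (α : ℕ → ℝ) (a : Fin b → ℝ) (v : Wiener b τ) :
    Wiener b τ :=
  multiplier (nonresSymbol n fun k => sqNorm (mode n k)) M
      (abs_nonresSymbol_le hM.nonneg hM.sqNorm_le) (nonlinearity α (tangent a + v)) -
    ∑ j, ((sqNorm (n j) : ℝ) * freqShift α a v j) •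
      multiplier (nonresSymbol n fun k => k j) M
        (abs_nonresSymbol_le hM.nonneg (hM.coord_le j)) v

/-- The equation at k reads (D + ∑ k_j|n_j|² shift_j) v_k = |n_k|² N_k, where N is the nonlinearity.
The unbounded shift term is moved to the right and divided by D, which bounds it. -/
theorem coef_nonresMap (hM : DivisorBound n M) (α : ℕ → ℝ) (a : Fin b → ℝ) (v : Wiener b τ)
    (k : Fin b → ℤ) :
    coef k (nonresMap hM α a v) = if ∑ j, k j = 1 ∧ divisor n k ≠ 0 then
      ((sqNorm (mode n k) : ℝ) * coef k (nonlinearity α (tangent a + v)) -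
        (∑ j, ((k j : ℝ) * (sqNorm (n j) : ℝ)) * freqShift α a v j) * coef k v) / divisor n k
      else 0 := by
  rw [nonresMap, coef_sub, coef_sum]
  simp only [coef_smul, coef_multiplier, nonresSymbol]
  split_ifs with h
  · rw [sub_div, Finset.sum_mul, Finset.sum_div]
    congr 1
    · ring
    · exact Finset.sum_congr rfl fun j _ => by ring
  · simp

/-- The terms of higher order in the equations at the resonant modes. -/
def resRem (n : Fin b → Fin d → ℤ) (α : ℕ → ℝ) (a : Fin b → ℝ) (v : Wiener b τ)
    (k : Fin b → ℤ) : ℝ :=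
  (∑ j, ((k j : ℝ) * (sqNorm (n j) : ℝ)) * freqRem α a v j) * coef k v -
    (sqNorm (mode n k) : ℝ) * coef k (cubicLin a (v - resProj n v) + remainder α a v)

section Estimates

variable {α : ℕ → ℝ} {a : Fin b → ℝ} {ε C : ℝ} (hB : ExpansionBounds τ α a ε C)
  (hC : 0 ≤ C) (hε : 0 < ε) (hε1 : ε ≤ 1) (ha : ∀ j, ε ≤ a j)
include hB hC hε hε1

theorem norm_nonresMap_zero_le (hM : DivisorBound n M) :
    ‖nonresMap hM α a (0 : Wiener b τ)‖ ≤ 6 * C * M * ε ^ 3 := by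
  have h := hB.norm_nonlinearity_le hC hε hε1 (v := 0) (by rw [norm_zero]; positivity)
  rw [nonresMap]
  simp only [map_zero, smul_zero, Finset.sum_const_zero, sub_zero]
  refine (norm_multiplier_apply_le _ _).trans ?_
  have := mul_le_mul_of_nonneg_left h hM.nonneg
  linarith

include ha

/-- Product rule for shift × v: either v varies, with a shift of size ε², or the shift varies at
rate ε, with w of size ε². Every contribution is O(ε²)‖v - w‖. -/
theorem norm_nonresMap_sub_le (hM : DivisorBound n M) {v w : Wiener b τ} (hv : ‖v‖ ≤ 2 * ε ^ 2)
    (hw : ‖w‖ ≤ 2 * ε ^ 2) :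
    ‖nonresMap hM α a v - nonresMap hM α a w‖ ≤
      (2 + 10 * ∑ j, |(sqNorm (n j) : ℝ)|) * C * M * ε ^ 2 * ‖v - w‖ := by
  have hM0 := hM.nonneg
  have h1 := hB.norm_nonlinearity_sub_le hC hε hε1 hv hw
  set X := ‖v - w‖
  have hX : 0 ≤ X := norm_nonneg _
  set T := fun j => multiplier (τ := τ) (nonresSymbol n fun k => k j) M
    (abs_nonresSymbol_le hM.nonneg (hM.coord_le j)) with hT
  have hTn : ∀ j f, ‖T j f‖ ≤ M * ‖f‖ := fun j f => norm_multiplier_apply_le _ f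
  have e : nonresMap hM α a v - nonresMap hM α a w =
      multiplier (nonresSymbol n fun k => sqNorm (mode n k)) M
        (abs_nonresSymbol_le hM.nonneg hM.sqNorm_le)
        (nonlinearity α (tangent a + v) - nonlinearity α (tangent a + w)) -
      ∑ j, (sqNorm (n j) : ℝ) • (freqShift α a v j • T j (v - w) +
        (freqShift α a v j - freqShift α a w j) • T j w) := by
    rw [nonresMap, nonresMap, map_sub, sub_sub_sub_comm, ← Finset.sum_sub_distrib]
    congr 1
    refine Finset.sum_congr rfl fun j _ => ?_
    simp only [hT, map_sub, mul_smul, sub_smul, smul_sub, smul_add]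
    abel
  rw [e]
  refine (norm_sub_le _ _).trans ?_
  have h2 : ∀ j, ‖(sqNorm (n j) : ℝ) • (freqShift α a v j • T j (v - w) +
      (freqShift α a v j - freqShift α a w j) • T j w)‖ ≤
      |(sqNorm (n j) : ℝ)| * (10 * C * M * ε ^ 2 * X) := fun j => by
    rw [norm_smul, Real.norm_eq_abs]
    gcongr
    refine (norm_add_le _ _).trans ?_
    rw [norm_smul, norm_smul, Real.norm_eq_abs, Real.norm_eq_abs]
    have hε3 : ε ^ 3 ≤ ε ^ 2 := pow_le_pow_of_le_one hε.le hε1 (by norm_num)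
    calc _ ≤ 6 * C * ε ^ 2 * (M * X) + 2 * C * ε * X * (M * (2 * ε ^ 2)) := by
          gcongr
          · exact hB.abs_freqShift_le hC hε hε1 hv (ha j)
          · exact hTn j _
          · exact hB.abs_freqShift_sub_le hC hε hε1 hv hw (ha j)
          · exact (hTn j w).trans (by gcongr)
      _ = C * M * X * (6 * ε ^ 2 + 4 * ε ^ 3) := by ring
      _ ≤ C * M * X * (6 * ε ^ 2 + 4 * ε ^ 2) := by gcongr
      _ = _ := by ring
  calc _ ≤ M * (2 * C * ε ^ 2 * X) + ∑ j, |(sqNorm (n j) : ℝ)| * (10 * C * M * ε ^ 2 * X) := by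
        gcongr
        · exact (norm_multiplier_apply_le _ _).trans (by gcongr)
        · exact (norm_sum_le _ _).trans (Finset.sum_le_sum fun j _ => h2 j)
    _ = _ := by rw [← Finset.sum_mul]; ring

omit hC hε hε1 ha in
theorem abs_resRem_zero_le {k : Fin b → ℤ} {L : ℝ} (hL : |(sqNorm (mode n k) : ℝ)| ≤ L) :
    |resRem n α a (0 : Wiener b τ) k| ≤ L * C * ε ^ 5 := by
  have : resRem n α a (0 : Wiener b τ) k =
      -((sqNorm (mode n k) : ℝ) * coef k (remainder α a (0 : Wiener b τ))) := by
    simp [resRem, cubicLin_zero]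
  rw [this, abs_neg, abs_mul, mul_assoc]
  exact mul_le_mul hL ((abs_coef_le _ _).trans hB.rem_zero) (abs_nonneg _)
    ((abs_nonneg _).trans hL)

/-- The action of `cubicLin` on the resonant component has gone into A. Thus only the nonresonant
component enters with the weak factor ε², and everything else gains ε³. -/
theorem abs_resRem_sub_le {v w : Wiener b τ} (hv : ‖v‖ ≤ 2 * ε ^ 2) (hw : ‖w‖ ≤ 2 * ε ^ 2)
    {k : Fin b → ℤ} {L : ℝ} (hL : |(sqNorm (mode n k) : ℝ)| ≤ L)
    (hL' : ∑ j, |(k j : ℝ) * (sqNorm (n j) : ℝ)| ≤ L) :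
    |resRem n α a v k - resRem n α a w k| ≤
      10 * L * C * (ε ^ 3 * ‖v - w‖ + ε ^ 2 * ‖(v - resProj n v) - (w - resProj n w)‖) := by
  have hL0 : 0 ≤ L := (abs_nonneg _).trans hL
  set X := ‖v - w‖ with hX
  have hX0 : 0 ≤ X := norm_nonneg _
  set Y := ‖(v - resProj n v) - (w - resProj n w)‖ with hY
  have hY0 : 0 ≤ Y := norm_nonneg _
  set g : Wiener b τ → ℝ := fun v => ∑ j, ((k j : ℝ) * (sqNorm (n j) : ℝ)) * freqRem α a v j
    with hg
  have hgv : |g v| ≤ L * (5 * C * ε ^ 3) := by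
    refine (Finset.abs_sum_le_sum_abs _ _).trans
      (le_trans ?_ (mul_le_mul_of_nonneg_right hL' (by positivity)))
    rw [Finset.sum_mul]
    refine Finset.sum_le_sum fun j _ => ?_
    rw [abs_mul]
    gcongr
    exact hB.abs_freqRem_le hC hε hε1 hv (ha j)
  have hgvw : |g v - g w| ≤ L * (2 * C * ε * X) := by
    rw [hg, ← Finset.sum_sub_distrib]
    refine (Finset.abs_sum_le_sum_abs _ _).trans
      (le_trans ?_ (mul_le_mul_of_nonneg_right hL' (by positivity)))
    rw [Finset.sum_mul]
    refine Finset.sum_le_sum fun j _ => ?_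
    rw [← mul_sub, abs_mul]
    gcongr
    exact hB.abs_freqRem_sub_le hC hε hε1 hv hw (ha j)
  have e : resRem n α a v k - resRem n α a w k =
      g v * coef k (v - w) + (g v - g w) * coef k w -
        (sqNorm (mode n k) : ℝ) * (coef k (cubicLin a ((v - resProj n v) - (w - resProj n w))) +
          coef k (remainder α a v - remainder α a w)) := by
    simp only [resRem, cubicLin_sub, coef_sub, coef_add, hg]
    ring
  rw [e]
  refine (abs_sub _ _).trans ((add_le_add (abs_add_le _ _) le_rfl).trans ?_)
  rw [abs_mul, abs_mul, abs_mul]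
  calc _ ≤ L * (5 * C * ε ^ 3) * X + L * (2 * C * ε * X) * (2 * ε ^ 2) +
        L * (C * ε ^ 2 * Y + C * ε ^ 3 * X) := by
        gcongr
        · exact abs_coef_le _ _
        · exact (abs_coef_le _ _).trans hw
        · refine (abs_add_le _ _).trans (add_le_add ?_ ?_)
          · exact (abs_coef_le _ _).trans (hB.lin _)
          · exact (abs_coef_le _ _).trans (hB.rem v w hv hw)
    _ = 10 * L * C * (ε ^ 3 * X) + L * C * (ε ^ 2 * Y) := by ring
    _ ≤ 10 * L * C * (ε ^ 3 * X) + 10 * L * C * (ε ^ 2 * Y) := by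
        have : 0 ≤ L * C * (ε ^ 2 * Y) := by positivity
        linarith
    _ = _ := by ring

end Estimates

variable [Fintype (resonantModes₂ n)]

/-- The right-hand side of the equations at the resonant modes. -/
def resMap (α : ℕ → ℝ) (a : Fin b → ℝ) (B : Matrix (resonantModes₂ n) (resonantModes₂ n) ℝ)
    (v : Wiener b τ) : Wiener b τ :=
  ∑ k : resonantModes₂ n, (1 / 2 * ∑ k' : resonantModes₂ n, B k k' * resRem n α a v k'.1) •
    delta k.1

theorem coef_resMap (α : ℕ → ℝ) (a : Fin b → ℝ)
    (B : Matrix (resonantModes₂ n) (resonantModes₂ n) ℝ) (v : Wiener b τ)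
    (k : resonantModes₂ n) :
    coef k.1 (resMap α a B v) =
      1 / 2 * ∑ k' : resonantModes₂ n, B k k' * resRem n α a v k'.1 := by
  rw [resMap, coef_sum, Finset.sum_eq_single k]
  · rw [coef_smul, coef_delta, if_pos rfl, mul_one]
  · intro l _ hl
    rw [coef_smul, coef_delta, if_neg fun h => hl (Subtype.ext h.symm), mul_zero]
  · simp

theorem coef_resMap_of_notMem (α : ℕ → ℝ) (a : Fin b → ℝ)
    (B : Matrix (resonantModes₂ n) (resonantModes₂ n) ℝ) (v : Wiener b τ)
    {k : Fin b → ℤ} (hk : k ∉ resonantModes₂ n) : coef k (resMap α a B v) = 0 := by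
  rw [resMap, coef_sum]
  refine Finset.sum_eq_zero fun l _ => ?_
  rw [coef_smul, coef_delta, if_neg, mul_zero]
  rintro rfl
  exact hk l.2

/-- The sum of the weights of the resonant modes, times half of their number. -/
def resWeight (n : Fin b → Fin d → ℤ) [Fintype (resonantModes₂ n)] (τ : ℝ≥0) : ℝ :=
  ∑ k : resonantModes₂ n, 1 / 2 * (Fintype.card (resonantModes₂ n) * expWeight τ k.1)

theorem resWeight_nonneg : 0 ≤ resWeight n τ :=
  Finset.sum_nonneg fun k _ => by
    have := expWeight_pos τ k.1
    positivity

theorem norm_sum_smul_delta_le {B : Matrix (resonantModes₂ n) (resonantModes₂ n) ℝ} {β x : ℝ}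
    (hβ : ∀ k k', |B k k'| ≤ β) {y : resonantModes₂ n → ℝ} (hy : ∀ k, |y k| ≤ x) :
    ‖∑ k : resonantModes₂ n, (1 / 2 * ∑ k' : resonantModes₂ n, B k k' * y k') •
      (delta k.1 : Wiener b τ)‖ ≤ resWeight n τ * (β * x) := by
  refine (norm_sum_le _ _).trans ?_
  rw [resWeight, Finset.sum_mul]
  refine Finset.sum_le_sum fun k _ => ?_
  have hβ0 : 0 ≤ β := (abs_nonneg _).trans (hβ k k)
  have h1 : |∑ k' : resonantModes₂ n, B k k' * y k'| ≤
      Fintype.card (resonantModes₂ n) * (β * x) := by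
    refine (Finset.abs_sum_le_sum_abs _ _).trans ((Finset.sum_le_card_nsmul _ _ (β * x)
      fun k' _ => ?_).trans_eq ?_)
    · rw [abs_mul]
      exact mul_le_mul (hβ k k') (hy k') (abs_nonneg _) hβ0
    · rw [nsmul_eq_mul, Finset.card_univ]
  rw [norm_smul, norm_delta, Real.norm_eq_abs, abs_mul, abs_of_pos (by norm_num : (0 : ℝ) < 1 / 2)]
  have h2 := expWeight_pos τ k.1
  calc _ ≤ 1 / 2 * (Fintype.card (resonantModes₂ n) * (β * x)) * expWeight τ k.1 := by gcongr
    _ = _ := by ring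

theorem norm_resMap_zero_le {α : ℕ → ℝ} {a : Fin b → ℝ} {ε C L β : ℝ}
    (hB : ExpansionBounds τ α a ε C)
    (hL : ∀ k : resonantModes₂ n, |(sqNorm (mode n k.1) : ℝ)| ≤ L)
    {B : Matrix (resonantModes₂ n) (resonantModes₂ n) ℝ} (hβ : ∀ k k', |B k k'| ≤ β) :
    ‖resMap α a B (0 : Wiener b τ)‖ ≤ resWeight n τ * (β * (L * C * ε ^ 5)) :=
  norm_sum_smul_delta_le hβ fun k => abs_resRem_zero_le hB (hL k)

theorem norm_resMap_sub_le {α : ℕ → ℝ} {a : Fin b → ℝ} {ε C L β : ℝ}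
    (hB : ExpansionBounds τ α a ε C) (hC : 0 ≤ C) (hε : 0 < ε) (hε1 : ε ≤ 1)
    (ha : ∀ j, ε ≤ a j)
    (hL : ∀ k : resonantModes₂ n, |(sqNorm (mode n k.1) : ℝ)| ≤ L)
    (hL' : ∀ k : resonantModes₂ n, ∑ j, |(k.1 j : ℝ) * (sqNorm (n j) : ℝ)| ≤ L)
    {B : Matrix (resonantModes₂ n) (resonantModes₂ n) ℝ} (hβ : ∀ k k', |B k k'| ≤ β)
    {v w : Wiener b τ} (hv : ‖v‖ ≤ 2 * ε ^ 2) (hw : ‖w‖ ≤ 2 * ε ^ 2) :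
    ‖resMap α a B v - resMap α a B w‖ ≤ resWeight n τ * (β * (10 * L * C *
      (ε ^ 3 * ‖v - w‖ + ε ^ 2 * ‖(v - resProj n v) - (w - resProj n w)‖))) := by
  have e : resMap α a B v - resMap α a B w = ∑ k : resonantModes₂ n,
      (1 / 2 * ∑ k' : resonantModes₂ n, B k k' * (resRem n α a v k'.1 - resRem n α a w k'.1)) •
        delta k.1 := by
    rw [resMap, resMap, ← Finset.sum_sub_distrib]
    simp only [← sub_smul, ← mul_sub, ← Finset.sum_sub_distrib]
  rw [e]
  exact norm_sum_smul_delta_le hβ fun k =>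
    abs_resRem_sub_le hB hC hε hε1 ha hv hw (hL k) (hL' k)

end FixedPoint

end

end QuasiNLS

namespace QuasiNLS

noncomputable section

open scoped NNReal

/-! ### Solution of the fixed point problem -/

/-- The ball is invariant because ‖Φ v‖ ≤ ‖v‖/2 + ‖Φ 0‖ ≤ R; then the contraction principle applies.
-/
theorem exists_fixedPoint_of_contraction {E : Type*} [NormedAddCommGroup E] [CompleteSpace E]
    {Φ : E → E} {R : ℝ} (hR : 0 ≤ R)
    (hΦ : ∀ v w, ‖v‖ ≤ R → ‖w‖ ≤ R → ‖Φ v - Φ w‖ ≤ 1 / 2 * ‖v - w‖) (h0 : ‖Φ 0‖ ≤ R / 2) :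
    ∃ v, ‖v‖ ≤ R ∧ Φ v = v := by
  have hmaps : Set.MapsTo Φ (Metric.closedBall 0 R) (Metric.closedBall 0 R) := by
    intro v hv
    rw [mem_closedBall_zero_iff] at hv ⊢
    have h1 := hΦ v 0 hv (by rwa [norm_zero])
    rw [sub_zero] at h1
    have h2 := norm_add_le (Φ v - Φ 0) (Φ 0)
    rw [sub_add_cancel] at h2
    linarith
  have hc : ContractingWith (1 / 2) (hmaps.restrict Φ _ _) := by
    refine ⟨by rw [← NNReal.coe_lt_coe]; norm_num, LipschitzWith.of_dist_le_mul ?_⟩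
    rintro ⟨v, hv⟩ ⟨w, hw⟩
    rw [mem_closedBall_zero_iff] at hv hw
    simpa [Subtype.dist_eq, dist_eq_norm] using hΦ v w hv hw
  obtain ⟨v, hv, hfix, -⟩ := hc.exists_fixedPoint' Metric.isClosed_closedBall.isComplete hmaps
    (x := 0) (by simpa using hR) (edist_ne_top _ _)
  exact ⟨v, by simpa using hv, hfix⟩

section FixedPoint

variable {b d : ℕ} {τ : ℝ≥0}

open Wiener

variable {n : Fin b → Fin d → ℤ} {M : ℝ}

theorem resProj_nonresMap (hM : DivisorBound n M) (α : ℕ → ℝ) (a : Fin b → ℝ) (v : Wiener b τ) :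
    resProj n (nonresMap hM α a v) = 0 := by
  ext k
  rw [coef_zero]
  by_cases hk : k ∈ resonantModes₂ n
  · rw [coef_resProj_of_mem hk, coef_nonresMap, if_neg fun h => h.2
      (mem_resonantModes_iff.1 hk.1).2]
  · exact coef_resProj_of_notMem hk _

theorem resProj_resProj (v : Wiener b τ) : resProj n (resProj n v) = resProj n v := by
  ext k
  by_cases hk : k ∈ resonantModes₂ n
  · rw [coef_resProj_of_mem hk]
  · rw [coef_resProj_of_notMem hk, coef_resProj_of_notMem hk]

theorem coef_nonresMap_of_mem (hM : DivisorBound n M) (α : ℕ → ℝ) (a : Fin b → ℝ)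
    (v : Wiener b τ) {k : Fin b → ℤ} (hk : k ∈ resonantModes n) :
    coef k (nonresMap hM α a v) = 0 := by
  rw [coef_nonresMap, if_neg fun h => h.2 (mem_resonantModes_iff.1 hk).2]

variable [Fintype (resonantModes₂ n)]

theorem resProj_resMap (α : ℕ → ℝ) (a : Fin b → ℝ)
    (B : Matrix (resonantModes₂ n) (resonantModes₂ n) ℝ) (v : Wiener b τ) :
    resProj n (resMap α a B v) = resMap α a B v := by
  ext k
  by_cases hk : k ∈ resonantModes₂ n
  · rw [coef_resProj_of_mem hk]
  · rw [coef_resProj_of_notMem hk, coef_resMap_of_notMem α a B v hk]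

/-- The equations at the nonresonant and the resonant modes have a common solution of size `ε²`, if
the inverse of the resonance matrix is bounded by a small multiple of `ε⁻³`. -/
theorem exists_solution (hM : DivisorBound n M) (τ : ℝ≥0) {C : ℝ} (hC : 0 ≤ C) :
    ∃ δ ε₁ : ℝ, 0 < δ ∧ 0 < ε₁ ∧ ∀ (ε : ℝ) (α : ℕ → ℝ) (a : Fin b → ℝ), 0 < ε → ε < ε₁ → ε ≤ 1 →
      (∀ j, ε ≤ a j) → ExpansionBounds τ α a ε C →
      ∀ B : Matrix (resonantModes₂ n) (resonantModes₂ n) ℝ, (∀ k k', |B k k'| ≤ δ / ε ^ 3) →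
        ∃ v : Wiener b τ, ‖v‖ ≤ ε ^ 2 ∧ v = nonresMap hM α a v + resMap α a B v := by
  set Λ : ℝ := ∑ j, |(sqNorm (n j) : ℝ)| with hΛ
  have hΛ0 : 0 ≤ Λ := Finset.sum_nonneg fun _ _ => abs_nonneg _
  have hM0 := hM.nonneg
  set L : ℝ := ∑ k : resonantModes₂ n, (|(sqNorm (mode n k.1) : ℝ)| +
    ∑ j, |(k.1 j : ℝ) * (sqNorm (n j) : ℝ)|) with hLdef
  have hLk : ∀ k : resonantModes₂ n, |(sqNorm (mode n k.1) : ℝ)| +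
      ∑ j, |(k.1 j : ℝ) * (sqNorm (n j) : ℝ)| ≤ L := fun k =>
    Finset.single_le_sum (f := fun k : resonantModes₂ n => |(sqNorm (mode n k.1) : ℝ)| +
      ∑ j, |(k.1 j : ℝ) * (sqNorm (n j) : ℝ)|) (fun k _ => by positivity) (Finset.mem_univ k)
  have hL : ∀ k : resonantModes₂ n, |(sqNorm (mode n k.1) : ℝ)| ≤ L := fun k =>
    (le_add_of_nonneg_right (by positivity)).trans (hLk k)
  have hL' : ∀ k : resonantModes₂ n, ∑ j, |(k.1 j : ℝ) * (sqNorm (n j) : ℝ)| ≤ L := fun k =>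
    (le_add_of_nonneg_left (abs_nonneg _)).trans (hLk k)
  have hL0 : 0 ≤ L := Finset.sum_nonneg fun _ _ => by positivity
  set P : ℝ := (2 + 10 * Λ) * C * M + 6 * C * M with hP
  have hP0 : 0 ≤ P := by positivity
  set Q : ℝ := resWeight n τ * (10 * L * C) with hQ
  have hw0 : 0 ≤ resWeight n τ := resWeight_nonneg
  have hQ0 : 0 ≤ Q := by positivity
  -- Chosen so that the resonant equations contract with constant 1/4; the other 1/4 comes from the
  -- nonresonant ones, for small ε.
  set δ : ℝ := 1 / (4 * (Q * (2 * P + 1) + 1)) with hδ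
  have hδ0 : 0 < δ := by positivity
  have hδQ : δ * Q * (2 * P + 1) ≤ 1 / 4 := by
    rw [hδ, div_mul_eq_mul_div, div_mul_eq_mul_div, div_le_iff₀ (by positivity)]
    linarith
  refine ⟨δ, 1 / (4 * (P + 1)), hδ0, by positivity, fun ε α a hε hε' hε1 ha hB B hβ => ?_⟩
  have hPε : P * ε ≤ 1 / 4 := by
    rw [lt_div_iff₀ (by positivity)] at hε'
    linarith
  have hε2 : ε ^ 2 ≤ ε := by nlinarith
  have hPε2 : P * ε ^ 2 ≤ 1 / 4 := (mul_le_mul_of_nonneg_left hε2 hP0).trans hPε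
  have hε2pos : 0 < ε ^ 2 := by positivity
  have hε3 : ε ^ 3 ≤ ε ^ 2 := pow_le_pow_of_le_one hε.le hε1 (by norm_num)
  set W : Wiener b τ → Wiener b τ := nonresMap hM α a with hW
  have hWsub : ∀ v w, ‖v‖ ≤ 2 * ε ^ 2 → ‖w‖ ≤ 2 * ε ^ 2 → ‖W v - W w‖ ≤ P * ε ^ 2 * ‖v - w‖ :=
    fun v w hv hw => by
    refine (norm_nonresMap_sub_le hB hC hε hε1 ha hM hv hw).trans ?_
    refine mul_le_mul_of_nonneg_right (mul_le_mul_of_nonneg_right ?_ hε2pos.le) (norm_nonneg _)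
    rw [hP]
    have : 0 ≤ 6 * C * M := by positivity
    linarith
  have hWzero : ‖W 0‖ ≤ P * ε ^ 3 := by
    refine (norm_nonresMap_zero_le hB hC hε hε1 hM).trans ?_
    refine mul_le_mul_of_nonneg_right ?_ (by positivity)
    rw [hP]
    have : 0 ≤ (2 + 10 * Λ) * C * M := by positivity
    linarith
  have hWle : ∀ v, ‖v‖ ≤ ε ^ 2 → ‖W v‖ ≤ 1 / 2 * ε ^ 2 := fun v hv => by
    have h1 := hWsub v 0 (by linarith) (by rw [norm_zero]; positivity)
    have h2 := norm_add_le (W v - W 0) (W 0)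
    rw [sub_add_cancel] at h2
    rw [sub_zero] at h1
    have h3 : P * ε ^ 2 * ‖v‖ ≤ 1 / 4 * ε ^ 2 := by gcongr
    have h4 : P * ε ^ 3 = (P * ε) * ε ^ 2 := by ring
    have h5 : (P * ε) * ε ^ 2 ≤ 1 / 4 * ε ^ 2 := by gcongr
    linarith
  -- After multiplication by an inverse of size δ/ε³, the nonresonant component enters with a factor
  -- 1/ε, so v ↦ W v + `resMap` v need not contract.
  have hQsub : ∀ v w, ‖v‖ ≤ 2 * ε ^ 2 → ‖w‖ ≤ 2 * ε ^ 2 →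
      ‖resMap α a B v - resMap α a B w‖ ≤ δ * Q *
        (‖v - w‖ + ‖(v - resProj n v) - (w - resProj n w)‖ / ε) := fun v w hv hw => by
    refine (norm_resMap_sub_le hB hC hε hε1 ha hL hL' hβ hv hw).trans_eq ?_
    rw [hQ]
    field_simp
  have hQzero : ‖resMap α a B (0 : Wiener b τ)‖ ≤ δ * Q * ε ^ 2 := by
    refine (norm_resMap_zero_le hB hL hβ).trans ?_
    have e : resWeight n τ * (δ / ε ^ 3 * (L * C * ε ^ 5)) = δ * (resWeight n τ * (L * C)) * ε ^ 2 := by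
      field_simp
    rw [e, hQ]
    gcongr
    nlinarith
  -- Remedy: before `resMap` is applied, the nonresonant component of v is replaced by W v, whose
  -- Lipschitz constant Pε² outweighs the factor 1/ε. The ball of radius 2ε² in the bounds leaves
  -- room for x v.
  set x : Wiener b τ → Wiener b τ := fun v => W v + resProj n v with hx
  have hxle : ∀ v, ‖v‖ ≤ ε ^ 2 → ‖x v‖ ≤ 2 * ε ^ 2 := fun v hv => by
    have h1 := norm_add_le (W v) (resProj n v)
    have h2 := hWle v hv
    have h3 := norm_resProj_le n v
    simp only [hx]
    linarith
  have hxP : ∀ v, x v - resProj n (x v) = W v := fun v => by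
    simp only [hx, map_add]
    rw [resProj_nonresMap, resProj_resProj]
    abel
  have hlip : ∀ v w, ‖v‖ ≤ ε ^ 2 → ‖w‖ ≤ ε ^ 2 →
      ‖(W v + resMap α a B (x v)) - (W w + resMap α a B (x w))‖ ≤ 1 / 2 * ‖v - w‖ := by
    intro v w hv hw
    have h1 := hWsub v w (by linarith) (by linarith)
    have h2 := hQsub (x v) (x w) (hxle v hv) (hxle w hw)
    rw [hxP, hxP] at h2
    set X := ‖v - w‖
    have hX0 : 0 ≤ X := norm_nonneg _
    have h3 : ‖x v - x w‖ ≤ P * ε ^ 2 * X + X := by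
      have e : x v - x w = (W v - W w) + resProj n (v - w) := by
        simp only [hx, map_sub]
        abel
      rw [e]
      exact (norm_add_le _ _).trans (add_le_add h1 (norm_resProj_le n _))
    have h4 : ‖W v - W w‖ / ε ≤ P * ε * X := by
      rw [div_le_iff₀ hε]
      exact h1.trans_eq (by ring)
    have h5 : ‖resMap α a B (x v) - resMap α a B (x w)‖ ≤ 1 / 4 * X := by
      calc _ ≤ δ * Q * (P * ε ^ 2 * X + X + P * ε * X) := h2.trans (by gcongr)
        _ = δ * Q * (P * ε ^ 2 + P * ε + 1) * X := by ring
        _ ≤ δ * Q * (P * 1 + P * 1 + 1) * X := by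
          gcongr
          exact hε2.trans hε1
        _ = δ * Q * (2 * P + 1) * X := by ring
        _ ≤ _ := by gcongr
    have e : W v + resMap α a B (x v) - (W w + resMap α a B (x w)) =
        (W v - W w) + (resMap α a B (x v) - resMap α a B (x w)) := by abel
    rw [e]
    have h6 : P * ε ^ 2 * X ≤ 1 / 4 * X := by gcongr
    exact (norm_add_le _ _).trans (by linarith)
  have hzero : ‖W 0 + resMap α a B (x 0)‖ ≤ ε ^ 2 / 2 := by
    have hx0 : x 0 = W 0 := by simp [hx]
    have h0 : ‖(0 : Wiener b τ)‖ ≤ 2 * ε ^ 2 := by rw [norm_zero]; positivity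
    have h1 := hQsub (x 0) 0 (hxle 0 (by rw [norm_zero]; positivity)) h0
    rw [hxP, map_zero, sub_zero, sub_zero, sub_zero, hx0] at h1
    have h2 := norm_add_le (resMap α a B (W 0) - resMap α a B 0) (resMap α a B 0)
    rw [sub_add_cancel] at h2
    have h4 : ‖W 0‖ / ε ≤ P * ε ^ 2 := by
      rw [div_le_iff₀ hε]
      exact hWzero.trans_eq (by ring)
    have h5 : δ * Q * (‖W 0‖ + ‖W 0‖ / ε) + δ * Q * ε ^ 2 ≤ 1 / 4 * ε ^ 2 := by
      calc _ ≤ δ * Q * (P * ε ^ 2 + P * ε ^ 2) + δ * Q * ε ^ 2 := by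
            gcongr
            exact hWzero.trans (by gcongr)
        _ = δ * Q * (2 * P + 1) * ε ^ 2 := by ring
        _ ≤ _ := by gcongr
    have h6 : P * ε ^ 3 = (P * ε) * ε ^ 2 := by ring
    have h7 : (P * ε) * ε ^ 2 ≤ 1 / 4 * ε ^ 2 := by gcongr
    rw [hx0]
    refine (norm_add_le _ _).trans ?_
    linarith
  obtain ⟨v, hv, hfix⟩ := exists_fixedPoint_of_contraction
    (Φ := fun v => W v + resMap α a B (x v)) hε2pos.le hlip hzero
  refine ⟨v, hv, ?_⟩
  -- Projecting the fixed point equation gives the resonant part of v, so x v = v and the modified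
  -- equation is the original one.
  have h1 : resProj n v = resMap α a B (x v) := by
    conv_lhs => rw [← hfix]
    rw [map_add, resProj_nonresMap, zero_add, resProj_resMap]
  have h2 : x v = v := by
    change W v + resProj n v = v
    rw [h1]
    exact hfix
  rw [h2] at hfix
  exact hfix.symm

/-- The equations at the nonresonant and the resonant modes are the equations for the Fourier
coefficients. -/
theorem coef_equation (hM : DivisorBound n M) {α : ℕ → ℝ} {a : Fin b → ℝ} (ρ : ℝ)
    (ha : ∀ j, a j ≠ 0)
    (hnp : ∀ i j l : Fin b, stdVec i + stdVec j - stdVec l ∉ resonantModes₂ n)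
    {B : Matrix (resonantModes₂ n) (resonantModes₂ n) ℝ} (hAB : realResonanceMatrix n a * B = 1)
    {v : Wiener b τ} (hv : v = nonresMap hM α a v + resMap α a B v)
    (hgr : nonlinearity α (tangent a + v) ∈ graded 1) (hvgr : v ∈ graded 1)
    (hve : ∀ j, coef (stdVec j) v = 0) (k : Fin b → ℤ) :
    (-(∑ j, (k j : ℝ) * ((sqNorm (n j) : ℝ) + ρ - (sqNorm (n j) : ℝ) * freqShift α a v j)) +
        (sqNorm (mode n k) : ℝ) + ρ) * coef k (tangent a + v) -
      (sqNorm (mode n k) : ℝ) * coef k (nonlinearity α (tangent a + v)) = 0 := by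
  by_cases hk : ∑ j, k j = 1
  swap
  · rw [hgr k hk, Submodule.add_mem _ (tangent_mem_graded a) hvgr k hk]
    ring
  have hkR : ∑ j, (k j : ℝ) = 1 := by exact_mod_cast hk
  -- Since ∑ k_j = 1, the two occurrences of ρ cancel.
  have e : -(∑ j, (k j : ℝ) * ((sqNorm (n j) : ℝ) + ρ - (sqNorm (n j) : ℝ) * freqShift α a v j)) +
      (sqNorm (mode n k) : ℝ) + ρ =
      (divisor n k : ℝ) + ∑ j, ((k j : ℝ) * (sqNorm (n j) : ℝ)) * freqShift α a v j := by
    simp only [mul_sub, mul_add, Finset.sum_sub_distrib, Finset.sum_add_distrib, ← Finset.sum_mul,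
      hkR, divisor]
    push_cast
    simp only [mul_assoc]
    ring
  rw [e]
  by_cases hd : divisor n k = 0
  · rw [hd, Int.cast_zero, zero_add]
    by_cases hks : k ∈ Set.range stdVec
    · obtain ⟨j, rfl⟩ := hks
      rw [coef_add, hve, coef_tangent_stdVec, mode_stdVec, add_zero, Finset.sum_eq_single j]
      -- At e_j the equation holds by the choice of the frequency.
      · have : freqShift α a v j * a j = coef (stdVec j) (nonlinearity α (tangent a + v)) :=
          div_mul_cancel₀ _ (ha j)
        rw [← this]
        simp [stdVec]
        ring
      · intro i _ hi
        simp [stdVec, hi]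
      · simp
    · have hk2 : k ∈ resonantModes₂ n := ⟨mem_resonantModes_iff.2 ⟨hk, hd⟩, hks⟩
      have h1 := coef_cubicLin_resProj n a ⟨k, hk2⟩ v
      have hq : ∀ k' : resonantModes₂ n, coef k'.1 v =
          1 / 2 * ∑ l, B k' l * resRem n α a v l.1 := fun k' => by
        conv_lhs => rw [hv]
        rw [coef_add, coef_nonresMap_of_mem hM α a v k'.2.1, zero_add, coef_resMap]
      -- The coefficients of v on 𝒦₂ are (1/2)B · `resRem`, and AB = 1.
      have h2 : 2 * ∑ k' : resonantModes₂ n, realResonanceMatrix n a ⟨k, hk2⟩ k' * coef k'.1 v =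
          resRem n α a v k := by
        have h3 := congrFun (congrArg (fun T => Matrix.mulVec T fun l : resonantModes₂ n =>
          resRem n α a v l.1) hAB) ⟨k, hk2⟩
        simp only [Matrix.one_mulVec, ← Matrix.mulVec_mulVec] at h3
        rw [← h3, Matrix.mulVec, dotProduct, Finset.mul_sum]
        refine Finset.sum_congr rfl fun k' _ => ?_
        rw [hq, Matrix.mulVec, dotProduct]
        ring
      -- The cubic source lives on the indices e_i + e_l - e_m, which `hnp` keeps out of 𝒦₂.
      have hmono : coef k (monomial 1 (tangent a : Wiener b τ)) = 0 := by
        rw [coef_monomial_tangent]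
        refine Finset.sum_eq_zero fun i _ => Finset.sum_eq_zero fun l _ => ?_
        rw [coef_tangent_of_notMem, mul_zero]
        rintro ⟨m, hm⟩
        refine hnp i l m ?_
        rw [hm, sub_sub_cancel]
        exact hk2
      have hf : ∑ j, ((k j : ℝ) * (sqNorm (n j) : ℝ)) * freqShift α a v j =
          ∑ j, ((k j : ℝ) * (sqNorm (n j) : ℝ)) * (4 * ∑ l, a l ^ 2 - 2 * a j ^ 2) +
          ∑ j, ((k j : ℝ) * (sqNorm (n j) : ℝ)) * freqRem α a v j := by
        rw [← Finset.sum_add_distrib]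
        refine Finset.sum_congr rfl fun j _ => ?_
        rw [freqShift_eq α a v (ha j)]
        ring
      rw [h2, resRem, cubicLin_sub, coef_add, coef_sub] at h1
      rw [coef_add, coef_tangent_of_notMem a hks, zero_add, nonlinearity_tangent_add, coef_add,
        coef_add, coef_smul, hmono, hf]
      linear_combination -h1
  · have hks : k ∉ resonantModes n := fun h => hd (mem_resonantModes_iff.1 h).2
    have hkt : k ∉ Set.range stdVec := by
      rintro ⟨j, rfl⟩
      exact hks (stdVec_mem_resonantModes n j)
    have h1 : coef k v = ((sqNorm (mode n k) : ℝ) * coef k (nonlinearity α (tangent a + v)) -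
        (∑ j, ((k j : ℝ) * (sqNorm (n j) : ℝ)) * freqShift α a v j) * coef k v) /
          divisor n k := by
      conv_lhs => rw [hv]
      rw [coef_add, coef_nonresMap, if_pos ⟨hk, hd⟩,
        coef_resMap_of_notMem α a B v fun h => hks h.1, add_zero]
    rw [eq_div_iff (by exact_mod_cast hd)] at h1
    rw [coef_add, coef_tangent_of_notMem a hkt, zero_add]
    linear_combination h1

end FixedPoint

end

end QuasiNLS

namespace QuasiNLS

noncomputable section

open scoped NNReal

/-! ### Persistence under a bound for the inverse of the resonance matrix -/

section Persistence

variable {b d : ℕ} {n : Fin b → Fin d → ℤ}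

open Wiener

theorem abs_le_vecNorm (a : Fin b → ℝ) (j : Fin b) : |a j| ≤ vecNorm a := by
  rw [vecNorm]
  refine Real.abs_le_sqrt ?_
  exact Finset.single_le_sum (f := fun j => a j ^ 2) (fun _ _ => sq_nonneg _) (Finset.mem_univ j)

theorem vecNorm_le_sum_abs (a : Fin b → ℝ) : vecNorm a ≤ ∑ j, |a j| := by
  rw [vecNorm]
  refine Real.sqrt_le_iff.2 ⟨Finset.sum_nonneg fun _ _ => abs_nonneg _, ?_⟩
  calc ∑ j, a j ^ 2 = ∑ j, |a j| ^ 2 := by simp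
    _ ≤ _ := Finset.sum_sq_le_sq_sum_of_nonneg fun _ _ => abs_nonneg _

/-- Collects the analysis: after this, only a right inverse B of A with entries at most δ/ε³ is
needed. The constants are uniform in a and B. -/
theorem exists_persistsWithShift (hn : Indep n) (hb : 1 ≤ b) [Fintype (resonantModes₂ n)]
    (hnp : ∀ i j l : Fin b, stdVec i + stdVec j - stdVec l ∉ resonantModes₂ n)
    (ρ : ℝ) {α : ℕ → ℝ} (hα : AnalyticNearZero α) {σ s : ℝ} (hσ : 0 < σ) (hs : 0 ≤ s) :
    ∃ δ C ε₀ : ℝ, 0 < δ ∧ 0 < C ∧ 0 < ε₀ ∧ ∀ ε : ℝ, 0 < ε → ε < ε₀ →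
      ∀ a ∈ Set.Icc (fun _ : Fin b => ε) (fun _ => 2 * ε),
      ∀ B : Matrix (resonantModes₂ n) (resonantModes₂ n) ℝ, realResonanceMatrix n a * B = 1 →
        (∀ k k', |B k k'| ≤ δ / ε ^ 3) → PersistsWithShift ρ α n (1 / 2) σ s C a := by
  obtain ⟨τ, hτ, hw⟩ := exists_expWeight n hσ hs
  obtain ⟨r, r₁, hr, hrr, hsr, hsr₁⟩ := hα.exists_radius
  obtain ⟨C, ε₀, hC, hε₀, hε₀1, hexp⟩ := exists_expansionBounds b τ hr hsr₁
  obtain ⟨M, hM0, hMb⟩ := exists_divisor_bound hn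
  have hM : DivisorBound n M := ⟨hM0, fun k hk => (hMb k hk).1, fun j k hk => (hMb k hk).2 j⟩
  obtain ⟨δ, ε₁, hδ, hε₁, hsol⟩ := exists_solution hM τ hC.le
  set Λ : ℝ := ∑ j, |(sqNorm (n j) : ℝ)| with hΛ
  have hΛ0 : 0 ≤ Λ := Finset.sum_nonneg fun _ _ => abs_nonneg _
  have hΛj : ∀ j, |(sqNorm (n j) : ℝ)| ≤ Λ := fun j =>
    Finset.single_le_sum (f := fun j => |(sqNorm (n j) : ℝ)|) (fun _ _ => abs_nonneg _)
      (Finset.mem_univ j)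
  refine ⟨δ, 6 * C * Λ + 1, min ε₀ ε₁, hδ, by positivity, lt_min hε₀ hε₁,
    fun ε hε hεlt a ha B hAB hB => ?_⟩
  have hεε₀ : ε < ε₀ := hεlt.trans_le (min_le_left _ _)
  have hε1 : ε < 1 := hεε₀.trans_le hε₀1
  have ha1 : ∀ j, ε ≤ a j := fun j => ha.1 j
  have hapos : ∀ j, 0 < a j := fun j => hε.trans_le (ha1 j)
  obtain ⟨hE, hball⟩ := hexp ε hε hεε₀ a fun j => by
    rw [abs_of_pos (hapos j)]
    exact ha.2 j
  obtain ⟨v, hv, hveq⟩ := hsol ε α a hε (hεlt.trans_le (min_le_right _ _)) hε1.le ha1 hE B hB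
  have hε2 : 0 < ε ^ 2 := by positivity
  have hv2 : ‖v‖ ≤ 2 * ε ^ 2 := by linarith
  have hur := hball v hv2
  have hve : ∀ j, coef (stdVec j) v = 0 := fun j => by
    rw [hveq, coef_add, coef_nonresMap_of_mem hM α a v (stdVec_mem_resonantModes n j),
      coef_resMap_of_notMem α a B v fun h => h.2 ⟨j, rfl⟩, add_zero]
  have hvgr : v ∈ graded 1 := fun k hk => by
    rw [hveq, coef_add, coef_nonresMap, if_neg fun h => hk h.1,
      coef_resMap_of_notMem α a B v fun h => hk h.1.1, add_zero]
  have hgr : nonlinearity α (tangent a + v) ∈ graded 1 :=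
    nonlinearity_mem_graded hr hsr₁ hur.le (Submodule.add_mem _ (tangent_mem_graded a) hvgr)
  have hεa : ε ≤ vecNorm a :=
    (ha1 ⟨0, hb⟩).trans ((le_abs_self _).trans (abs_le_vecNorm a ⟨0, hb⟩))
  have hmul : ∀ j {x y : ℝ}, |x| ≤ y → |(sqNorm (n j) : ℝ) * x| ≤ |(sqNorm (n j) : ℝ)| * y :=
    fun j x y h => by
      rw [abs_mul]
      gcongr
  refine ⟨fun j => (sqNorm (n j) : ℝ) + ρ - (sqNorm (n j) : ℝ) * freqShift α a v j,
    persists_of_isSolution hw hve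
      (isSolution_of_coef n _ hr hrr hsr hsr₁ hτ hur
        (coef_equation hM ρ (fun j => (hapos j).ne') hnp hAB hveq hgr hvgr hve)) ?_ ?_,
    fun j => ?_⟩
  -- ε² < ε^{3/2} ≤ |a|^{3/2}, which is κ = 1/2.
  · calc ‖v‖ ≤ ε ^ 2 := hv
      _ = ε ^ (2 : ℝ) := by norm_cast
      _ < ε ^ (1 + 1 / 2 : ℝ) := Real.rpow_lt_rpow_of_exponent_gt hε hε1 (by norm_num)
      _ ≤ _ := Real.rpow_le_rpow hε.le hεa (by norm_num)
  · calc _ ≤ ∑ j, |(sqNorm (n j) : ℝ) + ρ - (sqNorm (n j) : ℝ) * freqShift α a v j -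
          linearFreq ρ n j| := vecNorm_le_sum_abs _
      _ ≤ ∑ j, |(sqNorm (n j) : ℝ)| * (6 * C * ε ^ 2) := by
          refine Finset.sum_le_sum fun j _ => ?_
          rw [linearFreq, sub_sub_cancel_left, abs_neg]
          exact hmul j (hE.abs_freqShift_le hC.le hε hε1.le hv2 (ha1 j))
      _ = 6 * C * Λ * ε ^ 2 := by rw [← Finset.sum_mul]; ring
      _ < (6 * C * Λ + 1) * ε ^ 2 := by linarith
      _ ≤ _ := by gcongr
  · have e : (sqNorm (n j) : ℝ) + ρ - (sqNorm (n j) : ℝ) * freqShift α a v j -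
        ((sqNorm (n j) : ℝ) + ρ - (sqNorm (n j) : ℝ) * (4 * ∑ l, a l ^ 2 - 2 * a j ^ 2)) =
        -((sqNorm (n j) : ℝ) * freqRem α a v j) := by
      rw [freqShift_eq α a v (hapos j).ne']
      ring
    rw [e, abs_neg]
    calc _ ≤ |(sqNorm (n j) : ℝ)| * (5 * C * ε ^ 3) :=
          hmul j (hE.abs_freqRem_le hC.le hε hε1.le hv2 (ha1 j))
      _ ≤ Λ * (5 * C * ε ^ 3) := by gcongr; exact hΛj j
      _ ≤ (6 * C * Λ + 1) * ε ^ 3 := by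
          have h1 : 0 ≤ Λ * C * ε ^ 3 := by positivity
          have h2 : 0 ≤ ε ^ 3 := by positivity
          nlinarith
      _ ≤ _ := by gcongr

/-- A is the empty matrix, and B = 0 is its inverse. -/
theorem persistsOnBoxes_of_resonantModes₂_eq_empty (hn : Indep n) (hb : 1 ≤ b)
    (hK : resonantModes₂ n = ∅) (ρ : ℝ) : PersistsOnBoxes ρ n (1 / 2) := by
  intro α hα σ s hσ hs
  have : IsEmpty (resonantModes₂ n) := Set.isEmpty_coe_sort.2 hK
  let _ : Fintype (resonantModes₂ n) := Fintype.ofIsEmpty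
  obtain ⟨δ, C, ε₀, -, hC, hε₀, h⟩ := exists_persistsWithShift hn hb
    (by simp [hK]) ρ hα hσ ((by positivity : (0 : ℝ) ≤ b / 2).trans hs.le)
  exact ⟨C, ε₀, hC, hε₀, fun ε hε hε' a ha => h ε hε hε' a ha 0 (Subsingleton.elim _ _)
    fun k => isEmptyElim k⟩

end Persistence

end

end QuasiNLS

namespace QuasiNLS

noncomputable section

open MeasureTheory

/-! ### Sublevel sets of polynomials -/

/-- Over ℂ, |f(t)| is the leading coefficient in modulus times ∏|t - z|. If t is at distance at
least η from the real parts of all roots, every factor is at least η. The exceptional set is a union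
of at most deg f intervals of length 2η. -/
theorem volume_sublevel_polynomial_le (f : Polynomial ℝ) {η : ℝ} (hη : 0 ≤ η) :
    volume {t : ℝ | |f.eval t| < |f.leadingCoeff| * η ^ f.natDegree} ≤
      ENNReal.ofReal (2 * f.natDegree * η) := by
  classical
  set F : Polynomial ℂ := f.map (algebraMap ℝ ℂ) with hF
  have hsplit : F.Splits := IsAlgClosed.splits F
  have hcard : Multiset.card F.roots = f.natDegree := by
    rw [← hsplit.natDegree_eq_card_roots, hF, Polynomial.natDegree_map]
  have hsub : {t : ℝ | |f.eval t| < |f.leadingCoeff| * η ^ f.natDegree} ⊆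
      ⋃ z ∈ F.roots.toFinset, Set.Ioo (z.re - η) (z.re + η) := by
    intro t ht
    rw [Set.mem_ofPred_eq] at ht
    by_contra hnot
    simp only [Set.mem_iUnion, not_exists] at hnot
    refine absurd ht (not_lt.2 ?_)
    have h1 : F.eval (t : ℂ) = ((f.eval t : ℝ) : ℂ) := by
      rw [hF, Polynomial.eval_map_algebraMap]
      exact (Polynomial.aeval_algebraMap_apply ℂ t f)
    have h2 : F.eval (t : ℂ) = F.leadingCoeff * (F.roots.map fun z => (t : ℂ) - z).prod :=
      hsplit.eval_eq_prod_roots t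
    have h3 : |f.eval t| = |f.leadingCoeff| * (F.roots.map fun z => ‖(t : ℂ) - z‖).prod := by
      have h4 := congrArg norm h2
      rw [h1, Complex.norm_real, norm_mul, hF, Polynomial.leadingCoeff_map, Real.norm_eq_abs] at h4
      rw [h4]
      congr 1
      · simp
      · rw [← hF]
        have h5 := Multiset.prod_hom (F.roots.map fun z => (t : ℂ) - z) (normHom : ℂ →*₀ ℝ)
        rw [Multiset.map_map] at h5
        exact h5.symm
    rw [h3, ← hcard]
    gcongr
    have h5 := Multiset.prod_map_le_prod_map₀ (s := F.roots) (fun _ => η)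
      (fun z => ‖(t : ℂ) - z‖) (fun _ _ => hη) fun z hz => by
        have h6 := hnot z (Multiset.mem_toFinset.2 hz)
        rw [Set.mem_Ioo, not_and_or, not_lt, not_lt] at h6
        have h7 := Complex.abs_re_le_norm ((t : ℂ) - z)
        rw [Complex.sub_re, Complex.ofReal_re] at h7
        rcases h6 with h6 | h6
        · linarith [neg_abs_le (t - z.re)]
        · linarith [le_abs_self (t - z.re)]
    simpa using h5
  refine (measure_mono hsub).trans ((measure_biUnion_finset_le _ _).trans ?_)
  simp only [Real.volume_Ioo]
  rw [Finset.sum_congr rfl fun z _ => by rw [show z.re + η - (z.re - η) = 2 * η by ring],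
    Finset.sum_const, nsmul_eq_mul, ← ENNReal.ofReal_natCast, ← ENNReal.ofReal_mul (by positivity)]
  refine ENNReal.ofReal_le_ofReal ?_
  have : (F.roots.toFinset.card : ℝ) ≤ f.natDegree := by
    rw [← hcard]
    exact_mod_cast Multiset.toFinset_card_le _
  nlinarith

/-- The sublevel sets of a nonzero polynomial in the box `[1, 2]^b` are small. -/
theorem exists_volume_sublevel_le {b : ℕ} {P : MvPolynomial (Fin b) ℝ} (hP : P ≠ 0) :
    ∃ γ K : ℝ, 0 < γ ∧ 0 ≤ K ∧ ∀ μ : ℝ, 0 < μ → μ ≤ 1 →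
      volume {y : Fin b → ℝ | y ∈ Set.Icc (fun _ => 1) (fun _ => 2) ∧
        |MvPolynomial.eval y P| ≤ μ} ≤ ENNReal.ofReal (K * μ ^ γ) := by
  have hbox : ∀ m : ℕ, volume (Set.Icc (fun _ : Fin m => (1 : ℝ)) (fun _ => 2)) = 1 := fun m => by
    rw [Real.volume_Icc_pi]
    norm_num
  induction b with
  | zero =>
    obtain ⟨c, rfl⟩ := MvPolynomial.C_surjective (Fin 0) P
    have hc : c ≠ 0 := by
      rintro rfl
      simp at hP
    have hc' : 0 < |c| := abs_pos.2 hc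
    refine ⟨1, 1 / |c|, one_pos, by positivity, fun μ hμ _ => ?_⟩
    by_cases h : |c| ≤ μ
    · refine (measure_mono fun y hy => hy.1).trans ((hbox 0).le.trans ?_)
      rw [ENNReal.one_le_ofReal, Real.rpow_one, one_div_mul_eq_div, one_le_div hc']
      exact h
    · simp [h]
  | succ b ih =>
    -- P as a polynomial in the first variable. Its leading coefficient p has one variable fewer:
    -- the set where |p| ≤ μ^{1/2} is small by induction, and elsewhere the one-variable estimate
    -- applies on each line.
    set q := MvPolynomial.finSuccEquiv ℝ b P with hq
    have hq0 : q ≠ 0 := by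
      rw [hq, Ne, EmbeddingLike.map_eq_zero_iff]
      exact hP
    obtain ⟨γ, K, hγ, hK, h⟩ := ih (Polynomial.leadingCoeff_ne_zero.2 hq0)
    set N := q.natDegree with hN
    set p := q.leadingCoeff with hp
    -- With η = μ^θ this exponent gives μ ≤ μ^{1/2} η^N, as 1/2 + N/(2(N+1)) ≤ 1.
    set θ : ℝ := 1 / (2 * (N + 1)) with hθ
    have hθ0 : 0 < θ := by positivity
    refine ⟨min (γ / 2) θ, K + 2 * N, lt_min (half_pos hγ) hθ0, by positivity, fun μ hμ hμ1 => ?_⟩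
    set e := MeasurableEquiv.piFinSuccAbove (fun _ : Fin (b + 1) => ℝ) 0 with he
    have hpres := volume_preserving_piFinSuccAbove (fun _ : Fin (b + 1) => ℝ) 0
    set η : ℝ := μ ^ θ with hη
    have hη0 : 0 < η := Real.rpow_pos_of_pos hμ _
    have hsqrt : 0 < μ ^ (1 / 2 : ℝ) := Real.rpow_pos_of_pos hμ _
    have hsqrt1 : μ ^ (1 / 2 : ℝ) ≤ 1 := Real.rpow_le_one hμ.le hμ1 (by norm_num)
    have hμη : μ ≤ μ ^ (1 / 2 : ℝ) * η ^ N := by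
      rw [hη, ← Real.rpow_natCast, ← Real.rpow_mul hμ.le, ← Real.rpow_add hμ]
      conv_lhs => rw [← Real.rpow_one μ]
      refine Real.rpow_le_rpow_of_exponent_ge hμ hμ1 ?_
      rw [hθ]
      have : (0 : ℝ) ≤ N := N.cast_nonneg
      rw [one_div_mul_eq_div, div_add_div _ _ (by norm_num) (by positivity),
        div_le_one (by positivity)]
      linarith
    set E₁ : Set (ℝ × (Fin b → ℝ)) := Set.Icc 1 2 ×ˢ
      {y | y ∈ Set.Icc (fun _ => 1) (fun _ => 2) ∧ |MvPolynomial.eval y p| ≤ μ ^ (1 / 2 : ℝ)}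
      with hE₁
    set E₂ : Set (ℝ × (Fin b → ℝ)) := {z | z.2 ∈ Set.Icc (fun _ => 1) (fun _ => 2) ∧
      μ ^ (1 / 2 : ℝ) < |MvPolynomial.eval z.2 p| ∧
        |MvPolynomial.eval (Fin.cons z.1 z.2 : Fin (b + 1) → ℝ) P| ≤ μ} with hE₂
    have hsub : {y : Fin (b + 1) → ℝ | y ∈ Set.Icc (fun _ => 1) (fun _ => 2) ∧
        |MvPolynomial.eval y P| ≤ μ} ⊆ e ⁻¹' (E₁ ∪ E₂) := by
      rintro y ⟨hy, hyP⟩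
      have hy2 : (e y).2 ∈ Set.Icc (fun _ : Fin b => (1 : ℝ)) (fun _ => 2) :=
        ⟨fun i => hy.1 i.succ, fun i => hy.2 i.succ⟩
      have hy1 : (e y).1 ∈ Set.Icc (1 : ℝ) 2 := ⟨hy.1 0, hy.2 0⟩
      by_cases hyp : |MvPolynomial.eval (e y).2 p| ≤ μ ^ (1 / 2 : ℝ)
      · exact Or.inl ⟨hy1, hy2, hyp⟩
      · refine Or.inr ⟨hy2, not_le.1 hyp, ?_⟩
        have : (Fin.cons (e y).1 (e y).2 : Fin (b + 1) → ℝ) = y := Fin.cons_self_tail y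
        rw [this]
        exact hyP
    have hcons : Continuous fun z : ℝ × (Fin b → ℝ) => (Fin.cons z.1 z.2 : Fin (b + 1) → ℝ) := by
      refine continuous_pi fun i => ?_
      refine Fin.cases ?_ (fun i => ?_) i
      · simpa using continuous_fst
      · exact (continuous_apply i).comp continuous_snd
    have hE₂m : MeasurableSet E₂ := by
      refine MeasurableSet.inter ?_ (MeasurableSet.inter ?_ ?_)
      · exact measurable_snd measurableSet_Icc
      · exact measurableSet_lt measurable_const
          ((p.continuous_eval.comp continuous_snd).abs.measurable)
      · exact measurableSet_le ((P.continuous_eval.comp hcons).abs.measurable) measurable_const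
    have hE₁v : volume E₁ ≤ ENNReal.ofReal (K * (μ ^ (1 / 2 : ℝ)) ^ γ) := by
      rw [hE₁, Measure.volume_eq_prod, Measure.prod_prod, Real.volume_Icc]
      norm_num only [ENNReal.ofReal_one, one_mul]
      exact h _ hsqrt hsqrt1
    have hE₂v : volume E₂ ≤ ENNReal.ofReal (2 * N * η) := by
      rw [Measure.volume_eq_prod, Measure.prod_apply_symm hE₂m]
      calc ∫⁻ y, volume ((fun t => (t, y)) ⁻¹' E₂) ≤
          ∫⁻ y, (Set.Icc (fun _ => (1 : ℝ)) (fun _ => 2)).indicator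
            (fun _ => ENNReal.ofReal (2 * N * η)) y := by
            refine lintegral_mono fun y => ?_
            by_cases hy : y ∈ Set.Icc (fun _ : Fin b => (1 : ℝ)) (fun _ => 2)
            swap
            · have h0 : (fun t => (t, y)) ⁻¹' E₂ = ∅ :=
                Set.eq_empty_of_forall_notMem fun t ht => hy ht.1
              rw [h0, measure_empty]
              exact zero_le
            rw [Set.indicator_of_mem hy]
            by_cases hyp : μ ^ (1 / 2 : ℝ) < |MvPolynomial.eval y p|
            swap
            · have h0 : (fun t => (t, y)) ⁻¹' E₂ = ∅ :=
                Set.eq_empty_of_forall_notMem fun t ht => hyp ht.2.1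
              rw [h0, measure_empty]
              exact zero_le
            set f : Polynomial ℝ := q.map (MvPolynomial.eval y) with hf
            have hpy : MvPolynomial.eval y q.leadingCoeff ≠ 0 := fun h0 => by
              rw [← hp] at h0
              rw [h0, abs_zero] at hyp
              exact absurd hyp (not_lt.2 hsqrt.le)
            have hfN : f.natDegree = N := Polynomial.natDegree_map_of_leadingCoeff_ne_zero _ hpy
            have hfl : f.leadingCoeff = MvPolynomial.eval y p :=
              Polynomial.leadingCoeff_map_of_leadingCoeff_ne_zero _ hpy
            have h1 := volume_sublevel_polynomial_le f hη0.le
            rw [hfN, hfl] at h1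
            refine (measure_mono fun t ht => ?_).trans h1
            have ht' := ht.2.2
            rw [MvPolynomial.eval_eq_eval_mv_eval'] at ht'
            refine ht'.trans_lt (hμη.trans_lt ?_)
            exact mul_lt_mul_of_pos_right hyp (pow_pos hη0 _)
        _ = _ := by
            rw [lintegral_indicator_const measurableSet_Icc, hbox, mul_one]
    have h3 : (μ ^ (1 / 2 : ℝ)) ^ γ ≤ μ ^ min (γ / 2) θ := by
      rw [← Real.rpow_mul hμ.le]
      refine Real.rpow_le_rpow_of_exponent_ge hμ hμ1 ((min_le_left _ _).trans_eq ?_)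
      ring
    have h4 : η ≤ μ ^ min (γ / 2) θ :=
      Real.rpow_le_rpow_of_exponent_ge hμ hμ1 (min_le_right _ _)
    calc _ ≤ volume (e ⁻¹' (E₁ ∪ E₂)) := measure_mono hsub
      _ = volume (E₁ ∪ E₂) := hpres.measure_preimage_equiv _
      _ ≤ volume E₁ + volume E₂ := measure_union_le _ _
      _ ≤ ENNReal.ofReal (K * (μ ^ (1 / 2 : ℝ)) ^ γ) + ENNReal.ofReal (2 * N * η) :=
        add_le_add hE₁v hE₂v
      _ = ENNReal.ofReal (K * (μ ^ (1 / 2 : ℝ)) ^ γ + 2 * N * η) :=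
        (ENNReal.ofReal_add (by positivity) (by positivity)).symm
      _ ≤ _ := by
        refine ENNReal.ofReal_le_ofReal ?_
        rw [add_mul]
        gcongr

end

end QuasiNLS

namespace QuasiNLS

noncomputable section

open MeasureTheory

/-! ### Configurations without nontrivial resonant modes -/

section Configurations

variable {b d : ℕ}

theorem inner_toEuclid_sub (x y z w : Fin d → ℤ) :
    inner ℝ (toEuclid x - toEuclid y) (toEuclid z - toEuclid w) =
      ((∑ i, (x i - y i) * (z i - w i) : ℤ) : ℝ) := by
  simp only [PiLp.inner_apply, toEuclid, PiLp.sub_apply]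
  push_cast
  exact Finset.sum_congr rfl fun i _ => by
    simp only [RCLike.inner_apply, conj_trivial]
    ring

theorem toEuclid_injective : Function.Injective (toEuclid : (Fin d → ℤ) → _) := fun x y h => by
  ext i
  have := congrArg (fun z : EuclideanSpace ℝ (Fin d) => z i) h
  simpa [toEuclid] using this

theorem Indep.injective {n : Fin b → Fin d → ℤ} (hn : Indep n) : Function.Injective n :=
  fun _ _ h => LinearIndependent.injective hn (congrArg toEuclid h)

/-- Resonance of e_i + e_j - e_l thus means a right angle at n_l in the triangle n_i, n_j, n_l. -/
theorem divisor_stdVec_add_sub (n : Fin b → Fin d → ℤ) (i j l : Fin b) :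
    divisor n (stdVec i + stdVec j - stdVec l) =
      2 * ∑ x, (n l x - n i x) * (n l x - n j x) := by
  have h1 : mode n (stdVec i + stdVec j - stdVec l) = n i + n j - n l := by
    rw [← mode_stdVec n i, ← mode_stdVec n j, ← mode_stdVec n l]
    simp only [mode, Pi.add_apply, Pi.sub_apply, sub_smul, add_smul, Finset.sum_add_distrib,
      Finset.sum_sub_distrib]
  have h2 : ∑ m, (stdVec i + stdVec j - stdVec l) m * sqNorm (n m) =
      sqNorm (n i) + sqNorm (n j) - sqNorm (n l) := by
    simp only [stdVec, Pi.add_apply, Pi.sub_apply, sub_mul, add_mul, Finset.sum_add_distrib,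
      Finset.sum_sub_distrib, Pi.single_apply, ite_mul, one_mul, zero_mul, Finset.sum_ite_eq',
      Finset.mem_univ, if_true]
  rw [divisor, h1, h2]
  simp only [sqNorm, Pi.add_apply, Pi.sub_apply, Finset.mul_sum, ← Finset.sum_add_distrib,
    ← Finset.sum_sub_distrib]
  exact Finset.sum_congr rfl fun x _ => by ring

/-- Coincidences l = i or l = j give basis vectors; i = j ≠ l would give |n_l - n_i|² = 0, contrary
to injectivity; distinct indices are excluded by the absence of right angles. -/
theorem stdVec_add_sub_notMem_resonantModes₂ {n : Fin b → Fin d → ℤ}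
    (hn : Function.Injective n)
    (hp : ∀ i j l : Fin b, i ≠ j → i ≠ l → j ≠ l →
      inner ℝ (toEuclid (n i) - toEuclid (n j)) (toEuclid (n i) - toEuclid (n l)) ≠ 0)
    (i j l : Fin b) : stdVec i + stdVec j - stdVec l ∉ resonantModes₂ n := by
  rintro ⟨hres, hk⟩
  have hd := (mem_resonantModes_iff.1 hres).2
  rw [divisor_stdVec_add_sub, mul_eq_zero, or_iff_right two_ne_zero] at hd
  by_cases hli : l = i
  · exact hk ⟨j, by rw [hli, add_sub_cancel_left]⟩
  by_cases hlj : l = j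
  · exact hk ⟨i, by rw [hlj, add_sub_cancel_right]⟩
  by_cases hij : i = j
  · subst hij
    rw [Finset.sum_eq_zero_iff_of_nonneg fun x _ => mul_self_nonneg _] at hd
    refine hli (hn (funext fun x => ?_))
    have := mul_self_eq_zero.1 (hd x (Finset.mem_univ x))
    lia
  · refine hp l i j hli hlj hij ?_
    rw [inner_toEuclid_sub, hd, Int.cast_zero]

/-- With k_1 = 1 - k_0 the divisor is k_0(k_0 - 1)|n_0 - n_1|², which vanishes only for k_0 ∈ {0,
1}. -/
theorem resonantModes₂_eq_empty_of_two {n : Fin 2 → Fin d → ℤ} (hn : Function.Injective n) :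
    resonantModes₂ n = ∅ := by
  refine Set.eq_empty_of_forall_notMem fun k hk => ?_
  obtain ⟨hs, hd⟩ := mem_resonantModes_iff.1 hk.1
  rw [Fin.sum_univ_two] at hs
  have h1 : k 1 = 1 - k 0 := by lia
  have h2 : divisor n k = -(k 0 * (1 - k 0)) * ∑ x, (n 0 x - n 1 x) ^ 2 := by
    rw [divisor, Fin.sum_univ_two, h1]
    simp only [sqNorm, mode, Fin.sum_univ_two, Pi.add_apply, Pi.smul_apply, smul_eq_mul, h1,
      Finset.mul_sum, ← Finset.sum_add_distrib, ← Finset.sum_sub_distrib]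
    exact Finset.sum_congr rfl fun x _ => by ring
  have h3 : ∑ x, (n 0 x - n 1 x) ^ 2 ≠ 0 := fun h => by
    rw [Finset.sum_eq_zero_iff_of_nonneg fun x _ => sq_nonneg _] at h
    refine absurd (hn (funext fun x => ?_) : (0 : Fin 2) = 1) (by decide)
    exact sub_eq_zero.1 (pow_eq_zero_iff two_ne_zero |>.1 (h x (Finset.mem_univ x)))
  rw [hd, eq_comm, mul_eq_zero, or_iff_left h3, neg_eq_zero, mul_eq_zero] at h2
  rcases h2 with h2 | h2
  · refine hk.2 ⟨1, ?_⟩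
    ext j
    fin_cases j <;> simp [stdVec, h1, h2]
  · refine hk.2 ⟨0, ?_⟩
    have h4 : k 0 = 1 := by lia
    ext j
    fin_cases j <;> simp [stdVec, h1, h4]

theorem eq_zero_or_one_of_sq_sub {z : ℤ} (h : z ^ 2 - z = 0) : z = 0 ∨ z = 1 := by
  have : z * (z - 1) = 0 := by linarith
  rcases mul_eq_zero.1 this with h | h
  · exact Or.inl h
  · exact Or.inr (by lia)

theorem sq_sub_self_nonneg (z : ℤ) : 0 ≤ z ^ 2 - z := by
  rcases le_or_gt z 0 with h | h
  · nlinarith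
  · nlinarith

/-- The divisor is ∑ c_j(k_j² - k_j), where c_j is the inner product of the two sides at the vertex
n_j. Acute angles make all c_j positive, and z² - z ≥ 0 on the integers, so every k_j is 0 or 1. For
j = 0 the identity z² - z = (1 - z)² - (1 - z) lets k_1 + k_2 stand in for k_0. -/
theorem resonantModes₂_eq_empty_of_acute {n : Fin 3 → Fin d → ℤ}
    (hn : ∀ i j l : Fin 3, i ≠ j → i ≠ l → j ≠ l →
      InnerProductGeometry.angle (toEuclid (n i) - toEuclid (n j))
        (toEuclid (n i) - toEuclid (n l)) < Real.pi / 2) :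
    resonantModes₂ n = ∅ := by
  have hpos : ∀ i j l : Fin 3, i ≠ j → i ≠ l → j ≠ l →
      0 < ∑ x, (n i x - n j x) * (n i x - n l x) := fun i j l hij hil hjl => by
    have h := hn i j l hij hil hjl
    rw [InnerProductGeometry.angle, Real.arccos_lt_pi_div_two] at h
    have h2 : 0 < inner ℝ (toEuclid (n i) - toEuclid (n j)) (toEuclid (n i) - toEuclid (n l)) := by
      by_contra hle
      exact absurd h (not_lt.2 (div_nonpos_of_nonpos_of_nonneg (not_lt.1 hle) (by positivity)))
    rw [inner_toEuclid_sub] at h2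
    exact_mod_cast h2
  refine Set.eq_empty_of_forall_notMem fun k hk => ?_
  obtain ⟨hs, hd⟩ := mem_resonantModes_iff.1 hk.1
  rw [Fin.sum_univ_three] at hs
  have h0 : k 0 = 1 - k 1 - k 2 := by lia
  have hp := hpos 0 1 2 (by decide) (by decide) (by decide)
  have hq := hpos 1 0 2 (by decide) (by decide) (by decide)
  have hr := hpos 2 0 1 (by decide) (by decide) (by decide)
  have h2 : divisor n k =
      (∑ x, (n 0 x - n 1 x) * (n 0 x - n 2 x)) * ((k 1 + k 2) ^ 2 - (k 1 + k 2)) +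
      (∑ x, (n 1 x - n 0 x) * (n 1 x - n 2 x)) * (k 1 ^ 2 - k 1) +
      (∑ x, (n 2 x - n 0 x) * (n 2 x - n 1 x)) * (k 2 ^ 2 - k 2) := by
    rw [divisor, Fin.sum_univ_three]
    simp only [sqNorm, mode, Fin.sum_univ_three, Pi.add_apply, Pi.smul_apply, smul_eq_mul, h0,
      Finset.mul_sum, Finset.sum_mul, ← Finset.sum_add_distrib, ← Finset.sum_sub_distrib]
    exact Finset.sum_congr rfl fun x _ => by ring
  rw [hd] at h2
  have n0 := mul_nonneg hp.le (sq_sub_self_nonneg (k 1 + k 2))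
  have n1 := mul_nonneg hq.le (sq_sub_self_nonneg (k 1))
  have n2 := mul_nonneg hr.le (sq_sub_self_nonneg (k 2))
  have z0 := eq_zero_or_one_of_sq_sub ((mul_eq_zero.1 (le_antisymm (by linarith) n0)).resolve_left
    hp.ne')
  have z1 := eq_zero_or_one_of_sq_sub ((mul_eq_zero.1 (le_antisymm (by linarith) n1)).resolve_left
    hq.ne')
  have z2 := eq_zero_or_one_of_sq_sub ((mul_eq_zero.1 (le_antisymm (by linarith) n2)).resolve_left
    hr.ne')
  rcases z1 with z1 | z1
  · rcases z2 with z2 | z2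
    · refine hk.2 ⟨0, ?_⟩
      ext j
      fin_cases j <;> simp [stdVec, h0, z1, z2]
    · refine hk.2 ⟨2, ?_⟩
      ext j
      fin_cases j <;> simp [stdVec, h0, z1, z2]
  · have z2' : k 2 = 0 := by lia
    refine hk.2 ⟨1, ?_⟩
    ext j
    fin_cases j <;> simp [stdVec, h0, z1, z2']

section Orthogonal

variable {n : Fin b → Fin d → ℤ} {M : ℤ} (hM : 0 < M) (hn : ∀ j, sqNorm (n j) = M)
  (ho : ∀ j l, j ≠ l → inner ℝ (toEuclid (n j)) (toEuclid (n l)) = 0)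
include hM hn ho

theorem indep_of_orthogonal : Indep n := by
  refine linearIndependent_of_ne_zero_of_inner_eq_zero (fun j h => ?_) fun j l hjl => ho j l hjl
  have h1 : n j = 0 := toEuclid_injective (h.trans (by ext; simp [toEuclid]))
  have h2 := hn j
  rw [h1] at h2
  simp [sqNorm] at h2
  exact hM.ne h2

/-- By Pythagoras |n_k|² = M∑k_j², so the divisor is M∑(k_j² - k_j), and its vanishing forces k_j ∈
{0, 1}. -/
theorem resonantModes₂_eq_empty_of_orthogonal : resonantModes₂ n = ∅ := by
  classical
  refine Set.eq_empty_of_forall_notMem fun k hk => ?_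
  have hs : ∑ j, k j = 1 := hk.1.1
  have hdot : ∀ j l, ∑ x, n j x * n l x = if j = l then M else 0 := fun j l => by
    split_ifs with h
    · subst h
      rw [← hn j, sqNorm]
      exact Finset.sum_congr rfl fun x _ => (sq _).symm
    · have h1 := inner_toEuclid_sub (n j) 0 (n l) 0
      have h2 : (toEuclid (0 : Fin d → ℤ)) = 0 := by ext; simp [toEuclid]
      rw [h2, sub_zero, sub_zero, ho j l h] at h1
      simp only [Pi.zero_apply, sub_zero] at h1
      exact_mod_cast h1.symm
  have h1 : sqNorm (mode n k) = M * ∑ j, k j ^ 2 := by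
    calc sqNorm (mode n k) = ∑ j, ∑ l, k j * k l * ∑ x, n j x * n l x := by
          simp only [sqNorm, mode, Finset.sum_apply, Pi.smul_apply, smul_eq_mul, sq,
            Finset.sum_mul_sum]
          rw [Finset.sum_comm]
          refine Finset.sum_congr rfl fun j _ => ?_
          rw [Finset.sum_comm]
          refine Finset.sum_congr rfl fun l _ => ?_
          rw [Finset.mul_sum]
          exact Finset.sum_congr rfl fun x _ => by ring
      _ = _ := by
          simp only [hdot, mul_ite, mul_zero, Finset.sum_ite_eq, Finset.mem_univ, if_true,
            Finset.mul_sum]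
          exact Finset.sum_congr rfl fun j _ => by ring
  have h2 : M * ∑ j, (k j ^ 2 - k j) = 0 := by
    have h3 := hk.1.2
    simp only [hn, ← Finset.sum_mul, hs, one_mul, h1] at h3
    rw [Finset.sum_sub_distrib, hs, mul_sub, ← h3]
    ring
  rw [mul_eq_zero, or_iff_right hM.ne',
    Finset.sum_eq_zero_iff_of_nonneg fun j _ => sq_sub_self_nonneg (k j)] at h2
  have h3 : ∀ j, k j = 0 ∨ k j = 1 := fun j => eq_zero_or_one_of_sq_sub (h2 j (Finset.mem_univ j))
  obtain ⟨j, hj⟩ : ∃ j, k j ≠ 0 := by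
    by_contra! h
    simp [h] at hs
  have hj1 : k j = 1 := (h3 j).resolve_left hj
  have h4 : ∑ i ∈ Finset.univ.erase j, k i = 0 := by
    have := Finset.add_sum_erase Finset.univ k (Finset.mem_univ j)
    lia
  rw [Finset.sum_eq_zero_iff_of_nonneg fun i _ => by rcases h3 i with h | h <;> simp [h]] at h4
  refine hk.2 ⟨j, funext fun i => ?_⟩
  by_cases hij : i = j
  · rw [hij, hj1]
    simp [stdVec]
  · rw [h4 i (Finset.mem_erase.2 ⟨hij, Finset.mem_univ i⟩)]
    simp [stdVec, hij]

end Orthogonal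

end Configurations

/-! ### Nondegenerate resonance matrices -/

section Nondegenerate

variable {b d : ℕ} {n : Fin b → Fin d → ℤ}

/-- Homogeneity moves all estimates from [ε, 2ε]^b to the fixed box [1, 2]^b. -/
theorem realResonanceMatrix_smul (n : Fin b → Fin d → ℤ) (ε : ℝ) (y : Fin b → ℝ) :
    realResonanceMatrix n (ε • y) = ε ^ 2 • realResonanceMatrix n y := by
  classical
  ext k k'
  have e : ∀ c : Prop, ∀ _ : Decidable c, ∀ i j, (if c then ε * y i * (ε * y j) else 0) =
      ε ^ 2 * if c then y i * y j else 0 := fun c _ i j => by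
    split_ifs
    · ring
    · ring
  rw [Matrix.smul_apply, realResonanceMatrix_apply, realResonanceMatrix_apply]
  simp only [Pi.smul_apply, smul_eq_mul, e, ← Finset.mul_sum]
  split_ifs with h
  · rw [Finset.mul_sum]
    exact Finset.sum_congr rfl fun j _ => by ring
  · ring

theorem continuous_realResonanceMatrix (n : Fin b → Fin d → ℤ) :
    Continuous (realResonanceMatrix n) := by
  refine continuous_pi fun k => continuous_pi fun k' => ?_
  simp only [realResonanceMatrix, Matrix.map_apply, MvPolynomial.aeval_def,
    MvPolynomial.eval₂_eq_eval_map]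
  exact MvPolynomial.continuous_eval _

/-- Where the determinant of the resonance matrix is not small, the inverse is bounded. -/
theorem exists_inverse_bound (n : Fin b → Fin d → ℤ) [Fintype (resonantModes₂ n)]
    [DecidableEq (resonantModes₂ n)] :
    ∃ K : ℝ, 0 < K ∧ ∀ ε : ℝ, 0 < ε → ∀ y ∈ Set.Icc (fun _ : Fin b => (1 : ℝ)) (fun _ => 2),
      ∀ μ : ℝ, 0 < μ → μ < |(realResonanceMatrix n y).det| →
        ∃ B : Matrix (resonantModes₂ n) (resonantModes₂ n) ℝ,
          realResonanceMatrix n (ε • y) * B = 1 ∧ ∀ k k', |B k k'| ≤ K / (μ * ε ^ 2) := by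
  have hadj : Continuous fun y => ∑ k, ∑ k', |(realResonanceMatrix n y).adjugate k k'| := by
    have h := (continuous_realResonanceMatrix n).matrix_adjugate
    exact continuous_finsetSum _ fun k _ => continuous_finsetSum _ fun k' _ =>
      (h.matrix_elem k k').abs
  obtain ⟨K, hK⟩ := (isCompact_Icc (a := fun _ : Fin b => (1 : ℝ))
    (b := fun _ => 2)).exists_bound_of_continuousOn hadj.continuousOn
  refine ⟨max K 1, lt_max_of_lt_right one_pos, fun ε hε y hy μ hμ hμd => ?_⟩
  have hdet : (realResonanceMatrix n y).det ≠ 0 := fun h => by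
    rw [h, abs_zero] at hμd
    linarith
  -- Cramer's rule; the adjugate is bounded on the compact box.
  refine ⟨(ε ^ 2 * (realResonanceMatrix n y).det)⁻¹ • (realResonanceMatrix n y).adjugate, ?_,
    fun k k' => ?_⟩
  · rw [realResonanceMatrix_smul, smul_mul_smul_comm, Matrix.mul_adjugate, smul_smul]
    convert one_smul ℝ _
    field_simp
  · have h1 : |(realResonanceMatrix n y).adjugate k k'| ≤ max K 1 := by
      refine le_trans ?_ (((le_abs_self _).trans (hK y hy)).trans (le_max_left _ _))
      exact (Finset.single_le_sum (f := fun k' => |(realResonanceMatrix n y).adjugate k k'|)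
        (fun _ _ => abs_nonneg _) (Finset.mem_univ k')).trans
        (Finset.single_le_sum (f := fun k => ∑ k', |(realResonanceMatrix n y).adjugate k k'|)
        (fun _ _ => Finset.sum_nonneg fun _ _ => abs_nonneg _) (Finset.mem_univ k))
    rw [Matrix.smul_apply, smul_eq_mul, abs_mul, abs_inv, abs_mul, abs_of_pos (by positivity),
      inv_mul_eq_div, mul_comm (ε ^ 2)]
    gcongr

variable [Fintype (resonantModes₂ n)] [DecidableEq (resonantModes₂ n)]

/-- ℤ embeds in ℝ, so the determinant remains a nonzero polynomial over ℝ and the sublevel estimate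
applies. -/
theorem exists_volume_resonanceDet_le (hn : Indep n) (hdet : resonanceDet n hn ≠ 0) :
    ∃ γ K : ℝ, 0 < γ ∧ 0 ≤ K ∧ ∀ μ : ℝ, 0 < μ → μ ≤ 1 →
      volume {y : Fin b → ℝ | y ∈ Set.Icc (fun _ => 1) (fun _ => 2) ∧
        |(realResonanceMatrix n y).det| ≤ μ} ≤ ENNReal.ofReal (K * μ ^ γ) := by
  have h1 : resonanceDet n hn = (resonanceMatrix n).det := by
    rw [resonanceDet]
    congr!
  have h2 : MvPolynomial.map (Int.castRingHom ℝ) (resonanceDet n hn) ≠ 0 := fun h =>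
    hdet (MvPolynomial.map_injective _ (RingHom.injective_int _) (h.trans (map_zero _).symm))
  obtain ⟨γ, K, hγ, hK, h⟩ := exists_volume_sublevel_le h2
  refine ⟨γ, K, hγ, hK, fun μ hμ hμ1 => ?_⟩
  convert h μ hμ hμ1 using 7 with y
  rw [h1, MvPolynomial.eval_map, ← MvPolynomial.coe_eval₂Hom]
  exact (AlgHom.map_det (MvPolynomial.aeval y) (resonanceMatrix n)).symm

end Nondegenerate

/-! ### Persistence off a small set of amplitudes. -/

theorem persists_of_resonanceDet_ne_zero {b d : ℕ} {n : Fin b → Fin d → ℤ} (hn : Indep n)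
    (hb : 1 ≤ b)
    (hp : ∀ i j l : Fin b, i ≠ j → i ≠ l → j ≠ l →
      inner ℝ (toEuclid (n i) - toEuclid (n j)) (toEuclid (n i) - toEuclid (n l)) ≠ 0)
    (hdet : resonanceDet n hn ≠ 0) :
    ∃ c : ℝ, 0 < c ∧ ∀ (ρ : ℝ) (α : ℕ → ℝ), AnalyticNearZero α →
      ∀ σ s : ℝ, 0 < σ → (b : ℝ) / 2 < s →
        ∃ C ε₀ : ℝ, 0 < C ∧ 0 < ε₀ ∧ ∀ ε : ℝ, 0 < ε → ε < ε₀ →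
          ∃ I : Set (Fin b → ℝ),
            I ⊆ Set.Icc (fun _ => ε) (fun _ => 2 * ε) ∧ MeasurableSet I ∧
            volume I < ENNReal.ofReal (ε ^ ((b : ℝ) + c)) ∧
            ∀ a ∈ Set.Icc (fun _ : Fin b => ε) (fun _ => 2 * ε) \ I,
              PersistsWithShift ρ α n (1 / 2) σ s C a := by
  classical
  let _ : Fintype (resonantModes₂ n) := (resonantModes₂_finite hn).fintype
  obtain ⟨γ, K, hγ, hK, hvol⟩ := exists_volume_resonanceDet_le hn hdet
  obtain ⟨N, hN, hinv⟩ := exists_inverse_bound n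
  -- γ depends only on n. Half of it is given up to absorb K', which depends on ρ, H, σ and s
  -- through δ.
  refine ⟨γ / 2, half_pos hγ, fun ρ α hα σ s hσ hs => ?_⟩
  obtain ⟨δ, C, ε₀, hδ, hC, hε₀, hper⟩ := exists_persistsWithShift hn hb
    (stdVec_add_sub_notMem_resonantModes₂ hn.injective hp) ρ hα hσ
    ((by positivity : (0 : ℝ) ≤ b / 2).trans hs.le)
  set K' : ℝ := K * (N / δ) ^ γ with hK'
  have hK'0 : 0 ≤ K' := by positivity
  set ε₁ : ℝ := (1 / (K' + 1)) ^ (2 / γ) with hε₁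
  have hε₁0 : 0 < ε₁ := by positivity
  refine ⟨C, min ε₀ (min (δ / N) ε₁), hC, by positivity, fun ε hε hεlt => ?_⟩
  have hlt0 : ε < ε₀ := hεlt.trans_le (min_le_left _ _)
  have hltN : ε < δ / N := hεlt.trans_le ((min_le_right _ _).trans (min_le_left _ _))
  have hlt1 : ε < ε₁ := hεlt.trans_le ((min_le_right _ _).trans (min_le_right _ _))
  -- Then N/(με²) = δ/ε³, the bound that the fixed point argument accepts.
  set μ : ℝ := N / δ * ε with hμ
  have hμ0 : 0 < μ := by positivity
  have hμ1 : μ ≤ 1 := by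
    rw [lt_div_iff₀ hN] at hltN
    rw [hμ, div_mul_eq_mul_div, div_le_one hδ]
    linarith
  set S : Set (Fin b → ℝ) := {y | y ∈ Set.Icc (fun _ => 1) (fun _ => 2) ∧
    |(realResonanceMatrix n y).det| ≤ μ} with hS
  have hSm : MeasurableSet S := measurableSet_Icc.inter
    (measurableSet_le ((continuous_realResonanceMatrix n).matrix_det.abs.measurable)
      measurable_const)
  have hbox : ∀ y : Fin b → ℝ, y ∈ Set.Icc (fun _ : Fin b => (1 : ℝ)) (fun _ => 2) ↔
      ε • y ∈ Set.Icc (fun _ : Fin b => ε) (fun _ => 2 * ε) := fun y => by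
    simp only [Set.mem_Icc, Pi.le_def, Pi.smul_apply, smul_eq_mul, mul_comm 2 ε]
    simp only [le_mul_iff_one_le_right hε, mul_le_mul_iff_right₀ hε]
  refine ⟨(fun y => ε • y) '' S, ?_, ?_, ?_, ?_⟩
  · rintro _ ⟨y, hy, rfl⟩
    exact (hbox y).1 hy.1
  · exact hSm.const_smul₀ ε
  -- Scaling contributes ε^b, and K'ε^γ < ε^{γ/2} for ε < ε₁.
  · have h1 : volume ((fun y => ε • y) '' S) = ENNReal.ofReal (ε ^ b) * volume S := by
      have := Measure.addHaar_smul (volume : Measure (Fin b → ℝ)) ε S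
      rw [Module.finrank_fin_fun, abs_of_pos (by positivity)] at this
      exact this
    have h2 : K * μ ^ γ = K' * ε ^ γ := by
      rw [hμ, Real.mul_rpow (by positivity) hε.le, hK']
      ring
    have h3 : ε ^ (γ / 2) < 1 / (K' + 1) := by
      have := Real.rpow_lt_rpow hε.le hlt1 (half_pos hγ)
      rwa [hε₁, ← Real.rpow_mul (by positivity), show 2 / γ * (γ / 2) = 1 by field_simp,
        Real.rpow_one] at this
    have h4 : K' * ε ^ γ < ε ^ (γ / 2) := by
      have h5 : ε ^ γ = ε ^ (γ / 2) * ε ^ (γ / 2) := by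
        rw [← Real.rpow_add hε]
        congr 1
        ring
      have h6 : 0 < ε ^ (γ / 2) := Real.rpow_pos_of_pos hε _
      rw [lt_div_iff₀ (by positivity)] at h3
      rw [h5]
      nlinarith
    rw [h1, Real.rpow_add hε, Real.rpow_natCast, ENNReal.ofReal_mul (by positivity)]
    refine (ENNReal.mul_lt_mul_iff_right (by simpa using pow_pos hε b) ENNReal.ofReal_ne_top).2 ?_
    refine (hvol μ hμ0 hμ1).trans_lt ?_
    rw [h2]
    exact (ENNReal.ofReal_lt_ofReal_iff (Real.rpow_pos_of_pos hε _)).2 h4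
  · rintro a ⟨ha, haI⟩
    set y : Fin b → ℝ := ε⁻¹ • a with hy
    have hya : ε • y = a := smul_inv_smul₀ hε.ne' a
    have hybox : y ∈ Set.Icc (fun _ : Fin b => (1 : ℝ)) (fun _ => 2) := by
      rw [hbox, hya]
      exact ha
    have hyd : μ < |(realResonanceMatrix n y).det| := by
      by_contra h
      exact haI ⟨y, ⟨hybox, not_lt.1 h⟩, hya⟩
    obtain ⟨B, hB, hBle⟩ := hinv ε hε y hybox μ hμ0 hyd
    rw [hya] at hB
    refine hper ε hε hlt0 a ha B hB fun k k' => (hBle k k').trans_eq ?_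
    rw [hμ]
    field_simp

end

end QuasiNLS

theorem theorem1p4 :
    ∃ κ : ℝ, 0 < κ ∧
    -- no nontrivial resonant modes
    (∀ (b d : ℕ) (n : Fin b → Fin d → ℤ), 1 ≤ b → QuasiNLS.Indep n →
      QuasiNLS.resonantModes₂ n = ∅ →
      ∀ ρ : ℝ, QuasiNLS.PersistsOnBoxes ρ n κ) ∧
    -- (i) periodic solutions
    (∀ (d : ℕ) (m : Fin d → ℤ), 1 ≤ d →
      ∀ (ρ : ℝ) (α : ℕ → ℝ), QuasiNLS.AnalyticNearZero α →
      ∀ σ s : ℝ, 0 < σ → 1 / 2 < s →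
        ∃ C δ : ℝ, 0 < C ∧ 0 < δ ∧ ∀ a : ℝ, a ≠ 0 → |a| < δ →
          ∃ ω : ℝ,
            QuasiNLS.Persists ρ α (fun _ : Fin 1 => m) κ σ s C (fun _ => a) (fun _ => ω) ∧
            |ω - ((QuasiNLS.sqNorm m : ℝ) + ρ - 2 * a ^ 2 * (QuasiNLS.sqNorm m : ℝ))|
              ≤ C * |a| ^ 3) ∧
    -- (ii) two nonparallel modes
    (∀ (d : ℕ) (n : Fin 2 → Fin d → ℤ), QuasiNLS.Indep n →
      ∀ ρ : ℝ, QuasiNLS.PersistsOnBoxes ρ n κ) ∧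
    -- (iii) three modes that form an acute triangle
    (∀ (d : ℕ) (n : Fin 3 → Fin d → ℤ), QuasiNLS.Indep n →
      (∀ i j l : Fin 3, i ≠ j → i ≠ l → j ≠ l →
        InnerProductGeometry.angle
          (QuasiNLS.toEuclid (n i) - QuasiNLS.toEuclid (n j))
          (QuasiNLS.toEuclid (n i) - QuasiNLS.toEuclid (n l)) < Real.pi / 2) →
      ∀ ρ : ℝ, QuasiNLS.PersistsOnBoxes ρ n κ) ∧
    -- (iv) orthogonal modes of equal length
    (∀ (b d : ℕ) (n : Fin b → Fin d → ℤ) (M : ℤ), 1 ≤ b → 0 < M →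
      (∀ j, QuasiNLS.sqNorm (n j) = M) →
      (∀ j l, j ≠ l → inner ℝ (QuasiNLS.toEuclid (n j)) (QuasiNLS.toEuclid (n l)) = 0) →
      ∀ ρ : ℝ, QuasiNLS.PersistsOnBoxes ρ n κ) ∧
    -- nontrivial resonant modes
    (∀ (b d : ℕ) (n : Fin b → Fin d → ℤ) (hn : QuasiNLS.Indep n), 1 ≤ b →
      (∀ i j l : Fin b, i ≠ j → i ≠ l → j ≠ l →
        inner ℝ (QuasiNLS.toEuclid (n i) - QuasiNLS.toEuclid (n j))
          (QuasiNLS.toEuclid (n i) - QuasiNLS.toEuclid (n l)) ≠ 0) →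
      QuasiNLS.resonanceDet n hn ≠ 0 →
      ∃ c : ℝ, 0 < c ∧ ∀ (ρ : ℝ) (α : ℕ → ℝ), QuasiNLS.AnalyticNearZero α →
        ∀ σ s : ℝ, 0 < σ → (b : ℝ) / 2 < s →
          ∃ C ε₀ : ℝ, 0 < C ∧ 0 < ε₀ ∧ ∀ ε : ℝ, 0 < ε → ε < ε₀ →
            ∃ I : Set (Fin b → ℝ),
              I ⊆ Set.Icc (fun _ => ε) (fun _ => 2 * ε) ∧ MeasurableSet I ∧
              MeasureTheory.volume I < ENNReal.ofReal (ε ^ ((b : ℝ) + c)) ∧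
              ∀ a ∈ Set.Icc (fun _ : Fin b => ε) (fun _ => 2 * ε) \ I,
                QuasiNLS.PersistsWithShift ρ α n κ σ s C a) := by
  refine ⟨1 / 2, by norm_num, fun b d n hb hn hK ρ =>
    QuasiNLS.persistsOnBoxes_of_resonantModes₂_eq_empty hn hb hK ρ, ?_, fun d n hn ρ =>
    QuasiNLS.persistsOnBoxes_of_resonantModes₂_eq_empty hn one_le_two
      (QuasiNLS.resonantModes₂_eq_empty_of_two hn.injective) ρ, fun d n hn hacute ρ =>
    QuasiNLS.persistsOnBoxes_of_resonantModes₂_eq_empty hn (by norm_num)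
      (QuasiNLS.resonantModes₂_eq_empty_of_acute hacute) ρ, fun b d n M hb hM hn ho ρ =>
    QuasiNLS.persistsOnBoxes_of_resonantModes₂_eq_empty (QuasiNLS.indep_of_orthogonal hM hn ho) hb
      (QuasiNLS.resonantModes₂_eq_empty_of_orthogonal hM hn ho) ρ, fun b d n hn hb hp hdet =>
    QuasiNLS.persists_of_resonanceDet_ne_zero hn hb hp hdet⟩
  intro d m _ ρ α hα σ s hσ hs
  exact QuasiNLS.persists_periodic m (1 / 2) ρ hα hσ ((by norm_num : (0 : ℝ) ≤ 1 / 2).trans hs.le)
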